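/- **Notation.** Let $v$ be an indeterminate, $\mathcal Z=\mathbb Z[v,v^{-1}]\subset\mathbb Q(v)$, and let $\bar{\ }$ be the ring homomorphism with $\bar v=v^{-1}$. For $i\in\mathbb Z$ put $[i]=\frac{v^i-v^{-i}}{v-v^{-1}}$, $[\![i]\!]=\frac{v^{2i}-1}{v^2-1}$; for $N\in\mathbb Z$, $t\in\mathbb N$ put $\left[{N\atop t}\right]=\frac{[N][N-1]\cdots[N-t+1]}{[t]^!}$ and $\left[\!\!\left[{N\atop t}\right]\!\!\right]=\frac{[\![N]\!]\cdots[\![N-t+1]\!]}{[\![t]\!]^!}$, where $[t]^!=[1]\cdots[t]$, $[\![t]\!]^!=[\![1]\!]\cdots[\![t]\!]$; for $a+b+c=N$ in $\mathbb N$ put $\left[{N\atop a,b,c}\right]=\frac{[N]^!}{[a]^![b]^![c]^!}$; for $\mu\in\mathbb Z^n$, $\lambda\in\mathbb N^n$ put $\left[{\mu\atop\lambda}\right]=\prod_i\left[{\mu_i\atop\lambda_i}\right]$. Let $\Lambda(n,r)$ be the set of $\lambda\in\mathbb N^n$ with $\sum_i\lambda_i=r$ (empty if $r<0$). Let $\boldsymbol{\mathcal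 H}(r)$ be the Hecke algebra of $\mathfrak S_r$ over $\mathbb Q(v)$, generated by $T_1,\dots,T_{r-1}$ with relations $(T_i+1)(T_i-v^2)=0$, $T_iT_{i+1}T_i=T_{i+1}T_iT_{i+1}$, and $T_iT_j=T_jT_i$ for $|i-j|>1$; $T_w$ is the product of the $T_i$ along a reduced expression of $w$. For $\lambda\in\Lambda(n,r)$ let $R^\lambda_1,\dots,R^\lambda_n$ be the consecutive blocks of $\{1,\dots,r\}$ of sizes $\lambda_1,\dots,\lambda_n$, $\mathfrak S_\lambda$ the Young subgroup preserving them, and $x_\lambda=\sum_{w\in\mathfrak S_\lambda}T_w$. The $q$-Schur algebra is $\boldsymbol{\mathcal S}(n,r)=\operatorname{End}_{\boldsymbol{\mathcal H}(r)}\big(\bigoplus_{\lambda\in\Lambda(n,r)}x_\lambda\boldsymbol{\mathcal H}(r)\big)$ (right modules). For $\lambda,\mu\in\Lambda(n,r)$ and $d$ of minimal length in $\mathfrak S_\lambda d\mathfrak S_\mu$ let $\phi^d_{\lambda\mu}(x_\nu h)=\delta_{\mu,\nu}\sum_{x\in\mathfrak S_\lambda d\mathfrak S_\mu}T_xh\in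 x_\lambda\boldsymbol{\mathcal H}(r)$. Every $n\times n$ matrix $A$ over $\mathbb N$ with entry sum $r$ is $(|R^\lambda_k\cap dR^\mu_l|)_{k,l}$ for a unique such $(\lambda,d,\mu)$, and one puts $[A]=v^{-d_A}\phi^d_{\lambda\mu}$, $d_A=\sum_{i\ge k,\,j<l}a_{i,j}a_{k,l}$. For $A\in M_n(\mathbb Z)$ with zero diagonal and non-negative entries, with entry sum $\sigma(A)$, and for $\delta\in\mathbb Z^n$, $\lambda\in\mathbb N^n$, let $$A(\delta,\lambda)=\Big(\sum_{\mu\in\Lambda(n,r-\sigma(A))}v^{\sum_i\mu_i\delta_i}\left[{\mu\atop\lambda}\right][A+\operatorname{diag}(\mu)]\Big)_{r\ge0}\in\prod_{r\ge0}\boldsymbol{\mathcal S}(n,r),\qquad A(\delta)=A(\delta,\mathbf 0),$$ and let $A(\delta,\lambda)=0$ if some off-diagonal entry of $A$ is negative. Let $E_{i,j}$ be the matrix units and $\boldsymbol e_i$ the standard unit vectors. **Lemma.** Let $A$ be an $n\times n$ matrix over $\mathbb N$ with zero diagonal, $\delta\in\mathbb Z^n$, $\lambda\in\mathbb N^n$,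 $m\in\mathbb N$ and $1\le h\le n-1$. (1) For $\mathbf t\in\Lambda(n,m)$, $0\le j\le\lambda_h$, $0\le k\le\lambda_{h+1}$ and $0\le c\le\min\{t_h,j\}$ set $$\alpha^{\mathbf t}_{j,c,k}=\Big(\sum_{u<h}t_u+\lambda_h-j-c\Big)\boldsymbol e_h+\Big(\lambda_{h+1}-k-\sum_{u<h+1}t_u\Big)\boldsymbol e_{h+1},$$ $$\beta^{\mathbf t}_{j,c,k}=(t_h+j-c-\lambda_h)\boldsymbol e_h+(k-\lambda_{h+1})\boldsymbol e_{h+1},$$ $$f^{\mathbf t}_{j,c,k}=v^{g^{\mathbf t}_{j,k}}\prod_{u\ne h}\overline{\left[\!\!\left[{a_{h,u}+t_u\atop t_u}\right]\!\!\right]}\left[{-t_h\atop\lambda_h-j}\right]\left[{t_h+j-c\atop c,\,t_h-c,\,j-c}\right]\left[{t_{h+1}\atop\lambda_{h+1}-k}\right],$$ $$g^{\mathbf t}_{j,k}=\sum_{i\ge u,\,i\ne h}a_{h,i}t_u-\sum_{i>u,\,i\ne h+1}a_{h+1,i}t_u+\sum_{u<u',\,u'\ne h,h+1}t_ut_{u'}-t_h\delta_h+t_{h+1}\delta_{h+1}+2jt_h-kt_{h+1}.$$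 Then all $f^{\mathbf t}_{j,c,k}$ lie in $\mathcal Z$, and $$(mE_{h,h+1})(\mathbf 0)\,A(\delta,\lambda)=\sum_{\mathbf t,j,k,c}f^{\mathbf t}_{j,c,k}\Big(A+\sum_{u\ne h}t_uE_{h,u}-\sum_{u\ne h+1}t_uE_{h+1,u}\Big)(\delta+\alpha^{\mathbf t}_{j,c,k},\lambda+\beta^{\mathbf t}_{j,c,k}),$$ the sum being over all $\mathbf t,j,k,c$ as above. (2) For $\mathbf t\in\Lambda(n,m)$, $0\le j\le\lambda_{h+1}$, $0\le k\le\lambda_h$ and $0\le c\le\min\{t_{h+1},j\}$ set $$\widetilde\alpha^{\mathbf t}_{j,c,k}=\Big(\sum_{u>h+1}t_u+\lambda_{h+1}-j-c\Big)\boldsymbol e_{h+1}+\Big(\lambda_h-k-\sum_{u>h}t_u\Big)\boldsymbol e_h,$$ $$\widetilde\beta^{\mathbf t}_{j,c,k}=(t_{h+1}+j-c-\lambda_{h+1})\boldsymbol e_{h+1}+(k-\lambda_h)\boldsymbol e_h,$$ $$\widetilde f^{\mathbf t}_{j,c,k}=v^{\widetilde g^{\mathbf t}_{j,k}}\prod_{u\ne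 h+1}\overline{\left[\!\!\left[{a_{h+1,u}+t_u\atop t_u}\right]\!\!\right]}\left[{-t_{h+1}\atop\lambda_{h+1}-j}\right]\left[{t_{h+1}+j-c\atop c,\,t_{h+1}-c,\,j-c}\right]\left[{t_h\atop\lambda_h-k}\right],$$ $$\widetilde g^{\mathbf t}_{j,k}=\sum_{i\le u,\,i\ne h+1}a_{h+1,i}t_u-\sum_{i<u,\,i\ne h}a_{h,i}t_u+\sum_{u<u',\,u\ne h,h+1}t_ut_{u'}+t_h\delta_h-t_{h+1}\delta_{h+1}+2jt_{h+1}-kt_h.$$ Then all $\widetilde f^{\mathbf t}_{j,c,k}$ lie in $\mathcal Z$, and $$(mE_{h+1,h})(\mathbf 0)\,A(\delta,\lambda)=\sum_{\mathbf t,j,k,c}\widetilde f^{\mathbf t}_{j,c,k}\Big(A-\sum_{u\ne h}t_uE_{h,u}+\sum_{u\ne h+1}t_uE_{h+1,u}\Big)(\delta+\widetilde\alpha^{\mathbf t}_{j,c,k},\lambda+\widetilde\beta^{\mathbf t}_{j,c,k}).$$ -/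

import Mathlib

open scoped BigOperators Pointwise DirectSum

noncomputable section

namespace QSchur

/-! ### The ground field and Gaussian binomial coefficients -/

/-- The field of rational functions in one indeterminate `v` over the rationals. -/
abbrev K : Type := RatFunc ℚ

/-- The indeterminate. -/
def v : K := RatFunc.X

/-- The ring of integral Laurent polynomials in `v`, inside its fraction field. -/
def laurent : Subring K := Subring.closure {v, v⁻¹}

theorem X_inv_transcendental : Transcendental ℚ ((RatFunc.X : K)⁻¹) := by
  intro h
  have h2 : IsAlgebraic ℚ (RatFunc.X : K) := by simpa using h.inv
  refine RatFunc.transcendental_X (K := ℚ) ?_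
  convert h2
  exact Subsingleton.elim _ _

theorem nonZeroDivisors_le_comap :
    nonZeroDivisors (Polynomial ℚ) ≤ (nonZeroDivisors K).comap
      ((Polynomial.aeval (R := ℚ) ((RatFunc.X : K)⁻¹)).toRingHom) := by
  apply nonZeroDivisors_le_comap_nonZeroDivisors_of_injective
  exact transcendental_iff_injective.mp X_inv_transcendental

/-- The bar involution: the ring homomorphism with `v ↦ v⁻¹` (and fixing the constants). -/
def bar : K →+* K :=
  RatFunc.liftRingHom ((Polynomial.aeval (R := ℚ) ((RatFunc.X : K)⁻¹)).toRingHom)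
    nonZeroDivisors_le_comap

theorem bar_v : bar v = v⁻¹ := by
  simp [bar, v, RatFunc.liftRingHom_apply]

/-- `[i] = (v^i - v^{-i}) / (v - v^{-1})`. -/
def qInt (i : ℤ) : K := (v ^ i - v ^ (-i)) / (v - v⁻¹)

/-- `⟦i⟧ = (v^{2i} - 1) / (v^2 - 1)`. -/
def qqInt (i : ℤ) : K := (v ^ (2 * i) - 1) / (v ^ 2 - 1)

/-- `[t]! = [1][2]⋯[t]`. -/
def qFact (t : ℕ) : K := ∏ s ∈ Finset.range t, qInt ((s : ℤ) + 1)

/-- `⟦t⟧! = ⟦1⟧⟦2⟧⋯⟦t⟧`. -/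
def qqFact (t : ℕ) : K := ∏ s ∈ Finset.range t, qqInt ((s : ℤ) + 1)

/-- `[N, t] = [N][N-1]⋯[N-t+1] / [t]!`, for every integer `N`. -/
def qBinom (N : ℤ) (t : ℕ) : K := (∏ s ∈ Finset.range t, qInt (N - s)) / qFact t

/-- `⟦N, t⟧ = ⟦N⟧⟦N-1⟧⋯⟦N-t+1⟧ / ⟦t⟧!`, for every integer `N`. -/
def qqBinom (N : ℤ) (t : ℕ) : K := (∏ s ∈ Finset.range t, qqInt (N - s)) / qqFact t

/-- `[N; a, b, c] = [N]! / ([a]! [b]! [c]!)`; used only for `N = a + b + c`. -/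
def qTrinom (N a b c : ℕ) : K := qFact N / (qFact a * qFact b * qFact c)

/-- `[μ, l] = ∏ i, [μ i, l i]`. -/
def qBinomVec {n : ℕ} (μ : Fin n → ℤ) (l : Fin n → ℕ) : K := ∏ i, qBinom (μ i) (l i)

/-! ### The Hecke algebra of the symmetric group -/

/-- The `i`-th simple transposition of the `r` letters (numbered from `0`). -/
def simpleRefl (r : ℕ) (i : Fin (r - 1)) : Equiv.Perm (Fin r) :=
  Equiv.swap ⟨i, by omega⟩ ⟨i + 1, by omega⟩

/-- The product of simple transpositions along a word. -/
def wordProd (r : ℕ) (L : List (Fin (r - 1))) : Equiv.Perm (Fin r) :=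
  (L.map (simpleRefl r)).prod

/-- A reduced expression of `w`: a word for `w` of minimal length. -/
def IsReducedWord (r : ℕ) (w : Equiv.Perm (Fin r)) (L : List (Fin (r - 1))) : Prop :=
  wordProd r L = w ∧ ∀ L' : List (Fin (r - 1)), wordProd r L' = w → L.length ≤ L'.length

theorem exists_wordProd (r : ℕ) (w : Equiv.Perm (Fin r)) : ∃ L, wordProd r L = w := by
  rcases r with _ | r
  · exact ⟨[], Subsingleton.elim _ _⟩
  · have hw : w ∈ Submonoid.closure
        (Set.range fun i : Fin r => Equiv.swap i.castSucc i.succ) := by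
      rw [Equiv.Perm.mclosure_swap_castSucc_succ]; trivial
    induction hw using Submonoid.closure_induction with
    | mem x hx =>
      obtain ⟨i, rfl⟩ := hx
      exact ⟨[i], by simp [wordProd, simpleRefl, Fin.castSucc, Fin.succ, Fin.castAdd,
        Fin.castLE]⟩
    | one => exact ⟨[], rfl⟩
    | mul x y _ _ hx hy =>
      obtain ⟨L, rfl⟩ := hx
      obtain ⟨L', rfl⟩ := hy
      exact ⟨L ++ L', by simp [wordProd]⟩

theorem exists_isReducedWord (r : ℕ) (w : Equiv.Perm (Fin r)) : ∃ L, IsReducedWord r w L := by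
  classical
  have h : ∃ m, ∃ L, wordProd r L = w ∧ L.length = m := by
    obtain ⟨L, hL⟩ := exists_wordProd r w
    exact ⟨_, L, hL, rfl⟩
  obtain ⟨L, hL, hm⟩ := Nat.find_spec h
  exact ⟨L, hL, fun L' hL' => hm ▸ Nat.find_min' h ⟨L', hL', rfl⟩⟩

/-- A reduced expression of `w`. -/
def reducedWord (r : ℕ) (w : Equiv.Perm (Fin r)) : List (Fin (r - 1)) :=
  (exists_isReducedWord r w).choose

/-- The length of a permutation. -/
def len (r : ℕ) (w : Equiv.Perm (Fin r)) : ℕ := (reducedWord r w).length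

/-- The defining relations of the Hecke algebra, with `q = v²`. -/
inductive HeckeRel (r : ℕ) :
    FreeAlgebra K (Fin (r - 1)) → FreeAlgebra K (Fin (r - 1)) → Prop
  | quad (i : Fin (r - 1)) :
      HeckeRel r ((FreeAlgebra.ι K i + 1) * (FreeAlgebra.ι K i - algebraMap K _ (v ^ 2))) 0
  | braid (i j : Fin (r - 1)) (h : (j : ℕ) = i + 1) :
      HeckeRel r (FreeAlgebra.ι K i * FreeAlgebra.ι K j * FreeAlgebra.ι K i)
        (FreeAlgebra.ι K j * FreeAlgebra.ι K i * FreeAlgebra.ι K j)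
  | comm (i j : Fin (r - 1)) (h : (i : ℕ) + 1 < j ∨ (j : ℕ) + 1 < i) :
      HeckeRel r (FreeAlgebra.ι K i * FreeAlgebra.ι K j)
        (FreeAlgebra.ι K j * FreeAlgebra.ι K i)

/-- The Hecke algebra of the symmetric group on `r` letters over the field of rational
functions, by generators and relations. -/
abbrev Hecke (r : ℕ) : Type := RingQuot (HeckeRel r)

/-- The generator `T_i`. -/
def heckeGen (r : ℕ) (i : Fin (r - 1)) : Hecke r :=
  RingQuot.mkAlgHom K (HeckeRel r) (FreeAlgebra.ι K i)

/-- `T_w`, the product of the generators along a reduced expression of `w`. -/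
def heckeT (r : ℕ) (w : Equiv.Perm (Fin r)) : Hecke r :=
  ((reducedWord r w).map (heckeGen r)).prod

/-! ### The q-Schur algebra -/

/-- Compositions of `r` into `n` parts (zero parts are allowed). -/
abbrev Comp (n r : ℕ) : Type := {l : Fin n → ℕ // ∑ i, l i = r}

/-- The `i`-th block of consecutive letters (numbered from `0`) belonging to `l`. -/
def block {n r : ℕ} (l : Comp n r) (i : Fin n) : Set (Fin r) :=
  {p | (∑ t with t < i, l.1 t) ≤ (p : ℕ) ∧
    (p : ℕ) < (∑ t with t < i, l.1 t) + l.1 i}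

/-- The Young subgroup of `l`: the permutations that preserve every block. -/
def young {n r : ℕ} (l : Comp n r) : Subgroup (Equiv.Perm (Fin r)) :=
  ⨅ i, MulAction.stabilizer (Equiv.Perm (Fin r)) (block l i)

open Classical in
/-- The sum of the `T_w` over a set of permutations. -/
def heckeSum {r : ℕ} (D : Set (Equiv.Perm (Fin r))) : Hecke r :=
  ∑ w with w ∈ D, heckeT r w

/-- `x_l`, the sum of the `T_w` over the Young subgroup of `l`. -/
def xElt {n r : ℕ} (l : Comp n r) : Hecke r := heckeSum (young l : Set (Equiv.Perm (Fin r)))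

/-- The right ideal `x_l H`. -/
def xIdeal {n r : ℕ} (l : Comp n r) : Submodule (Hecke r)ᵐᵒᵖ (Hecke r) :=
  Submodule.span (Hecke r)ᵐᵒᵖ {xElt l}

theorem xElt_mul_mem {n r : ℕ} (l : Comp n r) (x : Hecke r) : xElt l * x ∈ xIdeal l :=
  Submodule.smul_mem _ (MulOpposite.op x) (Submodule.mem_span_singleton_self _)

/-- The right Hecke module `⨁ x_l H`, over all compositions `l` of `r` into `n` parts. -/
abbrev TensorMod (n r : ℕ) : Type := ⨁ l : Comp n r, xIdeal l

/-- The q-Schur algebra over the field of rational functions; the product is composition. -/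
abbrev QSchurAlg (n r : ℕ) : Type := Module.End (Hecke r)ᵐᵒᵖ (TensorMod n r)

/-- The double coset of `d` with respect to two Young subgroups. -/
def dcoset {n r : ℕ} (l : Comp n r) (d : Equiv.Perm (Fin r)) (m : Comp n r) :
    Set (Equiv.Perm (Fin r)) :=
  DoubleCoset.doubleCoset d (young l : Set (Equiv.Perm (Fin r))) (young m)

/-- `d` is the distinguished representative of its double coset: it has minimal length. -/
def IsDistinguished {n r : ℕ} (l : Comp n r) (d : Equiv.Perm (Fin r)) (m : Comp n r) : Prop :=
  ∀ w ∈ dcoset l d m, len r d ≤ len r w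

/-- The property that determines the endomorphism `φ` of `(l, d, m)`: it sends `x_ν h` to `0`
for `ν ≠ m`, and `x_m h` to the element `(∑ T_w) h` of the summand `x_l H`, the sum being over
the double coset of `d`. -/
def IsPhi {n r : ℕ} (l : Comp n r) (d : Equiv.Perm (Fin r)) (m : Comp n r)
    (f : QSchurAlg n r) : Prop :=
  ∀ (ν : Comp n r) (x : Hecke r) (κ : Comp n r),
    ((f (DirectSum.of (fun l : Comp n r => xIdeal l) ν ⟨xElt ν * x, xElt_mul_mem ν x⟩) κ :
      xIdeal κ) : Hecke r) = if ν = m ∧ κ = l then heckeSum (dcoset l d m) * x else 0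

/-- An endomorphism is determined by the property above. -/
theorem IsPhi.unique {n r : ℕ} {l m : Comp n r} {d : Equiv.Perm (Fin r)} {f g : QSchurAlg n r}
    (hf : IsPhi l d m f) (hg : IsPhi l d m g) : f = g := by
  apply DirectSum.linearMap_ext
  intro ν
  ext ⟨y, hy⟩ κ
  obtain ⟨x, rfl⟩ := Submodule.mem_span_singleton.mp hy
  exact (hf ν x.unop κ).trans (hg ν x.unop κ).symm

open Classical in
/-- The endomorphism `φ` of `(l, d, m)`. Exactly one endomorphism has the property above, so
the value `0` of the other branch is never taken. -/
def phi {n r : ℕ} (l : Comp n r) (d : Equiv.Perm (Fin r)) (m : Comp n r) : QSchurAlg n r :=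
  if h : ∃ f, IsPhi l d m f then h.choose else 0

/-- The matrix of `(l, d, m)`: its `(i, j)` entry is the number of letters in the intersection
of the `i`-th block of `l` with the image under `d` of the `j`-th block of `m`. -/
def jmath {n r : ℕ} (l : Comp n r) (d : Equiv.Perm (Fin r)) (m : Comp n r) :
    Matrix (Fin n) (Fin n) ℤ :=
  Matrix.of fun i j => ((block l i ∩ d '' block m j).ncard : ℤ)

/-- `d_A`, the sum of `a_{ij} a_{kl}` over `i ≥ k` and `j < l`. -/
def dStat {n : ℕ} (A : Matrix (Fin n) (Fin n) ℤ) : ℤ :=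
  ∑ i, ∑ j, ∑ k, ∑ l, if k ≤ i ∧ j < l then A i j * A k l else 0

open Classical in
/-- The normalized basis element `[A]` of the q-Schur algebra, for a matrix `A` with entries in
the natural numbers and with entry sum `r`; such an `A` is the matrix of exactly one `(l, d, m)`
with `d` distinguished. For all other integer matrices `A` no such triple exists, and `[A] = 0`. -/
def basisElt {n : ℕ} (r : ℕ) (A : Matrix (Fin n) (Fin n) ℤ) : QSchurAlg n r :=
  if h : ∃ p : Comp n r × Equiv.Perm (Fin r) × Comp n r,
      IsDistinguished p.1 p.2.1 p.2.2 ∧ jmath p.1 p.2.1 p.2.2 = A then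
    v ^ (-dStat A) • phi h.choose.1 h.choose.2.1 h.choose.2.2
  else 0

/-! ### The elements `A(δ, l)` -/

/-- `Λ(n, N)`: the `n`-tuples of natural numbers with sum `N`; empty for negative `N`. -/
def Lam (n : ℕ) (N : ℤ) : Finset (Fin n → ℕ) :=
  if 0 ≤ N then Finset.piAntidiag Finset.univ N.toNat else ∅

theorem mem_Lam {n : ℕ} {N : ℤ} {μ : Fin n → ℕ} : μ ∈ Lam n N ↔ ∑ i, (μ i : ℤ) = N := by
  unfold Lam
  rw [← Nat.cast_sum]
  split_ifs with h
  · obtain ⟨m, rfl⟩ := Int.eq_ofNat_of_zero_le h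
    simp only [Finset.mem_piAntidiag, Finset.mem_univ, implies_true, and_true,
      Int.toNat_natCast, Nat.cast_inj]
  · simp only [Finset.notMem_empty, false_iff]
    omega

/-- The diagonal matrix of a tuple of natural numbers. -/
def diag {n : ℕ} (μ : Fin n → ℕ) : Matrix (Fin n) (Fin n) ℤ :=
  Matrix.diagonal fun i => (μ i : ℤ)

open Classical in
/-- `A(δ, l, r)`, for an integer matrix `A` with zero diagonal: the sum over `μ` in
`Λ(n, r - σ(A))` of `v^(μ·δ) [μ, l] [A + diag μ]`, where `σ(A)` is the sum of the entries of `A`,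
and `0` by convention if some off-diagonal entry of `A` is negative. -/
def eltAt {n : ℕ} (A : Matrix (Fin n) (Fin n) ℤ) (δ : Fin n → ℤ) (l : Fin n → ℕ) (r : ℕ) :
    QSchurAlg n r :=
  if ∃ i j, i ≠ j ∧ A i j < 0 then 0
  else ∑ μ ∈ Lam n ((r : ℤ) - ∑ i, ∑ j, A i j),
    (v ^ (∑ i, (μ i : ℤ) * δ i) * qBinomVec (fun i => (μ i : ℤ)) l) • basisElt r (A + diag μ)

/-- `A(δ, l)`, the family of all `A(δ, l, r)`, in the product of all q-Schur algebras. -/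
def elt {n : ℕ} (A : Matrix (Fin n) (Fin n) ℤ) (δ : Fin n → ℤ) (l : Fin n → ℕ) :
    ∀ r : ℕ, QSchurAlg n r :=
  fun r => eltAt A δ l r

/-- `A(δ)`, the family of all sums of `v^(μ·δ) [A + diag μ]` over `μ` in `Λ(n, r - σ(A))`, for an
integer matrix `A` with zero diagonal and natural entries. -/
def elt₁ {n : ℕ} (A : Matrix (Fin n) (Fin n) ℤ) (δ : Fin n → ℤ) : ∀ r : ℕ, QSchurAlg n r :=
  fun r => ∑ μ ∈ Lam n ((r : ℤ) - ∑ i, ∑ j, A i j),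
    v ^ (∑ i, (μ i : ℤ) * δ i) • basisElt r (A + diag μ)

/-! ### The data of the two multiplication formulas

Throughout, `h'` is the index that follows `h`. -/

section Data

variable {n : ℕ}

/-- `l + b`, used only where it has natural entries. -/
def shift (l : Fin n → ℕ) (b : Fin n → ℤ) : Fin n → ℕ := fun i => ((l i : ℤ) + b i).toNat

/-- The matrix `A + ∑_{u ≠ h} t_u E_{h,u} - ∑_{u ≠ h'} t_u E_{h',u}`. -/
def matUp (A : Matrix (Fin n) (Fin n) ℕ) (h h' : Fin n) (t : Fin n → ℕ) :
    Matrix (Fin n) (Fin n) ℤ :=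
  A.map (fun a => (a : ℤ)) + ∑ u with u ≠ h, Matrix.single h u (t u : ℤ)
    - ∑ u with u ≠ h', Matrix.single h' u (t u : ℤ)

/-- The shift `α` of `δ` in the first formula. -/
def alphaUp (l : Fin n → ℕ) (h h' : Fin n) (t : Fin n → ℕ) (j c k : ℕ) : Fin n → ℤ :=
  Pi.single h ((∑ u with u < h, (t u : ℤ)) + l h - j - c)
    + Pi.single h' ((l h' : ℤ) - k - ∑ u with u < h', (t u : ℤ))

/-- The shift `β` of `l` in the first formula. -/
def betaUp (l : Fin n → ℕ) (h h' : Fin n) (t : Fin n → ℕ) (j c k : ℕ) : Fin n → ℤ :=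
  Pi.single h ((t h : ℤ) + j - c - l h) + Pi.single h' ((k : ℤ) - l h')

/-- The exponent `g` of `v` in the first formula. -/
def gUp (A : Matrix (Fin n) (Fin n) ℕ) (δ : Fin n → ℤ) (h h' : Fin n) (t : Fin n → ℕ)
    (j k : ℕ) : ℤ :=
  (∑ u, ∑ i with u ≤ i ∧ i ≠ h, (A h i : ℤ) * t u)
    - (∑ u, ∑ i with u < i ∧ i ≠ h', (A h' i : ℤ) * t u)
    + (∑ u, ∑ u' with u' ≠ h ∧ u' ≠ h' ∧ u < u', (t u : ℤ) * t u')
    - t h * δ h + t h' * δ h' + 2 * j * t h - k * t h'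

/-- The coefficient `f` in the first formula. -/
def fUp (A : Matrix (Fin n) (Fin n) ℕ) (δ : Fin n → ℤ) (l : Fin n → ℕ) (h h' : Fin n)
    (t : Fin n → ℕ) (j c k : ℕ) : K :=
  v ^ gUp A δ h h' t j k * (∏ u with u ≠ h, bar (qqBinom ((A h u : ℤ) + t u) (t u)))
    * qBinom (-(t h : ℤ)) (l h - j) * qTrinom (t h + j - c) c (t h - c) (j - c)
    * qBinom (t h') (l h' - k)

/-- The matrix `A - ∑_{u ≠ h} t_u E_{h,u} + ∑_{u ≠ h'} t_u E_{h',u}`. -/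
def matDown (A : Matrix (Fin n) (Fin n) ℕ) (h h' : Fin n) (t : Fin n → ℕ) :
    Matrix (Fin n) (Fin n) ℤ :=
  A.map (fun a => (a : ℤ)) - ∑ u with u ≠ h, Matrix.single h u (t u : ℤ)
    + ∑ u with u ≠ h', Matrix.single h' u (t u : ℤ)

/-- The shift of `δ` in the second formula. -/
def alphaDown (l : Fin n → ℕ) (h h' : Fin n) (t : Fin n → ℕ) (j c k : ℕ) : Fin n → ℤ :=
  Pi.single h' ((∑ u with h' < u, (t u : ℤ)) + l h' - j - c)
    + Pi.single h ((l h : ℤ) - k - ∑ u with h < u, (t u : ℤ))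

/-- The shift of `l` in the second formula. -/
def betaDown (l : Fin n → ℕ) (h h' : Fin n) (t : Fin n → ℕ) (j c k : ℕ) : Fin n → ℤ :=
  Pi.single h' ((t h' : ℤ) + j - c - l h') + Pi.single h ((k : ℤ) - l h)

/-- The exponent of `v` in the second formula. -/
def gDown (A : Matrix (Fin n) (Fin n) ℕ) (δ : Fin n → ℤ) (h h' : Fin n) (t : Fin n → ℕ)
    (j k : ℕ) : ℤ :=
  (∑ u, ∑ i with i ≤ u ∧ i ≠ h', (A h' i : ℤ) * t u)
    - (∑ u, ∑ i with i < u ∧ i ≠ h, (A h i : ℤ) * t u)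
    + (∑ u with u ≠ h ∧ u ≠ h', ∑ u' with u < u', (t u : ℤ) * t u')
    + t h * δ h - t h' * δ h' + 2 * j * t h' - k * t h

/-- The coefficient in the second formula. -/
def fDown (A : Matrix (Fin n) (Fin n) ℕ) (δ : Fin n → ℤ) (l : Fin n → ℕ) (h h' : Fin n)
    (t : Fin n → ℕ) (j c k : ℕ) : K :=
  v ^ gDown A δ h h' t j k * (∏ u with u ≠ h', bar (qqBinom ((A h' u : ℤ) + t u) (t u)))
    * qBinom (-(t h' : ℤ)) (l h' - j) * qTrinom (t h' + j - c) c (t h' - c) (j - c)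
    * qBinom (t h) (l h - k)

end Data

end QSchur

end

/-!
Both formulas come from one rule for left multiplication by a basis element whose matrix is
diagonal except for a single entry `1` in the place `(a, b)`, where `a` and `b` are neighbours: such
an element moves one unit of the right factor's matrix from the row `b` to the row `a`, in all
columns, with explicit coefficients. The raising formula has `(a, b) = (h, h')` and the lowering
formula `(a, b) = (h', h)`. They are mirror images under the reversal of the order of the columns,
so everything after the rule is done once, with the columns compared through an injective key `κ`
that is either `u ↦ u` or `u ↦ -u`.

*The rule for one unit.* Fix a composition `m`. A permutation `w` has a word, which carries at the
place `p` the index of the `m`-block of `w⁻¹ p`. The sums of the `T_w` over all `w` with a given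
word are permuted by the generators `T_i`, acting from the left, like the words in the tensor space:
`T_i` exchanges adjacent letters, up to the quadratic relation (`IsWordRep`, `isWordRep_listSum`).
This uses `heckeGen_mul_heckeT`, which rests on Matsumoto's theorem (`matsumoto`). A double coset
with matrix `A` consists of the `w` whose word has, in the `k`-th block of places, the letters
given by the row `k` of `A` (`dcoset_eq`, `cosetSum_eq_sum`). Left multiplication by
`1 + T_{N-1} + T_{N-2} T_{N-1} + ⋯` inserts a letter into all words of length `N` with a given
multiset of letters, with a coefficient that depends only on the multiset (`insertOp_mul_sum`).
Applied to the first letter of a block of places, which is thereby moved into the preceding block,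
or in mirror image to the last letter of a block, this is the rule for double coset sums
(`MovesLetters`). As the double coset sums are left multiples of `x_m` and right multiples of `x_l`
(`cosetSum_eq_left`, `cosetSum_eq_right`), they define the endomorphisms `φ`, and the rule passes to
the `q`-Schur algebra; the powers of `v` in the normalization change by `dStat_move`. The result is
recorded in the structure `IsMulBasis` and proved in `isMulBasis_up` and `isMulBasis_down`.

*An arbitrary entry `m`.* The product of the elements for the entries `1` and `m` is `[m+1]` times
the element for `m + 1`. By induction, the element for `m` moves `t u` units in the column `u`, for
all `t` with sum `m`, with a coefficient that is a power of `v` times `∏ [A a u + t u, t u]`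
(`IsMulBasis.pow`); the induction step is the identity `qInt_sum`.

*The sum over the diagonals.* In the product with `A(δ, l)`, all diagonals `μ` are summed over. The
units in the columns `a` and `b` change the diagonal at `a` and `b`, and the sum is rewritten over
the diagonal `ν` after the move (`IsMulBasis.sum_diagonals`). The coefficient of a fixed basis
element then has the factors `[ν a - t a, l a] [ν a, t a]` and `[ν b + t b, l b]`, and these have to
be expanded in the binomials `[ν a, _]` and `[ν b, _]`. The `q`-Vandermonde identity does this,
twice for the first (`qBinom_sub_mul`) and once for the second (`qBinom_add_range`), and the
summation indices are the `j`, `c` and `k` of the formula (`sum_fKey_mul`).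
-/

noncomputable section

namespace QSchur

/-! ### Gaussian binomial coefficients -/

theorem v_ne_zero : v ≠ 0 := RatFunc.X_ne_zero

theorem v_zpow_ne_one {i : ℤ} (hi : i ≠ 0) : v ^ i ≠ 1 := by
  have hnat : ∀ k : ℕ, k ≠ 0 → v ^ k ≠ 1 := by
    intro k hk h
    have h2 : (algebraMap (Polynomial ℚ) K) (Polynomial.X ^ k) =
        algebraMap (Polynomial ℚ) K 1 := by
      simpa [v, RatFunc.algebraMap_X] using h
    have h3 := RatFunc.algebraMap_injective ℚ h2
    have h4 := congrArg Polynomial.natDegree h3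
    simp at h4
    exact hk h4
  intro h
  obtain ⟨k, rfl | rfl⟩ := i.eq_nat_or_neg
  · exact hnat k (by simpa using hi) (by simpa using h)
  · exact hnat k (by simpa using hi) (by simpa using h)

theorem v_sub_inv_ne_zero : v - v⁻¹ ≠ 0 := by
  have h := v_zpow_ne_one (i := 2) (by norm_num)
  intro h2
  apply h
  have h3 : v * (v - v⁻¹) = 0 := by rw [h2, mul_zero]
  rw [mul_sub, mul_inv_cancel₀ v_ne_zero] at h3
  have : v ^ (2 : ℤ) = v * v := by rw [zpow_two]
  rw [this]; linear_combination h3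

theorem v_sq_sub_one_ne_zero : v ^ 2 - 1 ≠ 0 := by
  have h := v_zpow_ne_one (i := 2) (by norm_num)
  exact sub_ne_zero.mpr (by exact_mod_cast h)

theorem vadd (a b : ℤ) : v ^ (a + b) = v ^ a * v ^ b := zpow_add₀ v_ne_zero a b

@[simp] theorem qInt_zero : qInt 0 = 0 := by simp [qInt]

theorem qInt_ne_zero {i : ℤ} (hi : i ≠ 0) : qInt i ≠ 0 := by
  unfold qInt
  refine div_ne_zero ?_ v_sub_inv_ne_zero
  intro h
  have h1 : v ^ i = v ^ (-i) := sub_eq_zero.mp h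
  refine v_zpow_ne_one (i := i + i) (by omega) ?_
  rw [vadd]
  nth_rewrite 1 [h1]
  rw [← vadd]; simp

theorem qInt_add (a b : ℤ) : qInt (a + b) = v ^ b * qInt a + v ^ (-a) * qInt b := by
  unfold qInt
  rw [← mul_div_assoc, ← mul_div_assoc, ← add_div]
  congr 1
  rw [mul_sub, mul_sub, ← vadd, ← vadd, ← vadd, ← vadd, neg_add, add_comm b a,
    show b + -a = -a + b by ring]
  ring

theorem qFact_ne_zero (t : ℕ) : qFact t ≠ 0 :=
  Finset.prod_ne_zero_iff.mpr fun s _ => qInt_ne_zero (by omega)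

theorem qFact_succ (t : ℕ) : qFact (t + 1) = qFact t * qInt ((t : ℤ) + 1) :=
  Finset.prod_range_succ _ _

@[simp] theorem qFact_zero : qFact 0 = 1 := rfl

@[simp] theorem qBinom_zero_right (N : ℤ) : qBinom N 0 = 1 := by simp [qBinom]

/-- The numerator of `qBinom N t`. -/
def qDesc (N : ℤ) (t : ℕ) : K := ∏ s ∈ Finset.range t, qInt (N - s)

theorem qBinom_eq (N : ℤ) (t : ℕ) : qBinom N t = qDesc N t / qFact t := rfl

theorem qDesc_succ (N : ℤ) (t : ℕ) : qDesc N (t + 1) = qDesc N t * qInt (N - t) :=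
  Finset.prod_range_succ _ _

theorem qDesc_succ' (N : ℤ) (t : ℕ) : qDesc N (t + 1) = qInt N * qDesc (N - 1) t := by
  unfold qDesc
  rw [Finset.prod_range_succ', mul_comm]
  congr 1
  · simp
  · refine Finset.prod_congr rfl fun s _ => ?_
    congr 1; push_cast; ring

theorem qDesc_add (N : ℤ) (s t : ℕ) : qDesc N (s + t) = qDesc N s * qDesc (N - s) t := by
  unfold qDesc
  rw [Finset.prod_range_add]
  congr 1
  refine Finset.prod_congr rfl fun s _ => ?_
  congr 1; push_cast; ring

theorem qDesc_eq_zero {N t : ℕ} (h : N < t) : qDesc N t = 0 :=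
  Finset.prod_eq_zero (Finset.mem_range.mpr h) (by simp)

theorem qDesc_mul_qFact (t s : ℕ) : qDesc ((t + s : ℕ) : ℤ) s * qFact t = qFact (t + s) := by
  induction s with
  | zero => simp [qDesc]
  | succ s ih =>
    rw [qDesc_succ', ← add_assoc, qFact_succ, ← ih]
    push_cast
    rw [add_sub_cancel_right]
    ring

theorem qBinom_eq_zero {N t : ℕ} (h : N < t) : qBinom N t = 0 := by
  rw [qBinom_eq, qDesc_eq_zero h, zero_div]

/-- Absorption: `[N, t+1] [t+1] = [N-1, t] [N]`. -/
theorem qBinom_succ_mul (N : ℤ) (t : ℕ) :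
    qBinom N (t + 1) * qInt ((t : ℤ) + 1) = qBinom (N - 1) t * qInt N := by
  rw [qBinom_eq, qBinom_eq, qDesc_succ', qFact_succ]
  have h1 := qFact_ne_zero t
  have h2 : qInt ((t : ℤ) + 1) ≠ 0 := qInt_ne_zero (by omega)
  field_simp

theorem qBinom_pascal (N : ℤ) (t : ℕ) : qBinom (N + 1) (t + 1) =
    v ^ ((t : ℤ) + 1) * qBinom N (t + 1) + v ^ ((t : ℤ) - N) * qBinom N t := by
  simp only [qBinom_eq]
  rw [qDesc_succ', qDesc_succ, qFact_succ, add_sub_cancel_right]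
  have h1 := qFact_ne_zero t
  have h2 : qInt ((t : ℤ) + 1) ≠ 0 := qInt_ne_zero (by omega)
  have h3 := qInt_add (N - t) (t + 1)
  rw [show N - t + ((t : ℤ) + 1) = N + 1 by ring, neg_sub] at h3
  rw [h3]
  field_simp

theorem qBinom_pascal' (N : ℤ) (t : ℕ) : qBinom (N + 1) (t + 1) =
    v ^ (-((t : ℤ) + 1)) * qBinom N (t + 1) + v ^ (N - (t : ℤ)) * qBinom N t := by
  simp only [qBinom_eq]
  rw [qDesc_succ', qDesc_succ, qFact_succ, add_sub_cancel_right]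
  have h1 := qFact_ne_zero t
  have h2 : qInt ((t : ℤ) + 1) ≠ 0 := qInt_ne_zero (by omega)
  have h3 := qInt_add (t + 1) (N - t)
  rw [show (t : ℤ) + 1 + (N - t) = N + 1 by ring] at h3
  rw [h3]
  field_simp
  ring

/-- The right-hand side of the `q`-Vandermonde identity. -/
def vand (a b : ℤ) (s : ℕ) : K :=
  ∑ p ∈ Finset.HasAntidiagonal.antidiagonal s,
    v ^ (a * p.2 - b * p.1) * qBinom a p.1 * qBinom b p.2

theorem vand_shift (a b : ℤ) (s : ℕ) : vand (a + 1) b s = vand a (b + 1) s := by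
  unfold vand
  rcases s with _ | s
  · simp
  have h1 : ∑ p ∈ Finset.HasAntidiagonal.antidiagonal (s + 1),
      v ^ ((a + 1) * p.2 - b * p.1) * qBinom (a + 1) p.1 * qBinom b p.2 =
      ∑ p ∈ Finset.HasAntidiagonal.antidiagonal (s + 1),
        v ^ ((a + 1) * p.2 - b * p.1 - p.1) * qBinom a p.1 * qBinom b p.2 +
      ∑ p ∈ Finset.HasAntidiagonal.antidiagonal s,
        v ^ ((a + 1) * p.2 - b * (p.1 + 1) + a - p.1) * qBinom a p.1 * qBinom b p.2 := by
    rw [Finset.Nat.sum_antidiagonal_succ, Finset.Nat.sum_antidiagonal_succ, add_assoc,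
      ← Finset.sum_add_distrib]
    congr 1
    · simp
    · refine Finset.sum_congr rfl fun p _ => ?_
      rw [qBinom_pascal']
      push_cast
      rw [show (a + 1) * (p.2 : ℤ) - b * (p.1 + 1) - (p.1 + 1) =
        ((a + 1) * (p.2 : ℤ) - b * (p.1 + 1)) + -((p.1 : ℤ) + 1) by ring, vadd,
        add_sub_assoc, vadd]
      ring
  have h2 : ∑ p ∈ Finset.HasAntidiagonal.antidiagonal (s + 1),
      v ^ (a * p.2 - (b + 1) * p.1) * qBinom a p.1 * qBinom (b + 1) p.2 =
      ∑ p ∈ Finset.HasAntidiagonal.antidiagonal (s + 1),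
        v ^ (a * p.2 - (b + 1) * p.1 + p.2) * qBinom a p.1 * qBinom b p.2 +
      ∑ p ∈ Finset.HasAntidiagonal.antidiagonal s,
        v ^ (a * (p.2 + 1) - (b + 1) * p.1 + p.2 - b) * qBinom a p.1 * qBinom b p.2 := by
    rw [Finset.Nat.sum_antidiagonal_succ', Finset.Nat.sum_antidiagonal_succ', add_assoc,
      ← Finset.sum_add_distrib]
    congr 1
    · simp
    · refine Finset.sum_congr rfl fun p _ => ?_
      rw [qBinom_pascal]
      push_cast
      rw [vadd _ ((p.2 : ℤ) + 1), add_sub_assoc, vadd _ ((p.2 : ℤ) - b)]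
      ring
  rw [h1, h2]
  congr 1 <;>
  · refine Finset.sum_congr rfl fun p _ => ?_
    congr 3
    ring

theorem vand_zero (b : ℤ) (s : ℕ) : vand 0 b s = qBinom b s := by
  unfold vand
  rw [Finset.sum_eq_single (0, s)]
  · simp
  · rintro ⟨i, j⟩ hij hne
    have hi : 0 < i := by
      rw [Finset.HasAntidiagonal.mem_antidiagonal] at hij
      simp only at hij
      rcases Nat.eq_zero_or_pos i with rfl | h
      · exact absurd (by simp_all) hne
      · exact h
    have : qBinom 0 i = 0 := by exact_mod_cast qBinom_eq_zero hi
    simp [this]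
  · simp

/-- The `q`-Vandermonde identity for integral upper indices: the right-hand side depends only on
`a + b`. -/
theorem qBinom_add (a b : ℤ) (s : ℕ) : qBinom (a + b) s = vand a b s := by
  induction a using Int.induction_on generalizing b with
  | zero => rw [vand_zero, zero_add]
  | succ a ih => rw [vand_shift, ← ih]; congr 1; ring
  | pred a ih =>
    have := vand_shift (-(a : ℤ) - 1) (b - 1) s
    rw [sub_add_cancel, sub_add_cancel] at this
    rw [← this, ← ih]; congr 1; ring

theorem qBinom_add_range (a b : ℤ) (s : ℕ) : qBinom (a + b) s =
    ∑ j ∈ Finset.range (s + 1),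
      v ^ (a * ((s : ℤ) - j) - b * j) * qBinom a j * qBinom b (s - j) := by
  rw [qBinom_add, vand, Finset.Nat.sum_antidiagonal_eq_sum_range_succ_mk]
  refine Finset.sum_congr rfl fun j hj => ?_
  rw [Finset.mem_range] at hj
  simp only
  rw [Nat.cast_sub (by omega)]

theorem v_zpow_mem_laurent (i : ℤ) : v ^ i ∈ laurent := by
  have h1 : v ∈ laurent := Subring.subset_closure (by simp)
  have h2 : v⁻¹ ∈ laurent := Subring.subset_closure (by simp)
  obtain ⟨k, rfl | rfl⟩ := i.eq_nat_or_neg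
  · simpa using pow_mem h1 k
  · simpa using pow_mem h2 k

theorem qBinom_mem_laurent (N : ℤ) (t : ℕ) : qBinom N t ∈ laurent := by
  induction t generalizing N with
  | zero => simp [one_mem]
  | succ t ih =>
    induction N using Int.induction_on with
    | zero =>
      have : qBinom 0 (t + 1) = 0 := by exact_mod_cast qBinom_eq_zero (Nat.succ_pos t)
      rw [this]; exact zero_mem _
    | succ N ihN =>
      rw [qBinom_pascal]
      exact add_mem (mul_mem (v_zpow_mem_laurent _) ihN) (mul_mem (v_zpow_mem_laurent _) (ih _))
    | pred N ihN =>
      -- Pascal's rule, solved for the term with the smaller upper index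
      have h := qBinom_pascal (-(N : ℤ) - 1) t
      rw [sub_add_cancel] at h
      have h2 : qBinom (-(N : ℤ) - 1) (t + 1) = v ^ (-((t : ℤ) + 1)) *
          (qBinom (-(N : ℤ)) (t + 1) -
            v ^ ((t : ℤ) - (-(N : ℤ) - 1)) * qBinom (-(N : ℤ) - 1) t) := by
        rw [h, add_sub_cancel_right, ← mul_assoc, ← vadd]; simp
      rw [h2]
      exact mul_mem (v_zpow_mem_laurent _)
        (sub_mem ihN (mul_mem (v_zpow_mem_laurent _) (ih _)))

theorem qqInt_eq (i : ℤ) : qqInt i = v ^ (i - 1) * qInt i := by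
  have h1 := v_sub_inv_ne_zero
  have h2 := v_sq_sub_one_ne_zero
  have h3 : v ^ 2 - 1 = v * (v - v⁻¹) := by
    rw [mul_sub, mul_inv_cancel₀ v_ne_zero]; ring
  have h4 : v ^ (2 * i) - 1 = v ^ (i - 1) * v * (v ^ i - v ^ (-i)) := by
    rw [← zpow_add_one₀ v_ne_zero, sub_add_cancel, mul_sub, ← vadd, ← vadd]; simp [two_mul]
  rw [qqInt, qInt, h4, h3]
  have := v_ne_zero
  field_simp

theorem bar_v_zpow (i : ℤ) : bar (v ^ i) = v ^ (-i) := by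
  rw [map_zpow₀, bar_v, inv_zpow, zpow_neg]

theorem bar_qInt (i : ℤ) : bar (qInt i) = qInt i := by
  rw [qInt, map_div₀, map_sub, map_sub, bar_v_zpow, bar_v_zpow, map_inv₀, bar_v, neg_neg, inv_inv,
    ← neg_sub, ← neg_sub v, neg_div_neg_eq]

theorem bar_qqInt (i : ℤ) : bar (qqInt i) = v ^ (1 - i) * qInt i := by
  rw [qqInt_eq, map_mul, bar_v_zpow, bar_qInt, neg_sub]

theorem bar_qqBinom (N : ℤ) (t : ℕ) :
    bar (qqBinom N t) = v ^ (-((t : ℤ) * (N - t))) * qBinom N t := by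
  have hnum : ∀ s : ℕ, ∏ x ∈ Finset.range s, bar (qqInt (N - x)) =
      v ^ ((s : ℤ) * (1 - N) ) * v ^ (((s : ℤ) * (s - 1)) / 2) * qDesc N s := by
    intro s
    induction s with
    | zero => simp [qDesc]
    | succ s ih =>
      rw [Finset.prod_range_succ, ih, qDesc_succ, bar_qqInt]
      have : (((s + 1 : ℕ) : ℤ) * ((s + 1 : ℕ) - 1)) / 2 = (s : ℤ) * (s - 1) / 2 + s := by
        rw [show (((s + 1 : ℕ) : ℤ) * ((s + 1 : ℕ) - 1)) = (s : ℤ) * (s - 1) + s * 2 by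
          push_cast; ring, Int.add_mul_ediv_right _ _ (by norm_num)]
      rw [this, vadd]
      push_cast
      rw [show ((s : ℤ) + 1) * (1 - N) = s * (1 - N) + (1 - N) by ring, vadd,
        show 1 - (N - (s : ℤ)) = (1 - N) + s by ring, vadd]
      ring
  have hden : ∀ s : ℕ, bar (qqFact s) = v ^ (-(((s : ℤ) * (s - 1)) / 2)) * qFact s := by
    intro s
    induction s with
    | zero => simp [qqFact]
    | succ s ih =>
      have : (((s + 1 : ℕ) : ℤ) * ((s + 1 : ℕ) - 1)) / 2 = (s : ℤ) * (s - 1) / 2 + s := by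
        rw [show (((s + 1 : ℕ) : ℤ) * ((s + 1 : ℕ) - 1)) = (s : ℤ) * (s - 1) + s * 2 by
          push_cast; ring, Int.add_mul_ediv_right _ _ (by norm_num)]
      rw [qqFact, Finset.prod_range_succ, map_mul, ← qqFact, ih, qFact_succ, bar_qqInt, this,
        neg_add, vadd]
      rw [show 1 - ((s : ℤ) + 1) = -s by ring]
      ring
  rw [qqBinom, map_div₀, map_prod, hnum, hden, qBinom_eq]
  have hdiv : (t : ℤ) * (t - 1) / 2 + (t : ℤ) * (t - 1) / 2 = (t : ℤ) * (t - 1) := by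
    have : (2 : ℤ) ∣ (t : ℤ) * (t - 1) := by
      have := Int.even_mul_succ_self ((t : ℤ) - 1)
      rw [sub_add_cancel, mul_comm] at this
      exact this.two_dvd
    omega
  have he : v ^ (-((t : ℤ) * (N - t))) * v ^ (-(((t : ℤ) * (t - 1)) / 2)) =
      v ^ ((t : ℤ) * (1 - N)) * v ^ (((t : ℤ) * (t - 1)) / 2) := by
    rw [← vadd, ← vadd]
    congr 1
    linear_combination -hdiv
  rw [← he, mul_assoc, mul_div_assoc, mul_div_mul_left _ _ (zpow_ne_zero _ v_ne_zero)]

theorem qTrinom_eq {c t j : ℕ} (h1 : c ≤ t) (h2 : c ≤ j) :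
    qTrinom (t + j - c) c (t - c) (j - c) =
      qBinom ((t + j - c : ℕ) : ℤ) (j - c) * qBinom (t : ℤ) c := by
  obtain ⟨a, rfl⟩ := Nat.exists_eq_add_of_le h1
  obtain ⟨b, rfl⟩ := Nat.exists_eq_add_of_le h2
  have e1 := qDesc_mul_qFact (c + a) b
  have e2 := qDesc_mul_qFact a c
  rw [show c + a + (c + b) - c = c + a + b by omega, Nat.add_sub_cancel_left,
    Nat.add_sub_cancel_left, qTrinom, qBinom_eq, qBinom_eq, ← e1]
  rw [add_comm a c] at e2
  rw [← e2]
  have := qFact_ne_zero a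
  have := qFact_ne_zero b
  have := qFact_ne_zero c
  field_simp

/-- Both sides are `[N][N-1]⋯[N-t-j+c+1]` divided by `[c]! [t-c]! [j-c]!`. -/
theorem qBinom_mul_qTrinom (N : ℤ) {c t j : ℕ} (h1 : c ≤ t) (h2 : c ≤ j) :
    qBinom N (t + j - c) * qTrinom (t + j - c) c (t - c) (j - c) =
      qBinom N t * qBinom t c * qBinom (N - t) (j - c) := by
  obtain ⟨a, rfl⟩ := Nat.exists_eq_add_of_le h1
  obtain ⟨b, rfl⟩ := Nat.exists_eq_add_of_le h2
  have e2 := qDesc_mul_qFact a c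
  rw [show c + a + (c + b) - c = c + a + b by omega, Nat.add_sub_cancel_left,
    Nat.add_sub_cancel_left, qTrinom, qBinom_eq, qBinom_eq, qBinom_eq, qBinom_eq, qDesc_add]
  rw [add_comm a c] at e2
  rw [← e2]
  have := qFact_ne_zero a
  have := qFact_ne_zero b
  have := qFact_ne_zero c
  have := qFact_ne_zero (c + a + b)
  have : qDesc ((c + a : ℕ) : ℤ) c ≠ 0 := by
    intro h; rw [h, zero_mul] at e2; exact qFact_ne_zero _ e2.symm
  field_simp

theorem qTrinom_mem_laurent {c t j : ℕ} (h1 : c ≤ t) (h2 : c ≤ j) :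
    qTrinom (t + j - c) c (t - c) (j - c) ∈ laurent := by
  rw [qTrinom_eq h1 h2]
  exact mul_mem (qBinom_mem_laurent _ _) (qBinom_mem_laurent _ _)

/-- The part of the comparison of coefficients that belongs to the raised row `h`: `N` is the
diagonal entry after the move, and `N - t` the one before. The identity follows from two
applications of the `q`-Vandermonde identity, to `N - t = N + (-t)` and to `N = t + (N - t)`. -/
theorem qBinom_sub_mul (N : ℤ) (t s : ℕ) :
    qBinom (N - t) s * qBinom N t =
      ∑ j ∈ Finset.range (s + 1), ∑ c ∈ Finset.range (min t j + 1),
        v ^ (2 * (j : ℤ) * t + N * ((s : ℤ) - j - c)) * qBinom (-(t : ℤ)) (s - j) *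
          qTrinom (t + j - c) c (t - c) (j - c) * qBinom N (t + j - c) := by
  rw [sub_eq_add_neg, qBinom_add_range, Finset.sum_mul]
  refine Finset.sum_congr rfl fun j _ => ?_
  have h : qBinom N j = ∑ c ∈ Finset.range (min t j + 1),
      v ^ ((t : ℤ) * j - N * c) * qBinom t c * qBinom (N - t) (j - c) := by
    have h1 := qBinom_add_range t (N - t) j
    rw [add_sub_cancel] at h1
    rw [h1]
    symm
    apply Finset.sum_subset_zero_on_sdiff
    · intro c; simp only [Finset.mem_range]; omega
    · intro c hc
      simp only [Finset.mem_sdiff, Finset.mem_range] at hc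
      rw [qBinom_eq_zero (N := t) (t := c) (by omega)]
      ring
    · intro c _
      congr 3; ring
  rw [h, Finset.mul_sum, Finset.sum_mul, Finset.sum_mul]
  refine Finset.sum_congr rfl fun c hc => ?_
  simp only [Finset.mem_range] at hc
  have h3 := qBinom_mul_qTrinom N (c := c) (t := t) (j := j) (by omega) (by omega)
  rw [mul_assoc _ (qTrinom _ _ _ _), mul_comm (qTrinom _ _ _ _), h3,
    show 2 * (j : ℤ) * t + N * ((s : ℤ) - j - c) =
      (N * ((s : ℤ) - j) - -(t : ℤ) * j) + ((t : ℤ) * j - N * c) by ring, vadd]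
  ring

/-- The sum over `u` of `v^(∑_{i>u} t_i - ∑_{i<u} t_i) [t_u]` telescopes to `[∑ t_u]`; the
indices are compared through `κ`. -/
theorem qInt_sum {ι : Type*} [DecidableEq ι] {κ : ι → ℤ} (hκ : Function.Injective κ) (t : ι → ℤ)
    (S : Finset ι) :
    ∑ u ∈ S, v ^ ((∑ i ∈ S with κ u < κ i, t i) - ∑ i ∈ S with κ i < κ u, t i) * qInt (t u) =
      qInt (∑ u ∈ S, t u) := by
  induction S using Finset.induction_on_min_value κ with
  | empty => simp
  | insert a S ha hmin ih =>
    have h1 : ∀ x ∈ S, κ a < κ x := fun x hx =>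
      lt_of_le_of_ne (hmin x hx) fun h => ha (hκ h ▸ hx)
    rw [Finset.sum_insert ha, Finset.sum_insert ha, qInt_add, ← ih, Finset.mul_sum,
      Finset.filter_insert, if_neg (lt_irrefl _), Finset.filter_insert, if_neg (lt_irrefl _),
      Finset.filter_true_of_mem h1, Finset.filter_false_of_mem fun x hx => not_lt.mpr (h1 x hx).le,
      Finset.sum_empty, sub_zero]
    congr 1
    refine Finset.sum_congr rfl fun u hu => ?_
    rw [Finset.filter_insert, if_neg (not_lt.mpr (h1 u hu).le), Finset.filter_insert,
      if_pos (h1 u hu), Finset.sum_insert (by simp [ha]), ← mul_assoc, ← vadd]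
    congr 2
    ring

/-! ### Lengths of permutations and Matsumoto's theorem -/

section Perm

variable {r : ℕ}

/-- The lower of the two letters that `simpleRefl r i` exchanges. -/
def lo (i : Fin (r - 1)) : Fin r := ⟨i, by omega⟩

/-- The upper of the two letters that `simpleRefl r i` exchanges. -/
def hi (i : Fin (r - 1)) : Fin r := ⟨i + 1, by omega⟩

theorem simpleRefl_eq (i : Fin (r - 1)) : simpleRefl r i = Equiv.swap (lo i) (hi i) := rfl

theorem lo_lt_hi (i : Fin (r - 1)) : lo i < hi i := by simp [lo, hi, Fin.lt_def]

@[simp] theorem simpleRefl_lo (i : Fin (r - 1)) : simpleRefl r i (lo i) = hi i :=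
  Equiv.swap_apply_left _ _

@[simp] theorem simpleRefl_hi (i : Fin (r - 1)) : simpleRefl r i (hi i) = lo i :=
  Equiv.swap_apply_right _ _

@[simp] theorem simpleRefl_mul_self (i : Fin (r - 1)) : simpleRefl r i * simpleRefl r i = 1 :=
  Equiv.swap_mul_self _ _

@[simp] theorem simpleRefl_mul_self_mul (i : Fin (r - 1)) (w : Equiv.Perm (Fin r)) :
    simpleRefl r i * (simpleRefl r i * w) = w := by
  rw [← mul_assoc, simpleRefl_mul_self, one_mul]

@[simp] theorem simpleRefl_inv (i : Fin (r - 1)) : (simpleRefl r i)⁻¹ = simpleRefl r i :=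
  Equiv.swap_inv _ _

theorem simpleRefl_val (i : Fin (r - 1)) (p : Fin r) : (simpleRefl r i p : ℕ) =
    if (p : ℕ) = i then (i : ℕ) + 1 else if (p : ℕ) = i + 1 then (i : ℕ) else p := by
  rw [simpleRefl_eq, Equiv.swap_apply_def]
  simp only [lo, hi, Fin.ext_iff]
  split_ifs <;> rfl

theorem simpleRefl_lt_iff (i : Fin (r - 1)) {p q : Fin r} (h1 : ¬ (p = lo i ∧ q = hi i))
    (h2 : ¬ (p = hi i ∧ q = lo i)) : simpleRefl r i p < simpleRefl r i q ↔ p < q := by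
  simp only [Fin.ext_iff, lo, hi] at h1 h2
  rw [Fin.lt_def, Fin.lt_def, simpleRefl_val, simpleRefl_val]
  split_ifs <;> omega

/-- The set of inversions of a permutation. -/
def invSet (w : Equiv.Perm (Fin r)) : Finset (Fin r × Fin r) :=
  Finset.univ.filter fun p => p.1 < p.2 ∧ w p.2 < w p.1

/-- The number of inversions of a permutation. -/
def inv (w : Equiv.Perm (Fin r)) : ℕ := (invSet w).card

theorem inv_one : inv (1 : Equiv.Perm (Fin r)) = 0 := by
  rw [inv, Finset.card_eq_zero, invSet, Finset.filter_eq_empty_iff]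
  rintro p - ⟨h1, h2⟩
  exact absurd h1 (not_lt.mpr h2.le)

/-- `i` is an ascent: `w⁻¹ i < w⁻¹ (i+1)`. -/
def Asc (w : Equiv.Perm (Fin r)) (i : Fin (r - 1)) : Prop := w⁻¹ (lo i) < w⁻¹ (hi i)

theorem asc_or (w : Equiv.Perm (Fin r)) (i : Fin (r - 1)) :
    Asc w i ∨ w⁻¹ (hi i) < w⁻¹ (lo i) := by
  rcases lt_trichotomy (w⁻¹ (lo i)) (w⁻¹ (hi i)) with h | h | h
  · exact Or.inl h
  · exact absurd (w⁻¹.injective h) (lo_lt_hi i).ne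
  · exact Or.inr h

theorem asc_simpleRefl_mul (w : Equiv.Perm (Fin r)) (i : Fin (r - 1)) :
    Asc (simpleRefl r i * w) i ↔ ¬ Asc w i := by
  have h : Asc (simpleRefl r i * w) i ↔ w⁻¹ (hi i) < w⁻¹ (lo i) := by
    simp [Asc, mul_inv_rev]
  rw [h]
  rcases asc_or w i with h | h
  · exact ⟨fun h' => absurd h (not_lt.mpr h'.le), fun h' => absurd h h'⟩
  · exact ⟨fun _ h' => absurd h (not_lt.mpr (le_of_lt h')), fun _ => h⟩

theorem mem_invSet {w : Equiv.Perm (Fin r)} {p q : Fin r} :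
    (p, q) ∈ invSet w ↔ p < q ∧ w q < w p := by simp [invSet]

theorem inv_simpleRefl_mul {w : Equiv.Perm (Fin r)} {i : Fin (r - 1)} (h : Asc w i) :
    inv (simpleRefl r i * w) = inv w + 1 := by
  have hnot : (w⁻¹ (lo i), w⁻¹ (hi i)) ∉ invSet w := by
    simp [mem_invSet, (lo_lt_hi i).le]
  rw [inv, inv, ← Finset.card_insert_of_notMem hnot]
  congr 1
  ext ⟨p, q⟩
  rw [mem_invSet, Finset.mem_insert, mem_invSet, Prod.mk.injEq, Equiv.Perm.eq_inv_iff_eq,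
    Equiv.Perm.eq_inv_iff_eq, Equiv.Perm.mul_apply, Equiv.Perm.mul_apply]
  by_cases h1 : w p = lo i ∧ w q = hi i
  · have hpq : p < q := by
      have := h
      rw [Asc, ← h1.1, ← h1.2] at this
      simpa using this
    simp [h1, hpq, lo_lt_hi]
  · by_cases h2 : w p = hi i ∧ w q = lo i
    · have hq : q < p := by
        have := h
        rw [Asc, ← h2.1, ← h2.2] at this
        simpa using this
      simp [h1, not_lt.mpr hq.le]
    · rw [simpleRefl_lt_iff i (fun h => h2 ⟨h.2, h.1⟩) (fun h => h1 ⟨h.2, h.1⟩)]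
      simp [h1]

theorem inv_simpleRefl_mul_of_not_asc {w : Equiv.Perm (Fin r)} {i : Fin (r - 1)}
    (h : ¬ Asc w i) : inv (simpleRefl r i * w) + 1 = inv w := by
  have := inv_simpleRefl_mul ((asc_simpleRefl_mul w i).mpr h)
  rw [simpleRefl_mul_self_mul] at this
  exact this.symm

@[simp] theorem wordProd_cons (i : Fin (r - 1)) (L : List (Fin (r - 1))) :
    wordProd r (i :: L) = simpleRefl r i * wordProd r L := by simp [wordProd]

theorem inv_wordProd_le (L : List (Fin (r - 1))) : inv (wordProd r L) ≤ L.length := by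
  induction L with
  | nil => simp [wordProd, inv_one]
  | cons i L ih =>
    rw [wordProd_cons, List.length_cons]
    by_cases h : Asc (wordProd r L) i
    · rw [inv_simpleRefl_mul h]; omega
    · have := inv_simpleRefl_mul_of_not_asc h; omega

theorem exists_not_asc {w : Equiv.Perm (Fin r)} (hw : w ≠ 1) : ∃ i, ¬ Asc w i := by
  by_contra! h
  apply hw
  have hmono : StrictMono (w⁻¹ : Equiv.Perm (Fin r)) := by
    rcases r with _ | r
    · exact fun a => a.elim0
    · refine Fin.strictMono_iff_lt_succ.mpr fun i => ?_
      exact h ⟨i, by omega⟩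
  have : (w⁻¹ : Equiv.Perm (Fin r)) = 1 := by
    ext x
    have := congrFun (Subsingleton.elim
      (hmono.orderIsoOfSurjective _ w⁻¹.surjective) (OrderIso.refl _) ▸ rfl :
        (hmono.orderIsoOfSurjective _ w⁻¹.surjective : Fin r → Fin r) =
          (OrderIso.refl (Fin r) : Fin r → Fin r)) x
    simpa using congrArg Fin.val this
  simpa using this

theorem exists_word (w : Equiv.Perm (Fin r)) :
    ∃ L, wordProd r L = w ∧ L.length = inv w := by
  induction hk : inv w generalizing w with
  | zero =>
    refine ⟨[], ?_, rfl⟩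
    by_contra hne
    obtain ⟨i, hi⟩ := exists_not_asc (Ne.symm (by simpa [wordProd] using hne) : w ≠ 1)
    have := inv_simpleRefl_mul_of_not_asc hi
    omega
  | succ k ih =>
    have hne : w ≠ 1 := by rintro rfl; rw [inv_one] at hk; omega
    obtain ⟨i, hi⟩ := exists_not_asc hne
    have := inv_simpleRefl_mul_of_not_asc hi
    obtain ⟨L, hL, hlen⟩ := ih (simpleRefl r i * w) (by omega)
    exact ⟨i :: L, by rw [wordProd_cons, hL, simpleRefl_mul_self_mul], by simp [hlen]⟩

theorem reducedWord_spec (w : Equiv.Perm (Fin r)) : IsReducedWord r w (reducedWord r w) :=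
  (exists_isReducedWord r w).choose_spec

theorem len_eq_inv (w : Equiv.Perm (Fin r)) : len r w = inv w := by
  obtain ⟨h1, h2⟩ := reducedWord_spec w
  obtain ⟨L, hL, hlen⟩ := exists_word w
  apply le_antisymm
  · exact hlen ▸ h2 L hL
  · have := inv_wordProd_le (reducedWord r w)
    rwa [h1] at this

theorem simpleRefl_comm {i j : Fin (r - 1)} (h : (i : ℕ) + 1 < j) (w : Equiv.Perm (Fin r)) :
    simpleRefl r i * (simpleRefl r j * w) = simpleRefl r j * (simpleRefl r i * w) := by
  ext p
  simp only [Equiv.Perm.mul_apply, simpleRefl_val]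
  split_ifs <;> omega

theorem simpleRefl_braid {i j : Fin (r - 1)} (h : (j : ℕ) = i + 1) (w : Equiv.Perm (Fin r)) :
    simpleRefl r i * (simpleRefl r j * (simpleRefl r i * w)) =
      simpleRefl r j * (simpleRefl r i * (simpleRefl r j * w)) := by
  ext p
  simp only [Equiv.Perm.mul_apply]
  generalize w p = y
  have e1 : (i : ℕ) + 1 + 1 ≠ i := by omega
  by_cases h0 : (y : ℕ) = i
  · simp [simpleRefl_val, h, h0, e1, e1.symm]
  by_cases h1 : (y : ℕ) = i + 1
  · simp [simpleRefl_val, h, h1, e1, e1.symm]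
  by_cases h2 : (y : ℕ) = i + 1 + 1
  · simp [simpleRefl_val, h, h2, e1, e1.symm]
  · simp [simpleRefl_val, h, h0, h1, h2]

theorem simpleRefl_fix (i : Fin (r - 1)) {p : Fin r} (h1 : (p : ℕ) ≠ i) (h2 : (p : ℕ) ≠ i + 1) :
    simpleRefl r i p = p := by
  apply Fin.ext; rw [simpleRefl_val]; simp [h1, h2]

/-- Matsumoto's theorem for the symmetric group: the images of the simple reflections in a monoid
in which they satisfy the braid relations multiply to the same element along all reduced
words of a permutation. -/
theorem matsumoto {M : Type*} [Monoid M] (g : Fin (r - 1) → M)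
    (hbraid : ∀ i j : Fin (r - 1), (j : ℕ) = i + 1 → g i * g j * g i = g j * g i * g j)
    (hcomm : ∀ i j : Fin (r - 1), (i : ℕ) + 1 < j → g i * g j = g j * g i)
    (w : Equiv.Perm (Fin r)) (L L' : List (Fin (r - 1)))
    (hL : wordProd r L = w) (hlen : L.length = inv w)
    (hL' : wordProd r L' = w) (hlen' : L'.length = inv w) :
    (L.map g).prod = (L'.map g).prod := by
  induction hk : inv w using Nat.strong_induction_on generalizing w L L' with
  | _ k ih =>
  -- without its first letter, a reduced word is a reduced word of the remaining factor
  have peel : ∀ (i : Fin (r - 1)) (L : List (Fin (r - 1))) (w : Equiv.Perm (Fin r)),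
      wordProd r (i :: L) = w → (i :: L).length = inv w →
      wordProd r L = simpleRefl r i * w ∧ L.length = inv (simpleRefl r i * w) ∧ ¬ Asc w i := by
    intro i L w h1 h2
    rw [wordProd_cons] at h1
    have h3 : wordProd r L = simpleRefl r i * w := by rw [← h1, simpleRefl_mul_self_mul]
    have h4 := inv_wordProd_le L
    rw [h3] at h4
    rw [List.length_cons] at h2
    have h5 : ¬ Asc w i := by
      intro h; have := inv_simpleRefl_mul h; omega
    have := inv_simpleRefl_mul_of_not_asc h5
    exact ⟨h3, by omega, h5⟩
  -- two reduced words whose first letters are `i` and `j`, with `i < j`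
  have main : ∀ (i j : Fin (r - 1)) (L L' : List (Fin (r - 1))), i < j →
      wordProd r (i :: L) = w → (i :: L).length = inv w →
      wordProd r (j :: L') = w → (j :: L').length = inv w →
      ((i :: L).map g).prod = ((j :: L').map g).prod := by
    intro i j L L' hij hL hlen hL' hlen'
    obtain ⟨a1, a2, a3⟩ := peel i L w hL hlen
    obtain ⟨b1, b2, b3⟩ := peel j L' w hL' hlen'
    have ci := inv_simpleRefl_mul_of_not_asc a3
    have cj := inv_simpleRefl_mul_of_not_asc b3
    have di := (asc_or w i).resolve_left a3
    have dj := (asc_or w j).resolve_left b3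
    rw [Fin.lt_def] at hij
    rcases Nat.lt_or_ge ((i : ℕ) + 1) j with hfar | hnear
    -- for commuting `i` and `j`, both words are compared with words that begin with `i j` and
    -- `j i`
    · have e1 : ¬ Asc (simpleRefl r i * w) j := by
        rw [Asc, mul_inv_rev, simpleRefl_inv, Equiv.Perm.mul_apply, Equiv.Perm.mul_apply,
          simpleRefl_fix i (by simp [lo]; omega) (by simp [lo]; omega),
          simpleRefl_fix i (by simp [hi]; omega) (by simp [hi]; omega)]
        exact b3
      have e2 := inv_simpleRefl_mul_of_not_asc e1
      obtain ⟨N, hN, hNlen⟩ := exists_word (simpleRefl r j * (simpleRefl r i * w))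
      have f1 := ih _ (by omega) (simpleRefl r i * w) L (j :: N) a1 a2
        (by rw [wordProd_cons, hN, simpleRefl_mul_self_mul]) (by rw [List.length_cons]; omega) rfl
      have f2 := ih _ (by omega) (simpleRefl r j * w) L' (i :: N) b1 b2
        (by rw [wordProd_cons, hN, ← simpleRefl_comm hfar, simpleRefl_mul_self_mul])
        (by rw [List.length_cons]; omega) rfl
      simp only [List.map_cons, List.prod_cons] at f1 f2 ⊢
      rw [f1, f2, ← mul_assoc, ← mul_assoc, hcomm i j hfar]
    -- for neighbouring `i` and `j`, both words are compared with words that begin with `i j i`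
    -- and `j i j`
    · have hj : (j : ℕ) = i + 1 := by omega
      have hlj : lo j = hi i := Fin.ext hj
      have s1 : simpleRefl r i (hi j) = hi j :=
        simpleRefl_fix i (by simp [hi]; omega) (by simp [hi]; omega)
      have s2 : simpleRefl r j (lo i) = lo i :=
        simpleRefl_fix j (by simp [lo]; omega) (by simp [lo]; omega)
      have s3 : simpleRefl r j (hi i) = hi j := by rw [← hlj, simpleRefl_lo]
      rw [hlj] at dj
      have e1 : ¬ Asc (simpleRefl r i * w) j := by
        rw [Asc, mul_inv_rev, simpleRefl_inv, Equiv.Perm.mul_apply, Equiv.Perm.mul_apply, hlj,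
          simpleRefl_hi, s1]
        exact not_lt.mpr (dj.trans di).le
      have e2 := inv_simpleRefl_mul_of_not_asc e1
      have e3 : ¬ Asc (simpleRefl r j * (simpleRefl r i * w)) i := by
        rw [Asc, mul_inv_rev, mul_inv_rev, simpleRefl_inv, simpleRefl_inv]
        simp only [Equiv.Perm.mul_apply]
        rw [s2, s3, simpleRefl_lo, s1]
        exact not_lt.mpr dj.le
      have e4 := inv_simpleRefl_mul_of_not_asc e3
      obtain ⟨N, hN, hNlen⟩ :=
        exists_word (simpleRefl r i * (simpleRefl r j * (simpleRefl r i * w)))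
      have f1 := ih _ (by omega) (simpleRefl r i * w) L (j :: i :: N) a1 a2
        (by simp only [wordProd_cons, hN, simpleRefl_mul_self_mul])
        (by simp only [List.length_cons]; omega) rfl
      have f2 := ih _ (by omega) (simpleRefl r j * w) L' (i :: j :: N) b1 b2
        (by rw [wordProd_cons, wordProd_cons, hN, simpleRefl_braid hj, simpleRefl_mul_self_mul,
          simpleRefl_mul_self_mul]) (by simp only [List.length_cons]; omega) rfl
      simp only [List.map_cons, List.prod_cons] at f1 f2 ⊢
      rw [f1, f2]
      simp only [← mul_assoc]
      rw [hbraid i j hj]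
  rcases L with _ | ⟨i, L⟩
  · rw [List.length_nil] at hlen
    rw [List.length_eq_zero_iff.mp (hlen'.trans hlen.symm)]
  rcases L' with _ | ⟨j, L'⟩
  · rw [List.length_nil] at hlen'; rw [List.length_cons] at hlen; omega
  rcases lt_trichotomy i j with h | rfl | h
  · exact main i j L L' h hL hlen hL' hlen'
  · obtain ⟨a1, a2, a3⟩ := peel i L w hL hlen
    obtain ⟨b1, b2, -⟩ := peel i L' w hL' hlen'
    have := inv_simpleRefl_mul_of_not_asc a3
    rw [List.map_cons, List.map_cons, List.prod_cons, List.prod_cons,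
      ih _ (by omega) _ L L' a1 a2 b1 b2 rfl]
  · exact (main j i L' L h hL' hlen' hL hlen).symm

end Perm

/-! ### The Hecke algebra -/

section Hecke

variable {r : ℕ}

theorem quad_iff {R : Type*} [Ring R] [Algebra K R] (x : R) (q : K) :
    (x + 1) * (x - algebraMap K R q) = 0 ↔ x * x = (q - 1) • x + q • (1 : R) := by
  rw [Algebra.algebraMap_eq_smul_one, add_mul, mul_sub, mul_sub, one_mul, one_mul, mul_smul_comm,
    mul_one, sub_smul, one_smul, ← sub_eq_zero (a := x * x)]
  constructor <;> intro h <;> rw [← h] <;> abel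

theorem heckeGen_quad (i : Fin (r - 1)) :
    heckeGen r i * heckeGen r i = (v ^ 2 - 1) • heckeGen r i + v ^ 2 • (1 : Hecke r) := by
  have h := RingQuot.mkAlgHom_rel K (HeckeRel.quad (r := r) i)
  rw [map_mul, map_add, map_sub, map_one, map_zero, AlgHom.commutes] at h
  exact (quad_iff _ _).mp h

theorem heckeGen_braid (i j : Fin (r - 1)) (h : (j : ℕ) = i + 1) :
    heckeGen r i * heckeGen r j * heckeGen r i = heckeGen r j * heckeGen r i * heckeGen r j := by
  have h := RingQuot.mkAlgHom_rel K (HeckeRel.braid (r := r) i j h)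
  rw [map_mul, map_mul, map_mul, map_mul] at h
  exact h

theorem heckeGen_comm (i j : Fin (r - 1)) (h : (i : ℕ) + 1 < j) :
    heckeGen r i * heckeGen r j = heckeGen r j * heckeGen r i := by
  have h := RingQuot.mkAlgHom_rel K (HeckeRel.comm (r := r) i j (Or.inl h))
  rw [map_mul, map_mul] at h
  exact h

theorem heckeT_eq {w : Equiv.Perm (Fin r)} {L : List (Fin (r - 1))} (hL : wordProd r L = w)
    (hlen : L.length = inv w) : heckeT r w = (L.map (heckeGen r)).prod :=
  matsumoto (heckeGen r) heckeGen_braid heckeGen_comm w _ _ (reducedWord_spec w).1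
    (len_eq_inv w) hL hlen

theorem heckeGen_mul_heckeT {w : Equiv.Perm (Fin r)} {i : Fin (r - 1)} (h : Asc w i) :
    heckeGen r i * heckeT r w = heckeT r (simpleRefl r i * w) := by
  obtain ⟨L, hL, hlen⟩ := exists_word w
  rw [heckeT_eq hL hlen, heckeT_eq (L := i :: L) (by rw [wordProd_cons, hL])
    (by rw [List.length_cons, inv_simpleRefl_mul h, hlen])]
  simp

theorem heckeGen_mul_heckeT_of_not_asc {w : Equiv.Perm (Fin r)} {i : Fin (r - 1)}
    (h : ¬ Asc w i) : heckeGen r i * heckeT r w =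
      v ^ 2 • heckeT r (simpleRefl r i * w) + (v ^ 2 - 1) • heckeT r w := by
  have h1 := heckeGen_mul_heckeT ((asc_simpleRefl_mul w i).mpr h)
  rw [simpleRefl_mul_self_mul] at h1
  rw [← h1, ← mul_assoc, heckeGen_quad, add_mul, smul_mul_assoc, smul_mul_assoc, one_mul, add_comm]

/-- The anti-involution of the Hecke algebra that fixes the generators. -/
def heckeRev (r : ℕ) : Hecke r →ₐ[K] (Hecke r)ᵐᵒᵖ :=
  RingQuot.liftAlgHom K ⟨FreeAlgebra.lift K fun i => MulOpposite.op (heckeGen r i), by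
    intro x y hxy
    induction hxy with
    | quad i =>
      simp only [map_mul, map_add, map_sub, map_one, map_zero, FreeAlgebra.lift_ι_apply,
        AlgHom.commutes]
      rw [quad_iff, ← MulOpposite.op_mul, heckeGen_quad]
      rfl
    | braid i j h =>
      simp only [map_mul, FreeAlgebra.lift_ι_apply, ← MulOpposite.op_mul, ← mul_assoc]
      rw [heckeGen_braid i j h]
    | comm i j h =>
      simp only [map_mul, FreeAlgebra.lift_ι_apply, ← MulOpposite.op_mul]
      rcases h with h | h
      · rw [heckeGen_comm i j h]
      · rw [heckeGen_comm j i h]⟩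

theorem heckeRev_gen (i : Fin (r - 1)) :
    heckeRev r (heckeGen r i) = MulOpposite.op (heckeGen r i) := by
  simp [heckeRev, heckeGen]

theorem inv_inv (w : Equiv.Perm (Fin r)) : inv w⁻¹ = inv w := by
  have key : ∀ w : Equiv.Perm (Fin r), inv w⁻¹ ≤ inv w := by
    intro w
    obtain ⟨L, hL, hlen⟩ := exists_word w
    have : wordProd r L.reverse = w⁻¹ := by
      rw [← hL, wordProd, wordProd, List.prod_inv_reverse, List.map_reverse, List.map_map]
      congr 2
    have h := inv_wordProd_le L.reverse
    rw [this, List.length_reverse, hlen] at h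
    exact h
  refine le_antisymm (key w) ?_
  have := key w⁻¹
  rwa [_root_.inv_inv] at this

theorem heckeRev_T (w : Equiv.Perm (Fin r)) :
    heckeRev r (heckeT r w) = MulOpposite.op (heckeT r w⁻¹) := by
  obtain ⟨L, hL, hlen⟩ := exists_word w
  have h : wordProd r L.reverse = w⁻¹ := by
    rw [← hL, wordProd, wordProd, List.prod_inv_reverse, List.map_reverse, List.map_map]
    congr 2
  rw [heckeT_eq hL hlen, heckeT_eq h (by rw [List.length_reverse, inv_inv, hlen])]
  clear hL hlen h
  induction L with
  | nil => simp
  | cons i L ih =>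
    rw [List.map_cons, List.prod_cons, map_mul, ih, heckeRev_gen, List.reverse_cons,
      List.map_append, List.prod_append, ← MulOpposite.op_mul]
    simp

end Hecke

/-! ### Sums over words with prescribed letters -/

section Words

variable {α : Type*} [DecidableEq α] {M : Type*} [AddCommMonoid M]

/-- The words with a given multiset of letters. -/
def words (s : Multiset α) : Finset (List α) := s.lists.toFinset

theorem mem_words {s : Multiset α} {x : List α} : x ∈ words s ↔ (x : Multiset α) = s := by
  rw [words, Multiset.mem_toFinset, Multiset.mem_lists_iff]; exact eq_comm

theorem length_of_mem_words {s : Multiset α} {x : List α} (h : x ∈ words s) :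
    x.length = s.card := by
  rw [← mem_words.mp h]; simp

theorem sum_words_cons [Fintype α] {s : Multiset α} (hs : s ≠ 0) (f : List α → M) :
    ∑ x ∈ words s, f x = ∑ u with u ∈ s, ∑ x ∈ words (s.erase u), f (u :: x) := by
  have h : words s = (Finset.univ.filter (· ∈ s)).biUnion
      fun u => (words (s.erase u)).image (u :: ·) := by
    ext x
    simp only [mem_words, Finset.mem_biUnion, Finset.mem_filter, Finset.mem_univ, true_and,
      Finset.mem_image]
    constructor
    · rintro rfl
      rcases x with _ | ⟨u, x⟩
      · simp at hs
      · exact ⟨u, by simp, x, by simp, rfl⟩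
    · rintro ⟨u, hu, y, hy, rfl⟩
      rw [← Multiset.cons_coe, hy, Multiset.cons_erase hu]
  rw [h, Finset.sum_biUnion]
  · refine Finset.sum_congr rfl fun u _ => ?_
    rw [Finset.sum_image]
    intro x _ y _ hxy
    simpa using hxy
  · intro u _ w _ huw
    simp only [Function.onFun, Finset.disjoint_left, Finset.mem_image]
    rintro _ ⟨y, -, rfl⟩ ⟨z, -, hz⟩
    exact huw (List.cons.inj hz).1.symm

theorem sum_words_reverse (s : Multiset α) (f : List α → M) :
    ∑ x ∈ words s, f x.reverse = ∑ x ∈ words s, f x := by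
  refine Finset.sum_bij' (fun x _ => x.reverse) (fun x _ => x.reverse) ?_ ?_ ?_ ?_ ?_ <;>
    simp [mem_words]

theorem sum_words_snoc [Fintype α] {s : Multiset α} (hs : s ≠ 0) (f : List α → M) :
    ∑ x ∈ words s, f x = ∑ u with u ∈ s, ∑ x ∈ words (s.erase u), f (x ++ [u]) := by
  rw [← sum_words_reverse, sum_words_cons hs]
  refine Finset.sum_congr rfl fun u _ => ?_
  rw [← sum_words_reverse]
  simp

/-- The words that are concatenations of words with the given multisets of letters. -/
def blockLists : List (Multiset α) → Finset (List α)
  | [] => {[]}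
  | s :: S => ((words s) ×ˢ blockLists S).image fun p => p.1 ++ p.2

theorem sum_blockLists_cons (s : Multiset α) (S : List (Multiset α)) (f : List α → M) :
    ∑ x ∈ blockLists (s :: S), f x = ∑ y ∈ words s, ∑ z ∈ blockLists S, f (y ++ z) := by
  rw [blockLists, Finset.sum_image, Finset.sum_product]
  rintro ⟨y, z⟩ h1 ⟨y', z'⟩ h2 h
  simp only [Finset.coe_product, Set.mem_prod, Finset.mem_coe] at h1 h2
  have := List.append_inj h ((length_of_mem_words h1.1).trans (length_of_mem_words h2.1).symm)
  exact Prod.ext this.1 this.2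

theorem sum_blockLists_append (S S' : List (Multiset α)) (f : List α → M) :
    ∑ x ∈ blockLists (S ++ S'), f x = ∑ y ∈ blockLists S, ∑ z ∈ blockLists S', f (y ++ z) := by
  induction S generalizing f with
  | nil => simp [blockLists]
  | cons s S ih =>
    rw [List.cons_append, sum_blockLists_cons, sum_blockLists_cons]
    simp only [ih, List.append_assoc]

theorem sum_blockLists_reverse (S : List (Multiset α)) (f : List α → M) :
    ∑ x ∈ blockLists S.reverse, f x.reverse = ∑ x ∈ blockLists S, f x := by
  induction S generalizing f with
  | nil => simp [blockLists]
  | cons s S ih =>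
    rw [List.reverse_cons, sum_blockLists_append, sum_blockLists_cons]
    simp only [sum_blockLists_cons, List.reverse_append]
    simp only [blockLists, Finset.sum_singleton]
    rw [Finset.sum_comm, ← sum_words_reverse]
    refine Finset.sum_congr rfl fun x _ => ?_
    rw [← ih]
    simp

/-- Membership of a word is a condition on the letters between consecutive cutting points. -/
theorem mem_blockLists {S : List (Multiset α)} {x : List α} : x ∈ blockLists S ↔
    x.length = (S.map Multiset.card).sum ∧ ∀ (k : ℕ) (hk : k < S.length),
      (((x.drop ((S.take k).map Multiset.card).sum).take S[k].card : List α) : Multiset α) =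
        S[k] := by
  induction S generalizing x with
  | nil => simp [blockLists]
  | cons s S ih =>
    simp only [blockLists, Finset.mem_image, Finset.mem_product, Prod.exists, mem_words, ih]
    constructor
    · rintro ⟨y, z, ⟨rfl, hz1, hz2⟩, rfl⟩
      refine ⟨by simp [hz1], fun k hk => ?_⟩
      rcases k with _ | k
      · simp
      · have := hz2 k (by simpa using hk)
        simp only [List.take_succ_cons, List.map_cons, List.sum_cons, List.getElem_cons_succ,
          Multiset.coe_card]
        rw [List.drop_append]
        rw [List.drop_eq_nil_of_le (by omega), List.nil_append, Nat.add_sub_cancel_left]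
        exact this
    · rintro ⟨h1, h2⟩
      refine ⟨x.take s.card, x.drop s.card, ⟨h2 0 (by simp), ?_, ?_⟩,
        List.take_append_drop _ _⟩
      · rw [List.length_drop, h1]; simp
      · intro k hk
        have := h2 (k + 1) (by simpa using hk)
        simpa [List.drop_drop] using this

theorem length_of_mem_blockLists {S : List (Multiset α)} {x : List α} (h : x ∈ blockLists S) :
    x.length = (S.map Multiset.card).sum := (mem_blockLists.mp h).1

end Words

/-! ### Hecke operators on words -/

section Action

variable {α : Type*} {R : Type*} [Ring R] [Algebra K R]

/-- A family of elements of an algebra indexed by words of length `N` on which the elements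
`T i` act from the left as the standard generators of the Hecke algebra act on the words, by
exchange of the letters at places `i` and `i + 1`. The letters are compared through `κ`. -/
structure IsWordRep (κ : α → ℤ) (T : ℕ → R) (F : List α → R) (N : ℕ) : Prop where
  lt : ∀ x y a b, x.length + y.length + 2 = N → κ a < κ b →
    T x.length * F (x ++ a :: b :: y) = F (x ++ b :: a :: y)
  eq : ∀ x y a, x.length + y.length + 2 = N →
    T x.length * F (x ++ a :: a :: y) = v ^ 2 • F (x ++ a :: a :: y)
  gt : ∀ x y a b, x.length + y.length + 2 = N → κ b < κ a →
    T x.length * F (x ++ a :: b :: y) =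
      v ^ 2 • F (x ++ b :: a :: y) + (v ^ 2 - 1) • F (x ++ a :: b :: y)

namespace IsWordRep

variable {κ : α → ℤ} {T : ℕ → R} {F : List α → R} {N : ℕ}

theorem congr_length (h : IsWordRep κ T F N) {N' : ℕ} (hN : N = N') : IsWordRep κ T F N' :=
  hN ▸ h

/-- The letters outside an interval of places can be kept fixed. -/
theorem restrict {a b c : ℕ} (h : IsWordRep κ T F (a + b + c)) {x z : List α}
    (hx : x.length = a) (hz : z.length = c) :
    IsWordRep κ (fun i => T (a + i)) (fun y => F (x ++ (y ++ z))) b where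
  lt x' y' p q hl hpq := by
    have := h.lt (x ++ x') (y' ++ z) p q (by simp only [List.length_append]; omega) hpq
    simpa [hx] using this
  eq x' y' p hl := by
    have := h.eq (x ++ x') (y' ++ z) p (by simp only [List.length_append]; omega)
    simpa [hx] using this
  gt x' y' p q hl hpq := by
    have := h.gt (x ++ x') (y' ++ z) p q (by simp only [List.length_append]; omega) hpq
    simpa [hx] using this

/-- Reading the words backwards reverses the order of the letters. -/
theorem reverse (h : IsWordRep κ T F N) :
    IsWordRep (fun a => -κ a) (fun i => T (N - 2 - i)) (fun x => F x.reverse) N where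
  lt x y a b hl hab := by
    have := h.lt y.reverse x.reverse b a (by simp only [List.length_reverse]; omega) (by omega)
    rw [show N - 2 - x.length = y.length by omega]
    simpa using this
  eq x y a hl := by
    have := h.eq y.reverse x.reverse a (by simp only [List.length_reverse]; omega)
    rw [show N - 2 - x.length = y.length by omega]
    simpa using this
  gt x y a b hl hab := by
    have := h.gt y.reverse x.reverse b a (by simp only [List.length_reverse]; omega) (by omega)
    rw [show N - 2 - x.length = y.length by omega]
    simpa using this

end IsWordRep

/-- The sum of the products `T k ⋯ T (N-1)` over `k ≤ N`: the last of `N + 1` letters is inserted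
at all places. -/
def insertOp (T : ℕ → R) : ℕ → R
  | 0 => 1
  | N + 1 => 1 + insertOp T N * T N

/-- `1 + q + ⋯ + q^(k-1)`, with `q = v²`. -/
def qSum (k : ℕ) : K := ∑ i ∈ Finset.range k, (v ^ 2) ^ i

theorem qSum_succ' (k : ℕ) : qSum (k + 1) = 1 + v ^ 2 * qSum k := by
  rw [qSum, Finset.sum_range_succ', qSum, Finset.mul_sum, add_comm]
  simp [pow_succ']

theorem mul_qSum (k : ℕ) : (v ^ 2 - 1) * qSum k = (v ^ 2) ^ k - 1 := mul_geom_sum _ _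

variable [DecidableEq α]

theorem sum_telescope (κ : α → ℤ) (hκ : Function.Injective κ) (f : α → ℕ) (S : Finset α) :
    ∑ z ∈ S, (v ^ 2) ^ (∑ j ∈ S with κ z < κ j, f j) * ((v ^ 2) ^ f z - 1) =
      (v ^ 2) ^ (∑ j ∈ S, f j) - 1 := by
  induction S using Finset.induction_on_min_value κ with
  | empty => simp
  | insert a S ha hmin ih =>
    have h1 : ∀ x ∈ S, κ a < κ x := fun x hx =>
      lt_of_le_of_ne (hmin x hx) fun h => ha (hκ h ▸ hx)
    rw [Finset.sum_insert ha, Finset.sum_insert ha, Finset.filter_insert, if_neg (lt_irrefl _),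
      Finset.filter_true_of_mem h1]
    have h2 : ∑ z ∈ S, (v ^ 2) ^ (∑ j ∈ insert a S with κ z < κ j, f j) * ((v ^ 2) ^ f z - 1) =
        ∑ z ∈ S, (v ^ 2) ^ (∑ j ∈ S with κ z < κ j, f j) * ((v ^ 2) ^ f z - 1) := by
      refine Finset.sum_congr rfl fun z hz => ?_
      rw [Finset.filter_insert, if_neg (not_lt.mpr (h1 z hz).le)]
    rw [h2, ih, pow_add]
    ring

variable [Fintype α]

/-- The number of letters of a multiset that are greater than `u`, with respect to `κ`. -/
def numGt (κ : α → ℤ) (u : α) (s : Multiset α) : ℕ := ∑ j with κ u < κ j, s.count j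

theorem numGt_cons (κ : α → ℤ) (u z : α) (s : Multiset α) :
    numGt κ u (z ::ₘ s) = numGt κ u s + if κ u < κ z then 1 else 0 := by
  simp only [numGt, Multiset.count_cons, Finset.sum_add_distrib]
  congr 1
  rw [Finset.sum_ite_eq']
  simp

/-- The coefficient with which a letter `u` is inserted into words with letters `s`: a factor `q`
for each greater letter that `u` passes, and `1 + q + ⋯ + q^k` for its `k` copies in `s`. -/
def insertCoef (κ : α → ℤ) (u : α) (s : Multiset α) : K :=
  (v ^ 2) ^ numGt κ u s * qSum (s.count u + 1)

theorem sum_telescope_numGt (κ : α → ℤ) (hκ : Function.Injective κ) (u : α) (s : Multiset α) :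
    ∑ z with κ u < κ z, (v ^ 2 - 1) * ((v ^ 2) ^ numGt κ z s * qSum (s.count z)) =
      (v ^ 2) ^ numGt κ u s - 1 := by
  rw [numGt, ← sum_telescope κ hκ]
  refine Finset.sum_congr rfl fun z hz => ?_
  simp only [Finset.mem_filter, Finset.mem_univ, true_and] at hz
  rw [mul_left_comm, mul_qSum, numGt, Finset.filter_filter]
  congr 3
  ext j
  simp only [Finset.mem_filter, Finset.mem_univ, true_and]
  exact ⟨fun h => ⟨hz.trans h, h⟩, fun h => h.2⟩

/-- Insertion of a letter `u` into all words with letters `s`. The induction splits off the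
last letter `z` of the word before `u`; the summands with `z ≠ u` give the words that end in `z`,
and the remaining multiples of the words that end in `u` telescope. -/
theorem insertOp_mul_sum {κ : α → ℤ} (hκ : Function.Injective κ) {T : ℕ → R} {F : List α → R}
    {N : ℕ} (hF : IsWordRep κ T F (N + 1)) (s : Multiset α) (hs : s.card = N) (u : α) :
    insertOp T N * ∑ x ∈ words s, F (x ++ [u]) =
      insertCoef κ u s • ∑ y ∈ words (u ::ₘ s), F y := by
  induction N generalizing F s u with
  | zero =>
    rw [Multiset.card_eq_zero] at hs
    subst hs
    have h0 : words (0 : Multiset α) = {[]} := by ext x; simp [mem_words]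
    have h1 : words ({u} : Multiset α) = {[u]} := by
      ext x
      simp [mem_words]
    simp [insertOp, insertCoef, qSum, numGt, h0, h1]
  | succ N ih =>
    have hs0 : s ≠ 0 := by rintro rfl; simp at hs
    -- words that end in `z`
    have hFz : ∀ z, IsWordRep κ T (fun x => F (x ++ [z])) (N + 1) := fun z => by
      have := (hF.congr_length (by omega : _ = 0 + (N + 1) + 1)).restrict (x := []) (z := [z])
        rfl rfl
      simpa using this
    set W : α → R := fun z => ∑ y ∈ words ((u ::ₘ s).erase z), F (y ++ [z])
    have hW : ∀ z, W z = ∑ y ∈ words ((u ::ₘ s).erase z), F (y ++ [z]) := fun _ => rfl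
    have hcard : ∀ z ∈ s, (s.erase z).card = N := fun z hz => by
      rw [Multiset.card_erase_of_mem hz, hs]; rfl
    have hQ : ∀ z ∈ s, z ≠ u → insertOp T N * ∑ x ∈ words (s.erase z), F (x ++ [u] ++ [z]) =
        insertCoef κ u (s.erase z) • W z := fun z hz hzu => by
      rw [ih (hFz z) _ (hcard z hz), hW, Multiset.erase_cons_tail _ (Ne.symm hzu)]
    have hP : ∀ z ∈ s, insertOp T N * ∑ x ∈ words (s.erase z), F (x ++ [z] ++ [u]) =
        ((v ^ 2) ^ numGt κ z s * qSum (s.count z)) • W u := fun z hz => by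
      rw [ih (hFz u) _ (hcard z hz), hW, Multiset.cons_erase hz, Multiset.erase_cons_head]
      have h1 := numGt_cons κ z z (s.erase z)
      rw [Multiset.cons_erase hz, if_neg (lt_irrefl _), add_zero] at h1
      have h2 := Multiset.count_cons_self z (s.erase z)
      rw [Multiset.cons_erase hz] at h2
      rw [insertCoef, h1, h2]
    have hterm : ∀ z ∈ s, insertOp T N * (T N * ∑ x ∈ words (s.erase z), F (x ++ [z] ++ [u])) =
        (if z ≠ u then insertCoef κ u s • W z else 0) +
        ((if z = u then v ^ 2 * ((v ^ 2) ^ numGt κ u s * qSum (s.count u)) else 0) +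
          (if κ u < κ z then (v ^ 2 - 1) * ((v ^ 2) ^ numGt κ z s * qSum (s.count z)) else 0)) •
            W u := by
      intro z hz
      have hg := numGt_cons κ u z (s.erase z)
      have hc := Multiset.count_cons u z (s.erase z)
      rw [Multiset.cons_erase hz] at hg hc
      have hlen : ∀ x ∈ words (s.erase z), x.length = N := fun x hx =>
        (length_of_mem_words hx).trans (hcard z hz)
      rcases lt_trichotomy (κ z) (κ u) with h | h | h
      · have hzu : z ≠ u := fun e => by rw [e] at h; exact lt_irrefl _ h
        have h1 : T N * ∑ x ∈ words (s.erase z), F (x ++ [z] ++ [u]) =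
            ∑ x ∈ words (s.erase z), F (x ++ [u] ++ [z]) := by
          rw [Finset.mul_sum]
          refine Finset.sum_congr rfl fun x hx => ?_
          have := hF.lt x [] z u (by rw [hlen x hx]; simp) h
          rw [hlen x hx] at this
          simpa using this
        rw [if_neg (not_lt.mpr h.le), add_zero] at hg
        rw [if_neg hzu.symm, add_zero] at hc
        rw [h1, hQ z hz hzu, if_pos hzu, if_neg hzu, if_neg (not_lt.mpr h.le), insertCoef,
          insertCoef, hg, hc]
        simp
      · obtain rfl : z = u := hκ h
        have h1 : T N * ∑ x ∈ words (s.erase z), F (x ++ [z] ++ [z]) =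
            v ^ 2 • ∑ x ∈ words (s.erase z), F (x ++ [z] ++ [z]) := by
          rw [Finset.mul_sum, Finset.smul_sum]
          refine Finset.sum_congr rfl fun x hx => ?_
          have := hF.eq x [] z (by rw [hlen x hx]; simp)
          rw [hlen x hx] at this
          simpa using this
        rw [h1, mul_smul_comm, hP z hz, smul_smul]
        simp
      · have hzu : z ≠ u := fun e => by rw [e] at h; exact lt_irrefl _ h
        have h1 : T N * ∑ x ∈ words (s.erase z), F (x ++ [z] ++ [u]) =
            v ^ 2 • ∑ x ∈ words (s.erase z), F (x ++ [u] ++ [z]) +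
              (v ^ 2 - 1) • ∑ x ∈ words (s.erase z), F (x ++ [z] ++ [u]) := by
          rw [Finset.mul_sum, Finset.smul_sum, Finset.smul_sum, ← Finset.sum_add_distrib]
          refine Finset.sum_congr rfl fun x hx => ?_
          have := hF.gt x [] z u (by rw [hlen x hx]; simp) h
          rw [hlen x hx] at this
          simpa using this
        rw [if_pos h] at hg
        rw [if_neg hzu.symm, add_zero] at hc
        rw [h1, mul_add, mul_smul_comm, mul_smul_comm, hQ z hz hzu, hP z hz, if_pos hzu,
          if_neg hzu, if_pos h, insertCoef, insertCoef, hg, hc, zero_add, smul_smul, smul_smul,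
          pow_succ']
        congr 2
        ring
    have hP1 : ∑ x ∈ words s, F (x ++ [u]) = W u := by
      rw [hW, Multiset.erase_cons_head]
    have hcons : (u ::ₘ s) ≠ 0 := Multiset.cons_ne_zero
    rw [insertOp, add_mul, one_mul, mul_assoc, hP1, ← hP1, sum_words_snoc hs0
      (fun x => F (x ++ [u])), Finset.mul_sum, Finset.mul_sum,
      Finset.sum_congr rfl fun z hz => hterm z (by simpa using hz),
      ← sum_words_snoc hs0 (fun x => F (x ++ [u])), hP1, sum_words_snoc hcons,
      Finset.sum_add_distrib, ← Finset.sum_smul, Finset.sum_add_distrib]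
    have e1 : ∑ z with z ∈ s, (if z = u then v ^ 2 * ((v ^ 2) ^ numGt κ u s * qSum (s.count u))
        else 0) = v ^ 2 * ((v ^ 2) ^ numGt κ u s * qSum (s.count u)) := by
      rw [Finset.sum_ite_eq']
      by_cases hu : u ∈ s
      · simp [hu]
      · simp [hu, qSum]
    have e2 : ∑ z with z ∈ s, (if κ u < κ z then
        (v ^ 2 - 1) * ((v ^ 2) ^ numGt κ z s * qSum (s.count z)) else 0) =
        (v ^ 2) ^ numGt κ u s - 1 := by
      rw [← sum_telescope_numGt κ hκ, Finset.sum_filter, Finset.sum_filter]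
      refine Finset.sum_congr rfl fun z _ => ?_
      by_cases hz : z ∈ s
      · simp [hz]
      · simp [hz, qSum]
    have e3 : ∑ z with z ∈ u ::ₘ s, W z = W u + ∑ z with z ∈ s, if z ≠ u then W z else 0 := by
      rw [← Finset.add_sum_erase (a := u) _ _ (by simp)]
      congr 1
      rw [← Finset.sum_filter, Finset.filter_filter]
      refine Finset.sum_congr ?_ fun _ _ => rfl
      ext z
      simp only [Finset.mem_erase, Finset.mem_filter, Finset.mem_univ, true_and, Multiset.mem_cons]
      tauto
    have e4 : ∑ z with z ∈ s, (if z ≠ u then insertCoef κ u s • W z else 0) =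
        insertCoef κ u s • ∑ z with z ∈ s, if z ≠ u then W z else 0 := by
      rw [Finset.smul_sum]
      refine Finset.sum_congr rfl fun z _ => ?_
      split_ifs <;> simp
    rw [e1, e2, e4]
    change _ = insertCoef κ u s • ∑ z with z ∈ u ::ₘ s, W z
    have hC : insertCoef κ u s = 1 + (v ^ 2 * ((v ^ 2) ^ numGt κ u s * qSum (s.count u)) +
        ((v ^ 2) ^ numGt κ u s - 1)) := by
      rw [insertCoef, qSum_succ']
      ring
    have hCW := congrArg (· • W u) hC
    simp only [add_smul (1 : K), one_smul] at hCW
    rw [e3, smul_add, hCW]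
    abel

/-- The first letter `u` of a block `s'` is moved into the preceding block `s`. -/
theorem insertOp_mul_blockLists {κ : α → ℤ} (hκ : Function.Injective κ) {T : ℕ → R}
    {F : List α → R} {N : ℕ} (hF : IsWordRep κ T F N) (S S' : List (Multiset α))
    (s s' : Multiset α) (hs' : s' ≠ 0)
    (hN : N = ((S ++ s :: s' :: S').map Multiset.card).sum) :
    insertOp (fun i => T ((S.map Multiset.card).sum + i)) s.card *
        ∑ x ∈ blockLists (S ++ s :: s' :: S'), F x =
      ∑ u with u ∈ s', insertCoef κ u s •
        ∑ x ∈ blockLists (S ++ (u ::ₘ s) :: (s'.erase u) :: S'), F x := by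
  have hsplit : ∀ f : List α → R, ∑ x ∈ blockLists (S ++ s :: s' :: S'), f x =
      ∑ u with u ∈ s', ∑ x ∈ blockLists S, ∑ z ∈ words (s'.erase u), ∑ w ∈ blockLists S',
        ∑ y ∈ words s, f (x ++ (y ++ [u] ++ (z ++ w))) := by
    intro f
    rw [sum_blockLists_append]
    simp only [sum_blockLists_cons, sum_words_cons hs']
    rw [Finset.sum_comm (t := blockLists S)]
    refine Finset.sum_congr rfl fun x _ => ?_
    rw [Finset.sum_comm]
    refine Finset.sum_congr rfl fun u _ => ?_
    rw [Finset.sum_comm]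
    refine Finset.sum_congr rfl fun z _ => ?_
    rw [Finset.sum_comm]
    refine Finset.sum_congr rfl fun w _ => Finset.sum_congr rfl fun y _ => ?_
    simp
  rw [hsplit, Finset.mul_sum]
  refine Finset.sum_congr rfl fun u hu => ?_
  have hu' : u ∈ s' := by simpa using hu
  rw [sum_blockLists_append, Finset.mul_sum, Finset.smul_sum]
  refine Finset.sum_congr rfl fun x hx => ?_
  simp only [sum_blockLists_cons]
  rw [Finset.sum_comm (s := words (u ::ₘ s)), Finset.mul_sum, Finset.smul_sum]
  refine Finset.sum_congr rfl fun z hz => ?_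
  rw [Finset.sum_comm (s := words (u ::ₘ s)), Finset.mul_sum, Finset.smul_sum]
  refine Finset.sum_congr rfl fun w hw => ?_
  have hx1 := length_of_mem_blockLists hx
  have hw1 := length_of_mem_blockLists hw
  have hz1 := length_of_mem_words hz
  have hcard := Multiset.card_erase_add_one hu'
  refine insertOp_mul_sum hκ (F := fun y => F (x ++ (y ++ (z ++ w)))) ?_ s rfl u
  refine (hF.congr_length ?_).restrict (z := z ++ w) hx1 rfl
  rw [hN, List.length_append, hz1, hw1]
  simp only [List.map_append, List.map_cons, List.sum_append, List.sum_cons]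
  omega

/-- The last letter `u` of a block `s` is moved into the following block `s'`. -/
theorem insertOp_mul_blockLists' {κ : α → ℤ} (hκ : Function.Injective κ) {T : ℕ → R}
    {F : List α → R} {N : ℕ} (hF : IsWordRep κ T F N) (S S' : List (Multiset α))
    (s s' : Multiset α) (hs : s ≠ 0)
    (hN : N = ((S ++ s :: s' :: S').map Multiset.card).sum) :
    insertOp (fun i => T (N - 2 - ((S'.map Multiset.card).sum + i))) s'.card *
        ∑ x ∈ blockLists (S ++ s :: s' :: S'), F x =
      ∑ u with u ∈ s, insertCoef (fun a => -κ a) u s' •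
        ∑ x ∈ blockLists (S ++ (s.erase u) :: (u ::ₘ s') :: S'), F x := by
  have h := insertOp_mul_blockLists (κ := fun a => -κ a) (fun a b hab => hκ (neg_injective hab))
    hF.reverse S'.reverse S.reverse s' s hs
    (by rw [hN]
        simp only [List.map_append, List.map_cons, List.sum_append, List.sum_cons,
          List.map_reverse, List.sum_reverse]
        omega)
  have hrev : ∀ a b : Multiset α, S'.reverse ++ b :: a :: S.reverse =
      (S ++ a :: b :: S').reverse := by intro a b; simp
  simp only [hrev, sum_blockLists_reverse, List.map_reverse, List.sum_reverse] at h
  exact h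

end Action

/-! ### Blocks of letters -/

section Blocks

variable {n r : ℕ}

/-- The number of letters before the block `k`. -/
def start (l : Comp n r) (k : ℕ) : ℕ := ∑ t : Fin n with t.val < k, l.1 t

theorem start_mono (l : Comp n r) {k k' : ℕ} (h : k ≤ k') : start l k ≤ start l k' := by
  apply Finset.sum_le_sum_of_subset
  intro t
  simp only [Finset.mem_filter, Finset.mem_univ, true_and]
  omega

theorem start_succ (l : Comp n r) (k : Fin n) : start l (k + 1) = start l k + l.1 k := by
  have h : (Finset.univ.filter fun t : Fin n => t.val < k + 1) =
      insert k (Finset.univ.filter fun t : Fin n => t.val < k) := by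
    ext t
    simp only [Finset.mem_filter, Finset.mem_univ, true_and, Finset.mem_insert, Fin.ext_iff]
    omega
  rw [start, h, Finset.sum_insert (by simp), start, add_comm]

theorem start_le (l : Comp n r) (k : ℕ) : start l k ≤ r := by
  conv_rhs => rw [← l.2]
  exact Finset.sum_le_sum_of_subset (Finset.subset_univ _)

theorem start_top (l : Comp n r) : start l n = r := by
  conv_rhs => rw [← l.2]
  rw [start, Finset.filter_true_of_mem fun t _ => t.2]

theorem mem_block {l : Comp n r} {i : Fin n} {p : Fin r} :
    p ∈ block l i ↔ start l i ≤ p ∧ (p : ℕ) < start l (i + 1) := by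
  rw [start_succ]
  simp only [block, start, Fin.lt_def, Set.mem_ofPred_eq]

theorem exists_mem_block (l : Comp n r) (p : Fin r) : ∃ i, p ∈ block l i := by
  classical
  have h : ∃ k, (p : ℕ) < start l k := ⟨n, by rw [start_top]; exact p.2⟩
  have h1 := Nat.find_spec h
  have h0 : Nat.find h ≠ 0 := fun h0 => by rw [h0] at h1; simp [start] at h1
  obtain ⟨k, hk⟩ := Nat.exists_eq_succ_of_ne_zero h0
  have h2 : ¬ (p : ℕ) < start l k := Nat.find_min h (by omega)
  have hn : k < n := by
    by_contra hkn
    have := start_mono l (not_lt.mp hkn)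
    rw [start_top] at this
    omega
  rw [hk] at h1
  exact ⟨⟨k, hn⟩, mem_block.mpr ⟨not_lt.mp h2, h1⟩⟩

/-- The index of the block that contains a letter. -/
def blk (l : Comp n r) (p : Fin r) : Fin n := (exists_mem_block l p).choose

theorem blk_spec (l : Comp n r) (p : Fin r) : p ∈ block l (blk l p) :=
  (exists_mem_block l p).choose_spec

theorem le_of_mem_block {l : Comp n r} {p q : Fin r} {i j : Fin n} (hp : p ∈ block l i)
    (hq : q ∈ block l j) (h : p ≤ q) : i ≤ j := by
  rw [mem_block] at hp hq
  by_contra hij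
  have : (j : ℕ) + 1 ≤ i := not_le.mp hij
  have := start_mono l this
  have : (p : ℕ) ≤ q := h
  omega

theorem mem_block_iff {l : Comp n r} {p : Fin r} {i : Fin n} : p ∈ block l i ↔ blk l p = i :=
  ⟨fun h => le_antisymm (le_of_mem_block (blk_spec l p) h le_rfl)
    (le_of_mem_block h (blk_spec l p) le_rfl), fun h => h ▸ blk_spec l p⟩

theorem blk_mono (l : Comp n r) : Monotone (blk l) := fun p q h =>
  le_of_mem_block (blk_spec l p) (blk_spec l q) h

theorem card_blk (l : Comp n r) (i : Fin n) :
    (Finset.univ.filter fun p => blk l p = i).card = l.1 i := by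
  have h1 := start_succ l i
  have h2 := start_le l (i + 1)
  rw [← Finset.card_map Fin.valEmbedding]
  have : (Finset.univ.filter fun p => blk l p = i).map Fin.valEmbedding =
      Finset.Ico (start l i) (start l (i + 1)) := by
    ext k
    simp only [Finset.mem_map, Finset.mem_filter, Finset.mem_univ, true_and, Fin.valEmbedding_apply,
      Finset.mem_Ico]
    constructor
    · rintro ⟨p, hp, rfl⟩
      exact mem_block.mp (mem_block_iff.mpr hp)
    · rintro ⟨a, b⟩
      exact ⟨⟨k, by omega⟩, mem_block_iff.mp (mem_block.mpr ⟨a, b⟩), rfl⟩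
  rw [this, Nat.card_Ico]
  omega

theorem mem_young {l : Comp n r} {w : Equiv.Perm (Fin r)} :
    w ∈ young l ↔ ∀ p, blk l (w p) = blk l p := by
  simp only [young, Subgroup.mem_iInf, MulAction.mem_stabilizer_iff]
  constructor
  · intro h p
    rw [← mem_block_iff, ← h (blk l p)]
    exact Set.smul_mem_smul_set (blk_spec l p)
  · intro h i
    ext p
    rw [Set.mem_smul_set_iff_inv_smul_mem, mem_block_iff, mem_block_iff, Equiv.Perm.smul_def,
      ← h (w⁻¹ p)]
    simp

/-- The word of a permutation: the place `p` carries the index of the block of `w⁻¹ p`. -/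
def word (m : Comp n r) (w : Equiv.Perm (Fin r)) (p : Fin r) : Fin n := blk m (w⁻¹ p)

theorem word_mul (m : Comp n r) (w w' : Equiv.Perm (Fin r)) (p : Fin r) :
    word m (w * w') p = word m w' (w⁻¹ p) := by
  simp [word, mul_inv_rev]

theorem jmath_apply (l m : Comp n r) (w : Equiv.Perm (Fin r)) (i j : Fin n) :
    jmath l w m i j = ((Finset.univ.filter fun p => blk l p = i ∧ word m w p = j).card : ℤ) := by
  rw [jmath, Matrix.of_apply, ← Set.ncard_coe_finset]
  congr 2
  ext p
  simp only [Set.mem_inter_iff, Finset.mem_coe, Finset.mem_filter, Finset.mem_univ, true_and,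
    mem_block_iff, Set.mem_image]
  simp only [word]
  constructor
  · rintro ⟨h1, q, h2, rfl⟩
    exact ⟨h1, by simpa using h2⟩
  · rintro ⟨h1, h2⟩
    exact ⟨h1, w⁻¹ p, h2, by simp⟩

theorem jmath_nonneg (l m : Comp n r) (w : Equiv.Perm (Fin r)) (i j : Fin n) :
    0 ≤ jmath l w m i j := by rw [jmath_apply]; positivity

theorem sum_jmath_row (l m : Comp n r) (w : Equiv.Perm (Fin r)) (i : Fin n) :
    ∑ j, jmath l w m i j = l.1 i := by
  simp only [jmath_apply]
  rw [← card_blk l i, ← Nat.cast_sum]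
  congr 1
  rw [Finset.card_eq_sum_card_fiberwise (f := word m w) (t := Finset.univ)
    (fun _ _ => Finset.mem_coe.mpr (Finset.mem_univ _))]
  simp only [Finset.filter_filter]

theorem jmath_inv (l m : Comp n r) (w : Equiv.Perm (Fin r)) :
    jmath m w⁻¹ l = (jmath l w m).transpose := by
  ext i j
  rw [Matrix.transpose_apply, jmath_apply, jmath_apply]
  congr 1
  refine Finset.card_bij' (fun p _ => w p) (fun p _ => w⁻¹ p) ?_ ?_ ?_ ?_
  · intro p hp
    simp only [Finset.mem_filter, Finset.mem_univ, true_and] at hp ⊢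
    simpa [word, and_comm] using hp
  · intro p hp
    simp only [Finset.mem_filter, Finset.mem_univ, true_and] at hp ⊢
    simpa [word, and_comm] using hp
  · simp
  · simp

theorem sum_jmath_col (l m : Comp n r) (w : Equiv.Perm (Fin r)) (j : Fin n) :
    ∑ i, jmath l w m i j = m.1 j := by
  rw [← sum_jmath_row m l w⁻¹ j, jmath_inv]
  rfl

/-- Two functions whose fibres have equal sizes differ by a permutation. -/
theorem exists_equiv_comp {X Y Z : Type*} [Fintype X] [Fintype Y] [DecidableEq Z] (f : X → Z)
    (g : Y → Z) (h : ∀ z, (Finset.univ.filter fun x => f x = z).card =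
      (Finset.univ.filter fun y => g y = z).card) : ∃ e : X ≃ Y, ∀ x, g (e x) = f x := by
  have e : ∀ z, {x // f x = z} ≃ {y // g y = z} := fun z =>
    Fintype.equivOfCardEq (by rw [Fintype.card_subtype, Fintype.card_subtype, h])
  refine ⟨(Equiv.sigmaFiberEquiv f).symm.trans
    ((Equiv.sigmaCongrRight e).trans (Equiv.sigmaFiberEquiv g)), fun x => ?_⟩
  exact (e (f x) ⟨x, rfl⟩).2

/-- A double coset consists of the permutations with a given matrix. -/
theorem dcoset_eq (l m : Comp n r) (d : Equiv.Perm (Fin r)) :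
    dcoset l d m = {w | jmath l w m = jmath l d m} := by
  ext w
  rw [dcoset, DoubleCoset.mem_doubleCoset, Set.mem_ofPred_eq]
  constructor
  · rintro ⟨a, ha, b, hb, rfl⟩
    ext i j
    rw [jmath_apply, jmath_apply]
    congr 1
    have ha' := mem_young.mp (inv_mem ha)
    have ha'' := mem_young.mp ha
    have hb' := mem_young.mp (inv_mem hb)
    have hb'' := mem_young.mp hb
    have hw : ∀ p, word m (a * d * b) p = word m d (a⁻¹ p) := by
      intro p
      simp only [word, mul_inv_rev, Equiv.Perm.mul_apply]
      exact hb' _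
    refine Finset.card_bij' (fun p _ => a⁻¹ p) (fun p _ => a p) ?_ ?_ ?_ ?_
    · intro p hp
      simp only [Finset.mem_filter, Finset.mem_univ, true_and, hw, ha'] at hp ⊢
      exact hp
    · intro p hp
      simp only [Finset.mem_filter, Finset.mem_univ, true_and, hw, ha''] at hp ⊢
      simpa using hp
    · simp
    · simp
  · intro h
    obtain ⟨e, he⟩ := exists_equiv_comp (fun p => (blk l p, word m d p))
      (fun p => (blk l p, word m w p)) (by
        rintro ⟨i, j⟩
        have := congrFun (congrFun h i) j
        rw [jmath_apply, jmath_apply] at this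
        simpa only [Prod.mk.injEq] using (Nat.cast_injective this).symm)
    have h1 : ∀ p, blk l (e p) = blk l p := fun p => congrArg Prod.fst (he p)
    have h2 : ∀ p, word m w (e p) = word m d p := fun p => congrArg Prod.snd (he p)
    refine ⟨e, mem_young.mpr h1, (e * d)⁻¹ * w, ?_, (mul_inv_cancel_left _ _).symm⟩
    refine mem_young.mpr fun p => ?_
    have := h2 (e.symm (w p))
    simp only [word, Equiv.apply_symm_apply] at this
    rw [mul_inv_rev]
    simp only [Equiv.Perm.mul_apply]
    refine this.symm.trans ?_
    simp

theorem exists_jmath_eq {l m : Comp n r} {A : Matrix (Fin n) (Fin n) ℤ} (hA : ∀ i j, 0 ≤ A i j)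
    (hl : ∀ i, ∑ j, A i j = l.1 i) (hm : ∀ j, ∑ i, A i j = m.1 j) :
    ∃ w, jmath l w m = A := by
  have hsum : ∀ i j, (((A i j).toNat : ℕ) : ℤ) = A i j := fun i j => Int.toNat_of_nonneg (hA i j)
  let X := Σ p : Fin n × Fin n, Fin (A p.1 p.2).toNat
  have hcard : ∀ P : Fin n × Fin n → Prop, ∀ _ : DecidablePred P,
      (Finset.univ.filter fun x : X => P x.1).card = ∑ p with P p, (A p.1 p.2).toNat := by
    intro P _
    rw [← Finset.univ_sigma_univ, Finset.card_filter, Finset.sum_sigma, Finset.sum_filter]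
    refine Finset.sum_congr rfl fun p _ => ?_
    split_ifs <;> simp
  have hrow : ∀ i, (Finset.univ.filter fun x : X => x.1.1 = i).card = l.1 i := by
    intro i
    rw [hcard (fun p => p.1 = i) inferInstance]
    zify
    rw [← hl, Finset.sum_filter, Fintype.sum_prod_type, Finset.sum_eq_single i]
    · simp [hsum]
    · intro b _ hb; simp [hb]
    · simp
  have hcol : ∀ j, (Finset.univ.filter fun x : X => x.1.2 = j).card = m.1 j := by
    intro j
    rw [hcard (fun p => p.2 = j) inferInstance]
    zify
    rw [← hm, Finset.sum_filter, Fintype.sum_prod_type]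
    refine Finset.sum_congr rfl fun i _ => ?_
    rw [Finset.sum_eq_single j]
    · simp [hsum]
    · intro b _ hb; simp [hb]
    · simp
  obtain ⟨e, he⟩ := exists_equiv_comp (blk l) (fun x : X => x.1.1)
    fun i => (card_blk l i).trans (hrow i).symm
  obtain ⟨f, hf⟩ := exists_equiv_comp (blk m) (fun x : X => x.1.2)
    fun i => (card_blk m i).trans (hcol i).symm
  refine ⟨f.trans e.symm, ?_⟩
  ext i j
  rw [jmath_apply, ← hsum]
  congr 1
  have h1 : ∀ p, word m (f.trans e.symm) p = (e p).1.2 := by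
    intro p
    rw [word, ← hf]
    congr 2
    change f (f.symm (e p)) = e p
    simp
  have h2 : (A i j).toNat = (Finset.univ.filter fun x : X => x.1 = (i, j)).card := by
    rw [hcard (fun p => p = (i, j)) inferInstance, Finset.filter_eq']
    simp
  rw [h2]
  refine Finset.card_bij' (fun p _ => e p) (fun x _ => e.symm x) ?_ ?_ ?_ ?_
  · intro p hp
    simp only [Finset.mem_filter, Finset.mem_univ, true_and, h1, ← he] at hp ⊢
    exact Prod.ext hp.1 hp.2
  · intro p hp
    simp only [Finset.mem_filter, Finset.mem_univ, true_and, h1, ← he] at hp ⊢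
    simp [hp]
  · simp
  · simp

theorem word_eq_blk_iff {m : Comp n r} {w : Equiv.Perm (Fin r)} :
    word m w = blk m ↔ w ∈ young m := by
  rw [← inv_mem_iff, mem_young, funext_iff]
  rfl

/-- The matrix of the double coset of the identity. -/
theorem jmath_self_eq_diag_iff {l : Comp n r} {w : Equiv.Perm (Fin r)} :
    jmath l w l = diag l.1 ↔ w ∈ young l := by
  rw [← word_eq_blk_iff]
  constructor
  · intro h
    funext p
    by_contra hp
    have := congrFun (congrFun h (blk l p)) (word l w p)
    rw [jmath_apply, diag, Matrix.diagonal_apply_ne _ (Ne.symm hp), Nat.cast_eq_zero,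
      Finset.card_eq_zero, Finset.filter_eq_empty_iff] at this
    exact this (Finset.mem_univ p) ⟨rfl, rfl⟩
  · intro h
    ext i j
    rw [jmath_apply, h]
    by_cases hij : i = j
    · subst hij
      rw [diag, Matrix.diagonal_apply_eq]
      simp [card_blk]
    · rw [diag, Matrix.diagonal_apply_ne _ hij, Nat.cast_eq_zero, Finset.card_eq_zero,
        Finset.filter_eq_empty_iff]
      rintro p - ⟨rfl, h2⟩
      exact hij h2

end Blocks

/-! ### Double coset sums in the Hecke algebra -/

section CosetSums

variable {n r : ℕ}

/-- The generators of the Hecke algebra, numbered by all natural numbers; those with numbers out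
of range are `0`. -/
def genNat (r : ℕ) (i : ℕ) : Hecke r := if h : i < r - 1 then heckeGen r ⟨i, h⟩ else 0

open Classical in
/-- The sum of the `T_w` over all `w` with a given word. -/
def wordSum (m : Comp n r) (c : Fin r → Fin n) : Hecke r := ∑ w with word m w = c, heckeT r w

theorem asc_of_word_lt {m : Comp n r} {w : Equiv.Perm (Fin r)} {i : Fin (r - 1)}
    (h : word m w (lo i) < word m w (hi i)) : Asc w i := by
  by_contra h'
  exact absurd h (not_lt.mpr (blk_mono m (not_lt.mp h')))

theorem word_simpleRefl_mul (m : Comp n r) (w : Equiv.Perm (Fin r)) (i : Fin (r - 1)) :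
    word m (simpleRefl r i * w) = word m w ∘ simpleRefl r i := by
  funext p
  rw [word_mul, simpleRefl_inv]; rfl

open Classical in
theorem sum_word_simpleRefl {M : Type*} [AddCommMonoid M] (m : Comp n r) (c : Fin r → Fin n)
    (i : Fin (r - 1)) (f : Equiv.Perm (Fin r) → M) :
    ∑ w with word m w = c, f (simpleRefl r i * w) =
      ∑ w with word m w = c ∘ simpleRefl r i, f w := by
  refine Finset.sum_bij' (fun w _ => simpleRefl r i * w) (fun w _ => simpleRefl r i * w)
    ?_ ?_ ?_ ?_ ?_
  · intro w hw
    simp only [Finset.mem_filter, Finset.mem_univ, true_and] at hw ⊢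
    rw [word_simpleRefl_mul, hw]
  · intro w hw
    simp only [Finset.mem_filter, Finset.mem_univ, true_and] at hw ⊢
    rw [word_simpleRefl_mul, hw]
    funext p
    simp [← Equiv.Perm.mul_apply]
  · simp
  · simp
  · simp

theorem heckeGen_mul_wordSum_lt {m : Comp n r} {c : Fin r → Fin n} {i : Fin (r - 1)}
    (h : c (lo i) < c (hi i)) :
    heckeGen r i * wordSum m c = wordSum m (c ∘ simpleRefl r i) := by
  classical
  rw [wordSum, wordSum, ← sum_word_simpleRefl, Finset.mul_sum]
  refine Finset.sum_congr rfl fun w hw => ?_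
  simp only [Finset.mem_filter, Finset.mem_univ, true_and] at hw
  exact heckeGen_mul_heckeT (asc_of_word_lt (m := m) (by rw [hw]; exact h))

theorem heckeGen_mul_wordSum_gt {m : Comp n r} {c : Fin r → Fin n} {i : Fin (r - 1)}
    (h : c (hi i) < c (lo i)) :
    heckeGen r i * wordSum m c =
      v ^ 2 • wordSum m (c ∘ simpleRefl r i) + (v ^ 2 - 1) • wordSum m c := by
  classical
  rw [wordSum, wordSum, ← sum_word_simpleRefl, Finset.mul_sum, Finset.smul_sum, Finset.smul_sum,
    ← Finset.sum_add_distrib]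
  refine Finset.sum_congr rfl fun w hw => ?_
  simp only [Finset.mem_filter, Finset.mem_univ, true_and] at hw
  refine heckeGen_mul_heckeT_of_not_asc ?_
  rw [← asc_simpleRefl_mul]
  refine asc_of_word_lt (m := m) ?_
  rw [word_simpleRefl_mul, hw]
  simpa using h

theorem heckeGen_mul_wordSum_eq {m : Comp n r} {c : Fin r → Fin n} {i : Fin (r - 1)}
    (h : c (lo i) = c (hi i)) : heckeGen r i * wordSum m c = v ^ 2 • wordSum m c := by
  classical
  have hc : c ∘ simpleRefl r i = c := by
    funext p
    simp only [Function.comp, simpleRefl_eq, Equiv.swap_apply_def]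
    split_ifs with h1 h2
    · rw [h1, h]
    · rw [h2, h]
    · rfl
  -- the ascents and the descents among the summands are exchanged by the simple reflection
  have h1 := sum_word_simpleRefl m c i (fun w => if Asc w i then 0 else heckeT r w)
  have h2 := sum_word_simpleRefl m c i (fun w => if Asc w i then v ^ 2 • heckeT r w else 0)
  rw [hc] at h1 h2
  have h3 : ∀ w, heckeGen r i * heckeT r w =
      ((if Asc (simpleRefl r i * w) i then 0 else heckeT r (simpleRefl r i * w)) +
        (if Asc (simpleRefl r i * w) i then v ^ 2 • heckeT r (simpleRefl r i * w) else 0)) +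
        (if Asc w i then 0 else (v ^ 2 - 1) • heckeT r w) := by
    intro w
    by_cases hw : Asc w i
    · have := asc_simpleRefl_mul w i
      simp [hw, this, heckeGen_mul_heckeT hw]
    · have := asc_simpleRefl_mul w i
      simp [hw, this, heckeGen_mul_heckeT_of_not_asc hw]
  rw [wordSum, Finset.mul_sum, Finset.sum_congr rfl fun w _ => h3 w, Finset.sum_add_distrib,
    Finset.sum_add_distrib, h1, h2, ← Finset.sum_add_distrib, ← Finset.sum_add_distrib,
    Finset.smul_sum]
  refine Finset.sum_congr rfl fun w _ => ?_
  by_cases hw : Asc w i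
  · simp [hw]
  · simp only [hw, if_false, add_zero]
    rw [← one_smul K (heckeT r w), smul_smul, smul_smul, ← add_smul]
    congr 1; ring

open Classical in
/-- The sum of the `T_w` over all `w` whose word is a given list. -/
def listSum (m : Comp n r) (x : List (Fin n)) : Hecke r :=
  ∑ w with List.ofFn (word m w) = x, heckeT r w

theorem listSum_ofFn (m : Comp n r) (c : Fin r → Fin n) :
    listSum m (List.ofFn c) = wordSum m c := by
  simp [listSum, wordSum, List.ofFn_inj]

theorem exists_ofFn_eq {x y : List (Fin n)} {a b : Fin n} (h : x.length + y.length + 2 = r) :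
    ∃ (c : Fin r → Fin n) (i : Fin (r - 1)), (i : ℕ) = x.length ∧ c (lo i) = a ∧ c (hi i) = b ∧
      List.ofFn c = x ++ a :: b :: y ∧
      List.ofFn (c ∘ simpleRefl r i) = x ++ b :: a :: y := by
  have hlen : (x ++ a :: b :: y).length = r := by
    simp only [List.length_append, List.length_cons]; omega
  refine ⟨fun p => (x ++ a :: b :: y)[(p : ℕ)], ⟨x.length, by omega⟩, rfl, ?_, ?_, ?_, ?_⟩
  · simp [lo]
  · simp [hi, List.getElem_append_right]
  · apply List.ext_getElem
    · simp [hlen]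
    · simp
  · apply List.ext_getElem
    · simp only [List.length_ofFn, List.length_append, List.length_cons]; omega
    · intro k h1 h2
      simp only [List.getElem_ofFn, Function.comp, simpleRefl_val]
      split_ifs with e1 e2
      · subst e1
        simp [List.getElem_append_right]
      · subst e2
        simp [List.getElem_append_right]
      · rcases Nat.lt_or_ge k x.length with hk | hk
        · simp [List.getElem_append_left, hk]
        · obtain ⟨k', rfl⟩ : ∃ k', k = x.length + (k' + 1 + 1) := ⟨k - x.length - 2, by omega⟩
          simp [List.getElem_append_right]

theorem isWordRep_listSum (m : Comp n r) :
    IsWordRep (fun a : Fin n => ((a : ℕ) : ℤ)) (genNat r) (listSum m) r where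
  lt x y a b hl hab := by
    obtain ⟨c, i, hi, ha, hb, h1, h2⟩ := exists_ofFn_eq (a := a) (b := b) hl
    rw [← h1, ← h2, listSum_ofFn, listSum_ofFn, ← heckeGen_mul_wordSum_lt (i := i), genNat,
      ← hi, dif_pos i.2]
    rw [ha, hb]; exact_mod_cast hab
  eq x y a hl := by
    obtain ⟨c, i, hi, ha, hb, h1, h2⟩ := exists_ofFn_eq (a := a) (b := a) hl
    rw [← h1, listSum_ofFn, ← heckeGen_mul_wordSum_eq (i := i) (ha.trans hb.symm), genNat,
      ← hi, dif_pos i.2]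
  gt x y a b hl hab := by
    obtain ⟨c, i, hi, ha, hb, h1, h2⟩ := exists_ofFn_eq (a := a) (b := b) hl
    rw [← h1, ← h2, listSum_ofFn, listSum_ofFn, ← heckeGen_mul_wordSum_gt (i := i), genNat,
      ← hi, dif_pos i.2]
    rw [ha, hb]; exact_mod_cast hab

theorem wordSum_one (m : Comp n r) : wordSum m (word m 1) = xElt m := by
  classical
  rw [wordSum, xElt, heckeSum]
  refine Finset.sum_congr ?_ fun _ _ => rfl
  ext w
  have : word m 1 = blk m := by funext p; simp [word]
  simp only [Finset.mem_filter, Finset.mem_univ, true_and, this, word_eq_blk_iff, SetLike.mem_coe]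

/-- The sum over all `w` with the same word is a left multiple of `x_m`. By induction on the
number of inversions: exchanging two adjacent letters that are in increasing order is the
multiplication by a generator, and all words arise in this way from the word of the identity. -/
theorem wordSum_mem (m : Comp n r) (w : Equiv.Perm (Fin r)) :
    ∃ y, wordSum m (word m w) = y * xElt m := by
  induction hk : inv w generalizing w with
  | zero =>
    have : w = 1 := by
      by_contra hne
      obtain ⟨i, hi⟩ := exists_not_asc hne
      have := inv_simpleRefl_mul_of_not_asc hi
      omega
    exact ⟨1, by rw [this, wordSum_one, one_mul]⟩
  | succ k ih =>
    have hne : w ≠ 1 := by rintro rfl; rw [inv_one] at hk; omega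
    obtain ⟨i, hi'⟩ := exists_not_asc hne
    have h1 := inv_simpleRefl_mul_of_not_asc hi'
    obtain ⟨y, hy⟩ := ih (simpleRefl r i * w) (by omega)
    have h2 := (asc_simpleRefl_mul w i).mpr hi'
    have h3 : word m (simpleRefl r i * w) ∘ simpleRefl r i = word m w := by
      rw [← word_simpleRefl_mul, simpleRefl_mul_self_mul]
    rcases (blk_mono m (le_of_lt h2)).lt_or_eq with h | h
    · refine ⟨heckeGen r i * y, ?_⟩
      rw [mul_assoc, ← hy, heckeGen_mul_wordSum_lt h, h3]
    · refine ⟨y, ?_⟩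
      rw [← hy, ← h3]
      congr 1
      funext p
      simp only [Function.comp, simpleRefl_eq, Equiv.swap_apply_def]
      split_ifs with h4 h5
      · rw [h4]; exact h.symm
      · rw [h5]; exact h
      · rfl

/-- The sum of the `T_w` over the double coset with a given matrix. -/
def cosetSum (l m : Comp n r) (A : Matrix (Fin n) (Fin n) ℤ) : Hecke r :=
  heckeSum {w | jmath l w m = A}

theorem cosetSum_eq_left (l m : Comp n r) (A : Matrix (Fin n) (Fin n) ℤ) :
    ∃ y, cosetSum l m A = y * xElt m := by
  classical
  choose y hy using fun w => wordSum_mem m w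
  have hA : ∀ w w', word m w = word m w' → (jmath l w m = A ↔ jmath l w' m = A) := by
    intro w w' h
    have : jmath l w m = jmath l w' m := by ext i j; rw [jmath_apply, jmath_apply, h]
    rw [this]
  have h1 : cosetSum l m A =
      ∑ c ∈ (Finset.univ.filter fun w => jmath l w m = A).image (word m), wordSum m c := by
    rw [cosetSum, heckeSum, ← Finset.sum_fiberwise_of_maps_to
      (t := (Finset.univ.filter fun w => jmath l w m = A).image (word m)) (g := word m)]
    · refine Finset.sum_congr rfl fun c hc => ?_
      rw [wordSum]
      refine Finset.sum_congr ?_ fun _ _ => rfl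
      simp only [Finset.mem_image, Finset.mem_filter, Finset.mem_univ, true_and] at hc
      obtain ⟨w, hw, rfl⟩ := hc
      ext w'
      simp only [Finset.mem_filter, Finset.mem_univ, true_and, Set.mem_ofPred_eq,
        and_iff_right_iff_imp]
      exact fun h => (hA w' w h).mpr hw
    · intro w hw
      simp only [Finset.mem_filter, Finset.mem_univ, true_and, Set.mem_ofPred_eq] at hw
      exact Finset.mem_image_of_mem _ (by simpa using hw)
  have h2 : cosetSum l m A ∈ LinearMap.range (LinearMap.mulRight K (xElt m)) := by
    rw [h1]
    refine Submodule.sum_mem _ fun c hc => ?_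
    obtain ⟨w, -, rfl⟩ := Finset.mem_image.mp hc
    exact ⟨y w, (hy w).symm⟩
  obtain ⟨z, hz⟩ := h2
  exact ⟨z, hz.symm⟩

theorem heckeRev_heckeSum (D : Set (Equiv.Perm (Fin r))) :
    heckeRev r (heckeSum D) = MulOpposite.op (heckeSum D⁻¹) := by
  classical
  rw [heckeSum, heckeSum, map_sum, Finset.op_sum]
  simp only [heckeRev_T]
  refine Finset.sum_bij' (fun w _ => w⁻¹) (fun w _ => w⁻¹) ?_ ?_ ?_ ?_ ?_ <;> simp

theorem heckeRev_cosetSum (l m : Comp n r) (A : Matrix (Fin n) (Fin n) ℤ) :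
    heckeRev r (cosetSum m l A.transpose) = MulOpposite.op (cosetSum l m A) := by
  rw [cosetSum, heckeRev_heckeSum, cosetSum]
  congr 2
  ext w
  simp only [Set.mem_inv, Set.mem_ofPred_eq]
  rw [jmath_inv]
  exact Matrix.transpose_injective.eq_iff

theorem heckeRev_xElt (l : Comp n r) : heckeRev r (xElt l) = MulOpposite.op (xElt l) := by
  rw [xElt, heckeRev_heckeSum]
  congr 2
  ext w
  simp

theorem cosetSum_eq_right (l m : Comp n r) (A : Matrix (Fin n) (Fin n) ℤ) :
    ∃ z, cosetSum l m A = xElt l * z := by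
  obtain ⟨y, hy⟩ := cosetSum_eq_left m l A.transpose
  have h := congrArg (heckeRev r) hy
  rw [heckeRev_cosetSum, map_mul, heckeRev_xElt] at h
  exact ⟨(heckeRev r y).unop, MulOpposite.op_injective (by rw [h]; simp)⟩

theorem cosetSum_diag (l : Comp n r) : cosetSum l l (diag l.1) = xElt l := by
  rw [cosetSum, xElt]
  congr 1
  ext w
  exact jmath_self_eq_diag_iff

theorem cosetSum_eq_zero (l m : Comp n r) {A : Matrix (Fin n) (Fin n) ℤ} {i j : Fin n}
    (h : A i j < 0) : cosetSum l m A = 0 := by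
  classical
  rw [cosetSum, heckeSum]
  apply Finset.sum_eq_zero
  intro w hw
  simp only [Finset.mem_filter, Finset.mem_univ, true_and, Set.mem_ofPred_eq] at hw
  have := jmath_nonneg l m w i j
  rw [hw] at this
  omega

end CosetSums

/-! ### Multiplication of double coset sums -/

section RowWords

variable {n r : ℕ}

/-- The row `k` of a matrix, as a multiset of column indices. -/
def rowMS (A : Matrix (Fin n) (Fin n) ℤ) (k : Fin n) : Multiset (Fin n) :=
  ∑ j, Multiset.replicate (A k j).toNat j

theorem count_rowMS (A : Matrix (Fin n) (Fin n) ℤ) (k j : Fin n) :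
    (rowMS A k).count j = (A k j).toNat := by
  simp only [rowMS, Multiset.count_sum', Multiset.count_replicate]
  simp

theorem card_rowMS (A : Matrix (Fin n) (Fin n) ℤ) (k : Fin n) :
    (rowMS A k).card = ∑ j, (A k j).toNat := by
  simp [rowMS]

theorem count_take_drop {α : Type*} [DecidableEq α] (c : Fin r → α) (a b : ℕ) (j : α) :
    (((List.ofFn c).drop a).take b).count j =
      (Finset.univ.filter fun p : Fin r => (a ≤ p.val ∧ p.val < a + b) ∧ c p = j).card := by
  rw [List.ofFn_eq_map, ← List.map_drop, ← List.map_take, List.count, List.countP_map,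
    List.countP_eq_length_filter, ← List.toFinset_card_of_nodup]
  · congr 1
    ext p
    simp only [List.mem_toFinset, List.mem_filter, Function.comp, beq_iff_eq, Finset.mem_filter,
      Finset.mem_univ, true_and]
    refine and_congr_left fun _ => ?_
    rw [List.mem_iff_getElem]
    constructor
    · rintro ⟨i, hi, rfl⟩
      simp only [List.length_take, List.length_drop, List.length_finRange] at hi
      simp only [List.getElem_take, List.getElem_drop, List.getElem_finRange, Fin.val_cast]
      omega
    · rintro ⟨h1, h2⟩
      have := p.2
      refine ⟨p - a, ?_, ?_⟩
      · simp only [List.length_take, List.length_drop, List.length_finRange]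
        omega
      · apply Fin.ext
        simp only [List.getElem_take, List.getElem_drop, List.getElem_finRange, Fin.val_cast]
        omega
  · exact ((List.nodup_finRange r).sublist ((List.take_sublist _ _).trans
      (List.drop_sublist _ _))).filter _

theorem ofFn_word_mem_iff {l m : Comp n r} {A : Matrix (Fin n) (Fin n) ℤ}
    (hA : ∀ i j, 0 ≤ A i j) (hl : ∀ i, ∑ j, A i j = l.1 i) (w : Equiv.Perm (Fin r)) :
    List.ofFn (word m w) ∈ blockLists (List.ofFn (rowMS A)) ↔ jmath l w m = A := by
  have hcard : ∀ k, (rowMS A k).card = l.1 k := by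
    intro k
    rw [card_rowMS]
    zify
    rw [← hl]
    exact Finset.sum_congr rfl fun j _ => Int.toNat_of_nonneg (hA k j)
  have hmap : (List.ofFn (rowMS A)).map Multiset.card = List.ofFn l.1 := by
    rw [List.map_ofFn]
    congr 1
    funext k
    exact hcard k
  rw [mem_blockLists]
  have h1 : (List.ofFn (word m w)).length = ((List.ofFn (rowMS A)).map Multiset.card).sum := by
    rw [hmap, List.length_ofFn, List.sum_ofFn, l.2]
  have hstart : ∀ k, (((List.ofFn (rowMS A)).take k).map Multiset.card).sum = start l k := by
    intro k
    rw [List.map_take, hmap, List.sum_take_ofFn, start]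
  simp only [h1, true_and, List.length_ofFn, List.getElem_ofFn, hstart, hcard]
  have hcount : ∀ k j : Fin n, jmath l w m k j =
      ((((List.ofFn (word m w)).drop (start l k)).take (l.1 k)).count j : ℕ) := by
    intro k j
    rw [count_take_drop, jmath_apply]
    congr 2
    ext p
    simp only [Finset.mem_filter, Finset.mem_univ, true_and]
    rw [← mem_block_iff, mem_block, start_succ]
  constructor
  · intro h
    ext k j
    rw [hcount, ← Multiset.coe_count, h k k.2, count_rowMS]
    exact Int.toNat_of_nonneg (hA k j)
  · intro h k hk
    ext j
    have := hcount ⟨k, hk⟩ j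
    rw [Multiset.coe_count, count_rowMS, ← h, this, Int.toNat_natCast]

/-- A double coset sum, as a sum over words with prescribed letters in every block. -/
theorem cosetSum_eq_sum {l : Comp n r} (m : Comp n r) {A : Matrix (Fin n) (Fin n) ℤ}
    (hA : ∀ i j, 0 ≤ A i j) (hl : ∀ i, ∑ j, A i j = l.1 i) :
    cosetSum l m A = ∑ x ∈ blockLists (List.ofFn (rowMS A)), listSum m x := by
  classical
  simp only [listSum, Finset.sum_filter]
  rw [Finset.sum_comm, cosetSum, heckeSum, Finset.sum_filter]
  refine Finset.sum_congr rfl fun w _ => ?_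
  rw [Finset.sum_ite_eq]
  simp only [ofFn_word_mem_iff (m := m) hA hl, Set.mem_ofPred_eq]
  congr

theorem ofFn_eq_append {β : Type*} (f : Fin n → β) {h h' : Fin n} (hh' : (h' : ℕ) = h + 1) :
    List.ofFn f = (List.ofFn f).take h ++ f h :: f h' :: (List.ofFn f).drop (h + 2) := by
  have h1 : (List.ofFn f).drop h = f h :: f h' :: (List.ofFn f).drop (h + 2) := by
    have hh := h.2
    have hh2 := h'.2
    rw [List.drop_eq_getElem_cons (by rw [List.length_ofFn]; omega),
      List.drop_eq_getElem_cons (by rw [List.length_ofFn]; omega)]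
    simp only [List.getElem_ofFn, Fin.eta]
    congr 2
    exact congrArg f (Fin.ext hh'.symm)
  rw [← h1, List.take_append_drop]

theorem take_ofFn_congr {β : Type*} {f g : Fin n → β} {k : ℕ}
    (h : ∀ i : Fin n, i.val < k → f i = g i) :
    (List.ofFn f).take k = (List.ofFn g).take k := by
  apply List.ext_getElem
  · simp
  · intro i h1 h2
    simp only [List.getElem_take, List.getElem_ofFn]
    exact h _ (by simp only [List.length_take] at h1; simp only; omega)

theorem drop_ofFn_congr {β : Type*} {f g : Fin n → β} {k : ℕ}
    (h : ∀ i : Fin n, k ≤ i.val → f i = g i) :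
    (List.ofFn f).drop k = (List.ofFn g).drop k := by
  apply List.ext_getElem
  · simp
  · intro i h1 h2
    simp only [List.getElem_drop, List.getElem_ofFn]
    exact h _ (by simp)

/-- The matrix obtained from `A` when a letter `u` moves from the row `b` to the row `a`. -/
def move (A : Matrix (Fin n) (Fin n) ℤ) (a b u : Fin n) : Matrix (Fin n) (Fin n) ℤ :=
  A + Matrix.single a u 1 - Matrix.single b u 1

theorem move_apply (A : Matrix (Fin n) (Fin n) ℤ) (a b u i j : Fin n) : move A a b u i j =
    A i j + (if i = a ∧ j = u then 1 else 0) - (if i = b ∧ j = u then 1 else 0) := by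
  simp only [move, Matrix.sub_apply, Matrix.add_apply, Matrix.single_apply, eq_comm]

theorem sum_move_row (A : Matrix (Fin n) (Fin n) ℤ) (a b u i : Fin n) : ∑ j, move A a b u i j =
    ∑ j, A i j + (if i = a then 1 else 0) - (if i = b then 1 else 0) := by
  simp only [move_apply, Finset.sum_sub_distrib, Finset.sum_add_distrib, ite_and]
  congr 2 <;> split_ifs <;> simp

theorem sum_move_col (A : Matrix (Fin n) (Fin n) ℤ) (a b u j : Fin n) :
    ∑ i, move A a b u i j = ∑ i, A i j := by
  simp only [move_apply, Finset.sum_sub_distrib, Finset.sum_add_distrib]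
  have : ∀ a : Fin n, ∑ i, (if i = a ∧ j = u then (1 : ℤ) else 0) = if j = u then 1 else 0 := by
    intro a
    simp only [and_comm (b := j = u), ite_and]
    split_ifs <;> simp
  rw [this, this]
  ring

theorem rowMS_move_of_ne (A : Matrix (Fin n) (Fin n) ℤ) {a b u i : Fin n} (ha : i ≠ a)
    (hb : i ≠ b) : rowMS (move A a b u) i = rowMS A i := by
  ext j
  simp [count_rowMS, move_apply, ha, hb]

theorem rowMS_move_left {A : Matrix (Fin n) (Fin n) ℤ} (hA : ∀ i j, 0 ≤ A i j) {a b : Fin n}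
    (u : Fin n) (hab : a ≠ b) : rowMS (move A a b u) a = u ::ₘ rowMS A a := by
  ext j
  have := hA a j
  rw [Multiset.count_cons, count_rowMS, count_rowMS, move_apply]
  simp only [hab, false_and, if_false, true_and]
  split_ifs <;> omega

theorem rowMS_move_right {A : Matrix (Fin n) (Fin n) ℤ} {a b u : Fin n} (hab : a ≠ b) :
    rowMS (move A a b u) b = (rowMS A b).erase u := by
  ext j
  rw [count_rowMS, move_apply]
  by_cases hj : j = u
  · subst hj
    rw [Multiset.count_erase_self, count_rowMS]
    simp only [hab.symm, false_and, if_false, true_and, if_true]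
    omega
  · rw [Multiset.count_erase_of_ne hj, count_rowMS]
    simp [hj]

/-- The property, of an element of the Hecke algebra, to move letters from the row `b` to the
row `a` in all double coset sums: left multiplication by `Y` takes one letter `u` out of the row
`b`, in all possible ways, and inserts it into the row `a`. -/
def MovesLetters (κ : Fin n → ℤ) (a b : Fin n) (l l' : Comp n r) (Y : Hecke r) : Prop :=
  ∀ (m : Comp n r) (A : Matrix (Fin n) (Fin n) ℤ), (∀ i j, 0 ≤ A i j) →
    (∀ i, ∑ j, A i j = l.1 i) → Y * cosetSum l m A =
      ∑ u, insertCoef κ u (rowMS A a) • cosetSum l' m (move A a b u)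

theorem mem_rowMS {A : Matrix (Fin n) (Fin n) ℤ} {k u : Fin n} : u ∈ rowMS A k ↔ 0 < A k u := by
  rw [← Multiset.count_pos, count_rowMS]
  omega

theorem sum_move_eq {l' : Comp n r} (κ : Fin n → ℤ) {a b : Fin n} (hab : a ≠ b) (m : Comp n r)
    {A : Matrix (Fin n) (Fin n) ℤ} (hA : ∀ i j, 0 ≤ A i j)
    (hl' : ∀ i, (∑ j, A i j) + (if i = a then 1 else 0) - (if i = b then 1 else 0) = (l'.1 i : ℤ)) :
    ∑ u, insertCoef κ u (rowMS A a) • cosetSum l' m (move A a b u) =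
      ∑ u with u ∈ rowMS A b, insertCoef κ u (rowMS A a) •
        ∑ x ∈ blockLists (List.ofFn (rowMS (move A a b u))), listSum m x := by
  rw [Finset.sum_filter]
  refine Finset.sum_congr rfl fun u _ => ?_
  split_ifs with hu
  · rw [cosetSum_eq_sum m _ fun i => (sum_move_row A a b u i).trans (hl' i)]
    intro i j
    have h1 := mem_rowMS.mp hu
    have h2 := hA i j
    rw [move_apply]
    split_ifs with h3 h4 h4
    · omega
    · omega
    · rw [h4.1, h4.2]; omega
    · omega
  · rw [cosetSum_eq_zero (i := b) (j := u), smul_zero]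
    rw [mem_rowMS] at hu
    rw [move_apply]
    simp only [hab.symm, false_and, if_false, and_self, if_true]
    omega

theorem card_rowMS_eq {l : Comp n r} {A : Matrix (Fin n) (Fin n) ℤ} (hA : ∀ i j, 0 ≤ A i j)
    (hl : ∀ i, ∑ j, A i j = l.1 i) (k : Fin n) : (rowMS A k).card = l.1 k := by
  rw [card_rowMS]
  zify
  rw [← hl]
  exact Finset.sum_congr rfl fun j _ => Int.toNat_of_nonneg (hA k j)

theorem valKey_injective : Function.Injective fun a : Fin n => ((a : ℕ) : ℤ) :=
  fun _ _ h => Fin.ext (Nat.cast_injective h)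

/-- Raising: the letters of the block `h'` that stand first are inserted into the block `h`. -/
theorem exists_movesLetters_up {h h' : Fin n} (hh' : (h' : ℕ) = h + 1) {l l' : Comp n r}
    (hl' : ∀ i, (l'.1 i : ℤ) = l.1 i + (if i = h then 1 else 0) - (if i = h' then 1 else 0)) :
    ∃ Y, MovesLetters (fun a : Fin n => ((a : ℕ) : ℤ)) h h' l l' Y := by
  have hne : h ≠ h' := by rintro rfl; omega
  refine ⟨insertOp (fun i => genNat r (start l h + i)) (l.1 h), fun m A hA hl => ?_⟩
  have hcard := card_rowMS_eq hA hl
  have hmap : (List.ofFn (rowMS A)).map Multiset.card = List.ofFn l.1 := by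
    rw [List.map_ofFn]; congr 1; funext k; exact hcard k
  rw [sum_move_eq _ hne m hA fun i => by rw [hl, hl' i], cosetSum_eq_sum m hA hl]
  have hs' : rowMS A h' ≠ 0 := by
    intro h0
    have h1 := hcard h'
    have h2 := hl' h'
    rw [h0, Multiset.card_zero] at h1
    rw [← h1] at h2
    simp only [hne.symm, if_false, if_true] at h2
    omega
  have key := insertOp_mul_blockLists (κ := fun a : Fin n => ((a : ℕ) : ℤ))
    valKey_injective (isWordRep_listSum m)
    ((List.ofFn (rowMS A)).take h) ((List.ofFn (rowMS A)).drop (h + 2)) (rowMS A h) (rowMS A h') hs'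
    (by rw [← ofFn_eq_append _ hh', hmap, List.sum_ofFn, l.2])
  rw [← ofFn_eq_append _ hh', List.map_take, hmap, List.sum_take_ofFn, ← start, hcard] at key
  rw [key]
  refine Finset.sum_congr rfl fun u _ => ?_
  rw [ofFn_eq_append (rowMS (move A h h' u)) hh', rowMS_move_left hA u hne, rowMS_move_right hne,
    take_ofFn_congr (f := rowMS (move A h h' u)) (g := rowMS A),
    drop_ofFn_congr (f := rowMS (move A h h' u)) (g := rowMS A)]
  · exact fun i hi => rowMS_move_of_ne A (by rintro rfl; omega) (by rintro rfl; omega)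
  · exact fun i hi => rowMS_move_of_ne A (by rintro rfl; omega) (by rintro rfl; omega)

/-- Lowering: the letters of the block `h` that stand last are inserted into the block `h'`. The
words are read backwards, which accounts for the sign of the key. -/
theorem exists_movesLetters_down {h h' : Fin n} (hh' : (h' : ℕ) = h + 1) {l l' : Comp n r}
    (hl' : ∀ i, (l'.1 i : ℤ) = l.1 i + (if i = h' then 1 else 0) - (if i = h then 1 else 0)) :
    ∃ Y, MovesLetters (fun a : Fin n => -((a : ℕ) : ℤ)) h' h l l' Y := by
  have hne : h ≠ h' := by rintro rfl; omega
  refine ⟨insertOp (fun i => genNat r (r - 2 - (((List.ofFn l.1).drop (h + 2)).sum + i))) (l.1 h'),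
    fun m A hA hl => ?_⟩
  have hcard := card_rowMS_eq hA hl
  have hmap : (List.ofFn (rowMS A)).map Multiset.card = List.ofFn l.1 := by
    rw [List.map_ofFn]; congr 1; funext k; exact hcard k
  rw [sum_move_eq _ hne.symm m hA fun i => by rw [hl, hl' i], cosetSum_eq_sum m hA hl]
  have hs : rowMS A h ≠ 0 := by
    intro h0
    have h1 := hcard h
    have h2 := hl' h
    rw [h0, Multiset.card_zero] at h1
    rw [← h1] at h2
    simp only [hne, if_false, if_true] at h2
    omega
  have key := insertOp_mul_blockLists' (κ := fun a : Fin n => ((a : ℕ) : ℤ))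
    valKey_injective (isWordRep_listSum m)
    ((List.ofFn (rowMS A)).take h) ((List.ofFn (rowMS A)).drop (h + 2)) (rowMS A h) (rowMS A h') hs
    (by rw [← ofFn_eq_append _ hh', hmap, List.sum_ofFn, l.2])
  rw [← ofFn_eq_append _ hh', List.map_drop, hmap, hcard] at key
  rw [key]
  refine Finset.sum_congr rfl fun u _ => ?_
  rw [ofFn_eq_append (rowMS (move A h' h u)) hh', rowMS_move_left hA u hne.symm,
    rowMS_move_right hne.symm,
    take_ofFn_congr (f := rowMS (move A h' h u)) (g := rowMS A),
    drop_ofFn_congr (f := rowMS (move A h' h u)) (g := rowMS A)]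
  · exact fun i hi => rowMS_move_of_ne A (by rintro rfl; omega) (by rintro rfl; omega)
  · exact fun i hi => rowMS_move_of_ne A (by rintro rfl; omega) (by rintro rfl; omega)

end RowWords

/-! ### The basis of the q-Schur algebra -/

section Schur

variable {n r : ℕ}

theorem end_ext {f g : QSchurAlg n r} (h : ∀ (ν : Comp n r) (x : Hecke r) (κ : Comp n r),
    ((f (DirectSum.of (fun l : Comp n r => xIdeal l) ν ⟨xElt ν * x, xElt_mul_mem ν x⟩) κ :
      xIdeal κ) : Hecke r) =
    ((g (DirectSum.of (fun l : Comp n r => xIdeal l) ν ⟨xElt ν * x, xElt_mul_mem ν x⟩) κ :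
      xIdeal κ) : Hecke r)) : f = g := by
  apply DirectSum.linearMap_ext
  intro ν
  ext ⟨y, hy⟩ κ
  obtain ⟨x, rfl⟩ := Submodule.mem_span_singleton.mp hy
  exact h ν x.unop κ

theorem cosetSum_mul_mem (l m : Comp n r) (A : Matrix (Fin n) (Fin n) ℤ) (x : Hecke r) :
    cosetSum l m A * x ∈ xIdeal l := by
  obtain ⟨z, hz⟩ := cosetSum_eq_right l m A
  rw [hz, mul_assoc]
  exact xElt_mul_mem l _

theorem exists_left_mul (l m : Comp n r) (A : Matrix (Fin n) (Fin n) ℤ) :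
    ∃ g : xIdeal m →ₗ[(Hecke r)ᵐᵒᵖ] xIdeal l, ∀ x,
      g ⟨xElt m * x, xElt_mul_mem m x⟩ = ⟨cosetSum l m A * x, cosetSum_mul_mem l m A x⟩ := by
  obtain ⟨y, hy⟩ := cosetSum_eq_left l m A
  have hmem : ∀ z : xIdeal m, y * (z : Hecke r) ∈ xIdeal l := by
    rintro ⟨z, hz⟩
    obtain ⟨x, rfl⟩ := Submodule.mem_span_singleton.mp hz
    have : y * (x • xElt m) = cosetSum l m A * x.unop := by
      rw [hy, mul_assoc]; rfl
    simp only [this]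
    exact cosetSum_mul_mem l m A _
  refine ⟨{ toFun := fun z => ⟨y * z, hmem z⟩, map_add' := ?_, map_smul' := ?_ }, ?_⟩
  · intro z w; ext; simp [mul_add]
  · intro a z
    ext
    exact (mul_assoc y z.1 a.unop).symm
  · intro x
    ext
    simp [hy, mul_assoc]

/-- The endomorphism that sends `x_m` to a double coset sum. -/
def schurMap (l m : Comp n r) (A : Matrix (Fin n) (Fin n) ℤ) : QSchurAlg n r :=
  (DirectSum.lof (Hecke r)ᵐᵒᵖ (Comp n r) (fun l : Comp n r => xIdeal l) l).comp
    ((exists_left_mul l m A).choose.comp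
      (DirectSum.component (Hecke r)ᵐᵒᵖ (Comp n r) (fun l : Comp n r => xIdeal l) m))

theorem schurMap_of_same (l m : Comp n r) (A : Matrix (Fin n) (Fin n) ℤ) (x : Hecke r) :
    schurMap l m A (DirectSum.of (fun l : Comp n r => xIdeal l) m
      ⟨xElt m * x, xElt_mul_mem m x⟩) =
    DirectSum.of (fun l : Comp n r => xIdeal l) l
      ⟨cosetSum l m A * x, cosetSum_mul_mem l m A x⟩ := by
  rw [← (exists_left_mul l m A).choose_spec x]
  simp only [schurMap, LinearMap.comp_apply, DirectSum.component.of,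
    ← DirectSum.lof_eq_of (Hecke r)ᵐᵒᵖ]
  simp

theorem schurMap_of_ne (l : Comp n r) {m ν : Comp n r} (h : ν ≠ m)
    (A : Matrix (Fin n) (Fin n) ℤ) (x : xIdeal ν) :
    schurMap l m A (DirectSum.of (fun l : Comp n r => xIdeal l) ν x) = 0 := by
  have : DirectSum.component (Hecke r)ᵐᵒᵖ (Comp n r) (fun l : Comp n r => xIdeal l) m
      (DirectSum.of (fun l : Comp n r => xIdeal l) ν x) = 0 :=
    DirectSum.of_eq_of_ne _ _ _ h.symm
  simp only [schurMap, LinearMap.comp_apply, this, map_zero]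

theorem schurMap_apply (l m : Comp n r) (A : Matrix (Fin n) (Fin n) ℤ) (ν : Comp n r)
    (x : Hecke r) (κ : Comp n r) :
    ((schurMap l m A (DirectSum.of (fun l : Comp n r => xIdeal l) ν
      ⟨xElt ν * x, xElt_mul_mem ν x⟩) κ : xIdeal κ) : Hecke r) =
      if ν = m ∧ κ = l then cosetSum l m A * x else 0 := by
  by_cases h : ν = m
  · subst h
    rw [schurMap_of_same]
    by_cases hκ : κ = l
    · subst hκ
      simp [DirectSum.of_eq_same]
    · rw [DirectSum.of_eq_of_ne _ _ _ hκ]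
      simp [hκ]
  · rw [schurMap_of_ne l h]
    simp [h]

theorem isPhi_schurMap (l m : Comp n r) (d : Equiv.Perm (Fin r)) :
    IsPhi l d m (schurMap l m (jmath l d m)) := by
  intro ν x κ
  rw [schurMap_apply, dcoset_eq]
  rfl

theorem phi_eq (l m : Comp n r) (d : Equiv.Perm (Fin r)) :
    phi l d m = schurMap l m (jmath l d m) := by
  have h : ∃ f, IsPhi l d m f := ⟨_, isPhi_schurMap l m d⟩
  rw [phi, dif_pos h]
  exact h.choose_spec.unique (isPhi_schurMap l m d)

theorem schurMap_eq_zero (l m : Comp n r) {A : Matrix (Fin n) (Fin n) ℤ} {i j : Fin n}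
    (h : A i j < 0) : schurMap l m A = 0 := by
  apply end_ext
  intro ν x κ
  rw [schurMap_apply, cosetSum_eq_zero l m h]
  simp

theorem basisElt_eq_zero_of_neg (r : ℕ) {A : Matrix (Fin n) (Fin n) ℤ} {i j : Fin n}
    (h : A i j < 0) : basisElt r A = 0 := by
  rw [basisElt, dif_neg]
  rintro ⟨p, -, rfl⟩
  exact absurd h (not_lt.mpr (jmath_nonneg _ _ _ _ _))

theorem exists_isDistinguished (l m : Comp n r) (w : Equiv.Perm (Fin r)) :
    ∃ d, IsDistinguished l d m ∧ jmath l d m = jmath l w m := by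
  classical
  obtain ⟨d, hd, hmin⟩ := Finset.exists_min_image
    (Finset.univ.filter fun w' => jmath l w' m = jmath l w m) (len r) ⟨w, by simp⟩
  simp only [Finset.mem_filter, Finset.mem_univ, true_and] at hd hmin
  refine ⟨d, fun w' hw' => hmin w' ?_, hd⟩
  rw [dcoset_eq] at hw'
  exact hw'.trans hd

/-- The formula for the basis elements in terms of the row and column sums of the matrix. For a
matrix with a negative entry both sides are zero. -/
theorem basisElt_eq {l m : Comp n r} {A : Matrix (Fin n) (Fin n) ℤ}
    (hl : ∀ i, ∑ j, A i j = l.1 i) (hm : ∀ j, ∑ i, A i j = m.1 j) :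
    basisElt r A = v ^ (-dStat A) • schurMap l m A := by
  by_cases hA : ∀ i j, 0 ≤ A i j
  · obtain ⟨w, hw⟩ := exists_jmath_eq hA hl hm
    obtain ⟨d, hd, hdw⟩ := exists_isDistinguished l m w
    have hex : ∃ p : Comp n r × Equiv.Perm (Fin r) × Comp n r,
        IsDistinguished p.1 p.2.1 p.2.2 ∧ jmath p.1 p.2.1 p.2.2 = A :=
      ⟨(l, d, m), hd, hdw.trans hw⟩
    rw [basisElt, dif_pos hex]
    obtain ⟨-, h2⟩ := hex.choose_spec
    have e1 : hex.choose.1 = l := by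
      ext i
      zify
      rw [← hl, ← sum_jmath_row _ hex.choose.2.2 hex.choose.2.1, h2]
    have e2 : hex.choose.2.2 = m := by
      ext j
      zify
      rw [← hm, ← sum_jmath_col hex.choose.1 _ hex.choose.2.1, h2]
    rw [phi_eq, h2, e1, e2]
  · push Not at hA
    obtain ⟨i, j, hij⟩ := hA
    rw [basisElt_eq_zero_of_neg r hij, schurMap_eq_zero l m hij, smul_zero]

theorem exists_comp {c : Fin n → ℤ} (hc : ∀ i, 0 ≤ c i) (hsum : ∑ i, c i = r) :
    ∃ l : Comp n r, ∀ i, c i = l.1 i := by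
  refine ⟨⟨fun i => (c i).toNat, ?_⟩, fun i => (Int.toNat_of_nonneg (hc i)).symm⟩
  zify
  rw [← hsum]
  exact Finset.sum_congr rfl fun i _ => Int.toNat_of_nonneg (hc i)

theorem basisElt_eq_zero_of_sum {A : Matrix (Fin n) (Fin n) ℤ} (h : ∑ i, ∑ j, A i j ≠ r) :
    basisElt r A = 0 := by
  rw [basisElt, dif_neg]
  rintro ⟨p, -, rfl⟩
  apply h
  simp only [sum_jmath_row]
  exact_mod_cast p.1.2

theorem schurMap_mul_of_ne (k l' l m : Comp n r) (B A : Matrix (Fin n) (Fin n) ℤ) (h : l' ≠ l) :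
    schurMap k l' B * schurMap l m A = 0 := by
  apply end_ext
  intro ν x κ
  rw [Module.End.mul_apply]
  by_cases hν : ν = m
  · subst hν
    rw [schurMap_of_same, schurMap_of_ne k h.symm]
    rfl
  · rw [schurMap_of_ne l hν, map_zero]
    rfl

/-- Products in the `q`-Schur algebra are computed in the Hecke algebra: a relation between double
coset sums for the left multiplication by `Y` gives the product with the endomorphism that
`Y * x_l` defines. -/
theorem schurMap_mul {k l m : Comp n r} {B A : Matrix (Fin n) (Fin n) ℤ} {Y : Hecke r}
    {ι : Type*} {s : Finset ι} {a : ι → K} {A' : ι → Matrix (Fin n) (Fin n) ℤ}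
    (hB : Y * xElt l = cosetSum k l B)
    (hA : Y * cosetSum l m A = ∑ u ∈ s, a u • cosetSum k m (A' u)) :
    schurMap k l B * schurMap l m A = ∑ u ∈ s, a u • schurMap k m (A' u) := by
  apply end_ext
  intro ν x κ
  have hsum : ∀ z : TensorMod n r,
      (((∑ u ∈ s, a u • schurMap k m (A' u)) z κ : xIdeal κ) : Hecke r) =
      ∑ u ∈ s, a u • ((schurMap k m (A' u) z κ : xIdeal κ) : Hecke r) := by
    intro z
    rw [LinearMap.sum_apply]
    simp only [LinearMap.smul_apply]
    rw [DirectSum.sum_apply]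
    simp
    rfl
  rw [hsum, Module.End.mul_apply]
  simp only [schurMap_apply]
  by_cases hν : ν = m
  · subst hν
    obtain ⟨z, hz⟩ := cosetSum_eq_right l ν A
    have h1 : (⟨cosetSum l ν A * x, cosetSum_mul_mem l ν A x⟩ : xIdeal l) =
        ⟨xElt l * (z * x), xElt_mul_mem l _⟩ := by
      ext; simp only [hz, mul_assoc]
    rw [schurMap_of_same, h1, schurMap_apply]
    by_cases hκ : κ = k
    · subst hκ
      simp only [and_self, if_true]
      rw [← hB, mul_assoc, ← mul_assoc (xElt l), ← hz, ← mul_assoc, hA, Finset.sum_mul]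
      simp only [smul_mul_assoc]
    · simp [hκ]
  · rw [schurMap_of_ne l hν, map_zero]
    simp [hν]

end Schur

/-! ### Multiplication by a basis element with one off-diagonal entry `1` -/

section Step

variable {n : ℕ}

/-- The bilinear form of which `dStat` is the quadratic form. -/
def dForm (A B : Matrix (Fin n) (Fin n) ℤ) : ℤ :=
  ∑ i, ∑ j, ∑ k, ∑ l, if k ≤ i ∧ j < l then A i j * B k l else 0

theorem dStat_eq (A : Matrix (Fin n) (Fin n) ℤ) : dStat A = dForm A A := rfl

theorem dForm_add_left (A A' B : Matrix (Fin n) (Fin n) ℤ) :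
    dForm (A + A') B = dForm A B + dForm A' B := by
  simp only [dForm, ← Finset.sum_add_distrib]
  refine Finset.sum_congr rfl fun i _ => Finset.sum_congr rfl fun j _ =>
    Finset.sum_congr rfl fun k _ => Finset.sum_congr rfl fun l _ => ?_
  split_ifs
  · rw [Matrix.add_apply, add_mul]
  · simp

theorem dForm_add_right (A B B' : Matrix (Fin n) (Fin n) ℤ) :
    dForm A (B + B') = dForm A B + dForm A B' := by
  simp only [dForm, ← Finset.sum_add_distrib]
  refine Finset.sum_congr rfl fun i _ => Finset.sum_congr rfl fun j _ =>
    Finset.sum_congr rfl fun k _ => Finset.sum_congr rfl fun l _ => ?_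
  split_ifs
  · rw [Matrix.add_apply, mul_add]
  · simp

theorem dForm_single_right (A : Matrix (Fin n) (Fin n) ℤ) (a u : Fin n) (c : ℤ) :
    dForm A (Matrix.single a u c) = c * ∑ i, ∑ j, if a ≤ i ∧ j < u then A i j else 0 := by
  simp only [dForm, Finset.mul_sum]
  refine Finset.sum_congr rfl fun i _ => Finset.sum_congr rfl fun j _ => ?_
  rw [Finset.sum_eq_single a, Finset.sum_eq_single u]
  · simp only [Matrix.single_apply_same]; split_ifs <;> ring
  · intro l _ hl; simp [hl.symm]
  · simp
  · intro k _ hk; simp [hk.symm]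
  · simp

theorem dForm_single_left (B : Matrix (Fin n) (Fin n) ℤ) (a u : Fin n) (c : ℤ) :
    dForm (Matrix.single a u c) B = c * ∑ k, ∑ l, if k ≤ a ∧ u < l then B k l else 0 := by
  simp only [dForm]
  rw [Finset.sum_eq_single a, Finset.sum_eq_single u]
  · simp only [Matrix.single_apply_same, Finset.mul_sum]
    refine Finset.sum_congr rfl fun i _ => Finset.sum_congr rfl fun j _ => ?_
    split_ifs <;> ring
  · intro j _ hj; simp [hj.symm]
  · simp
  · intro i _ hi; simp [hi.symm]
  · simp

theorem dForm_single_single (a b u : Fin n) (c d : ℤ) :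
    dForm (Matrix.single a u c) (Matrix.single b u d) = 0 := by
  rw [dForm_single_left, Finset.sum_eq_zero, mul_zero]
  intro k _
  refine Finset.sum_eq_zero fun l _ => ?_
  split_ifs with h
  · rw [Matrix.single_apply, if_neg]
    rintro ⟨-, rfl⟩
    exact lt_irrefl _ h.2
  · rfl

theorem dStat_move (A : Matrix (Fin n) (Fin n) ℤ) (a b u : Fin n) :
    dStat (move A a b u) = dStat A +
      (∑ i, ∑ j, if a ≤ i ∧ j < u then A i j else 0) -
      (∑ i, ∑ j, if b ≤ i ∧ j < u then A i j else 0) +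
      (∑ k, ∑ l, if k ≤ a ∧ u < l then A k l else 0) -
      (∑ k, ∑ l, if k ≤ b ∧ u < l then A k l else 0) := by
  have h : move A a b u = A + Matrix.single a u 1 + Matrix.single b u (-1) := by
    rw [move, sub_eq_add_neg, ← Matrix.single_neg]
  rw [dStat_eq, dStat_eq, h]
  simp only [dForm_add_left, dForm_add_right, dForm_single_single]
  simp only [dForm_single_left, dForm_single_right]
  ring

theorem sum_ite_row_sub {h h' : Fin n} (hh' : (h' : ℕ) = h + 1) (P : Fin n → Prop)
    [DecidablePred P] (A : Matrix (Fin n) (Fin n) ℤ) :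
    (∑ i, ∑ j, if h ≤ i ∧ P j then A i j else 0) - (∑ i, ∑ j, if h' ≤ i ∧ P j then A i j else 0) =
      ∑ j with P j, A h j := by
  rw [← Finset.sum_sub_distrib, Finset.sum_eq_single h, ← Finset.sum_sub_distrib, Finset.sum_filter]
  · refine Finset.sum_congr rfl fun j _ => ?_
    have : ¬ h' ≤ h := by rw [Fin.le_def]; omega
    simp [this]
  · intro i _ hi
    rw [← Finset.sum_sub_distrib]
    refine Finset.sum_eq_zero fun j _ => ?_
    have : h ≤ i ↔ h' ≤ i := by
      rw [Fin.le_def, Fin.le_def]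
      have : (i : ℕ) ≠ h := fun e => hi (Fin.ext e)
      omega
    simp [this]
  · simp

theorem sum_ite_row_sub' {h h' : Fin n} (hh' : (h' : ℕ) = h + 1) (P : Fin n → Prop)
    [DecidablePred P] (A : Matrix (Fin n) (Fin n) ℤ) :
    (∑ i, ∑ j, if i ≤ h' ∧ P j then A i j else 0) - (∑ i, ∑ j, if i ≤ h ∧ P j then A i j else 0) =
      ∑ j with P j, A h' j := by
  rw [← Finset.sum_sub_distrib, Finset.sum_eq_single h', ← Finset.sum_sub_distrib,
    Finset.sum_filter]
  · refine Finset.sum_congr rfl fun j _ => ?_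
    have : ¬ h' ≤ h := by rw [Fin.le_def]; omega
    simp [this]
  · intro i _ hi
    rw [← Finset.sum_sub_distrib]
    refine Finset.sum_eq_zero fun j _ => ?_
    have : i ≤ h' ↔ i ≤ h := by
      rw [Fin.le_def, Fin.le_def]
      have : (i : ℕ) ≠ h' := fun e => hi (Fin.ext e)
      omega
    simp [this]
  · simp

theorem dStat_move_up {h h' : Fin n} (hh' : (h' : ℕ) = h + 1) (A : Matrix (Fin n) (Fin n) ℤ)
    (u : Fin n) : dStat (move A h h' u) =
      dStat A + ∑ j with j < u, A h j - ∑ j with u < j, A h' j := by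
  rw [dStat_move, ← sum_ite_row_sub hh', ← sum_ite_row_sub' hh']
  ring

theorem dStat_move_down {h h' : Fin n} (hh' : (h' : ℕ) = h + 1) (A : Matrix (Fin n) (Fin n) ℤ)
    (u : Fin n) : dStat (move A h' h u) =
      dStat A + ∑ j with u < j, A h' j - ∑ j with j < u, A h j := by
  rw [dStat_move, ← sum_ite_row_sub hh', ← sum_ite_row_sub' hh']
  ring

theorem dForm_diag_diag (γ : Fin n → ℕ) : dForm (diag γ) (diag γ) = 0 := by
  refine Finset.sum_eq_zero fun i _ => Finset.sum_eq_zero fun j _ => Finset.sum_eq_zero fun k _ =>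
    Finset.sum_eq_zero fun l _ => ?_
  split_ifs with h
  · by_cases hij : i = j
    · have : k ≠ l := by rintro rfl; subst hij; exact absurd h.2 (not_lt.mpr h.1)
      simp [diag, Matrix.diagonal_apply_ne _ this]
    · simp [diag, Matrix.diagonal_apply_ne _ hij]
  · rfl

theorem dStat_diag (γ : Fin n → ℕ) : dStat (diag γ) = 0 := dForm_diag_diag γ

theorem dStat_diag_add_single_up {h h' : Fin n} (hh' : (h' : ℕ) = h + 1) (γ : Fin n → ℕ) :
    dStat (diag γ + Matrix.single h h' 1) = γ h := by
  rw [dStat_eq]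
  simp only [dForm_add_left, dForm_add_right, dForm_single_single, dForm_diag_diag]
  simp only [dForm_single_left, dForm_single_right, one_mul]
  have h1 : ∑ k, ∑ l, (if k ≤ h ∧ h' < l then diag γ k l else 0) = 0 := by
    refine Finset.sum_eq_zero fun k _ => Finset.sum_eq_zero fun l _ => ?_
    split_ifs with hkl
    · rw [diag, Matrix.diagonal_apply_ne]
      rintro rfl
      rw [Fin.le_def, Fin.lt_def] at hkl
      omega
    · rfl
  have h2 : ∑ i, ∑ j, (if h ≤ i ∧ j < h' then diag γ i j else 0) = γ h := by
    rw [Finset.sum_eq_single h, Finset.sum_eq_single h]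
    · rw [if_pos ⟨le_rfl, by rw [Fin.lt_def]; omega⟩, diag, Matrix.diagonal_apply_eq]
    · intro j _ hj
      simp [diag, Matrix.diagonal_apply_ne _ hj.symm]
    · simp
    · intro i _ hi
      refine Finset.sum_eq_zero fun j _ => ?_
      split_ifs with hij
      · rw [diag, Matrix.diagonal_apply_ne]
        rintro rfl
        rw [Fin.le_def, Fin.lt_def] at hij
        exact hi (Fin.ext (by omega))
      · rfl
    · simp
  rw [h1, h2]; ring

theorem dStat_diag_add_single_down {h h' : Fin n} (hh' : (h' : ℕ) = h + 1) (γ : Fin n → ℕ) :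
    dStat (diag γ + Matrix.single h' h 1) = γ h' := by
  rw [dStat_eq]
  simp only [dForm_add_left, dForm_add_right, dForm_single_single, dForm_diag_diag]
  simp only [dForm_single_left, dForm_single_right, one_mul]
  have h1 : ∑ k, ∑ l, (if h' ≤ k ∧ l < h then diag γ k l else 0) = 0 := by
    refine Finset.sum_eq_zero fun k _ => Finset.sum_eq_zero fun l _ => ?_
    split_ifs with hkl
    · rw [diag, Matrix.diagonal_apply_ne]
      rintro rfl
      rw [Fin.le_def, Fin.lt_def] at hkl
      omega
    · rfl
  have h2 : ∑ i, ∑ j, (if i ≤ h' ∧ h < j then diag γ i j else 0) = γ h' := by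
    rw [Finset.sum_eq_single h', Finset.sum_eq_single h']
    · rw [if_pos ⟨le_rfl, by rw [Fin.lt_def]; omega⟩, diag, Matrix.diagonal_apply_eq]
    · intro j _ hj
      simp [diag, Matrix.diagonal_apply_ne _ hj.symm]
    · simp
    · intro i _ hi
      refine Finset.sum_eq_zero fun j _ => ?_
      split_ifs with hij
      · rw [diag, Matrix.diagonal_apply_ne]
        rintro rfl
        rw [Fin.le_def, Fin.lt_def] at hij
        exact hi (Fin.ext (by omega))
      · rfl
    · simp
  rw [h1, h2]; ring

/-- The properties of the normalized basis of the `q`-Schur algebra from which the multiplication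
formulas follow. Multiplication from the left by the element of a matrix with `1` in the place
`(a, b)` and otherwise zero off the diagonal moves one unit from the row `b` to the row `a`. -/
structure IsMulBasis {S : Type*} [Semiring S] [Algebra K S] (r : ℕ) (κ : Fin n → ℤ) (a b : Fin n)
    (e : Matrix (Fin n) (Fin n) ℤ → S) : Prop where
  neg : ∀ A i j, A i j < 0 → e A = 0
  orth : ∀ A B i, ∑ k, B k i ≠ ∑ j, A i j → e B * e A = 0
  one : ∀ (γ : Fin n → ℕ) (A : Matrix (Fin n) (Fin n) ℤ), (∀ i, ∑ j, A i j = (γ i : ℤ)) →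
    ∑ i, ∑ j, A i j = (r : ℤ) →
    e (diag γ) * e A = e A
  step : ∀ (γ : Fin n → ℕ) (A : Matrix (Fin n) (Fin n) ℤ), (∀ i j, 0 ≤ A i j) →
    (∀ i, ∑ j, A i j = (γ i : ℤ) + if i = b then 1 else 0) → ∑ i, ∑ j, A i j = (r : ℤ) →
    e (diag γ + Matrix.single a b 1) * e A =
      ∑ u, (v ^ (∑ i with κ u < κ i, (A a i - A b i)) * qInt (A a u + 1)) • e (move A a b u)

theorem basisElt_orth (r : ℕ) (A B : Matrix (Fin n) (Fin n) ℤ) (i : Fin n)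
    (h : ∑ k, B k i ≠ ∑ j, A i j) : basisElt r B * basisElt r A = 0 := by
  by_cases hA : ∀ i j, 0 ≤ A i j
  swap
  · push Not at hA
    obtain ⟨i, j, hij⟩ := hA
    rw [basisElt_eq_zero_of_neg r hij, mul_zero]
  by_cases hB : ∀ i j, 0 ≤ B i j
  swap
  · push Not at hB
    obtain ⟨i, j, hij⟩ := hB
    rw [basisElt_eq_zero_of_neg r hij, zero_mul]
  by_cases hAs : ∑ i, ∑ j, A i j = r
  swap
  · rw [basisElt_eq_zero_of_sum hAs, mul_zero]
  by_cases hBs : ∑ i, ∑ j, B i j = r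
  swap
  · rw [basisElt_eq_zero_of_sum hBs, zero_mul]
  obtain ⟨l, hl⟩ := exists_comp (fun i => Finset.sum_nonneg fun j _ => hA i j) hAs
  obtain ⟨m, hm⟩ := exists_comp (fun j => Finset.sum_nonneg fun i _ => hA i j)
    (by rw [Finset.sum_comm]; exact hAs)
  obtain ⟨k, hk⟩ := exists_comp (fun i => Finset.sum_nonneg fun j _ => hB i j) hBs
  obtain ⟨l', hl'⟩ := exists_comp (fun j => Finset.sum_nonneg fun i _ => hB i j)
    (by rw [Finset.sum_comm]; exact hBs)
  rw [basisElt_eq hl hm, basisElt_eq hk hl', smul_mul_smul_comm, schurMap_mul_of_ne, smul_zero]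
  rintro rfl
  exact h ((hl' i).trans (hl i).symm)

theorem sum_diag_row (γ : Fin n → ℕ) (i : Fin n) : ∑ j, diag γ i j = γ i := by
  simp [diag, Matrix.diagonal_apply]

theorem sum_diag_col (γ : Fin n → ℕ) (j : Fin n) : ∑ i, diag γ i j = γ j := by
  simp [diag, Matrix.diagonal_apply]

theorem sum_single_row (a b i : Fin n) (c : ℤ) :
    ∑ j, Matrix.single a b c i j = if i = a then c else 0 := by
  simp only [Matrix.single_apply, ite_and, eq_comm (a := a)]
  split_ifs <;> simp

theorem sum_single_col (a b j : Fin n) (c : ℤ) :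
    ∑ i, Matrix.single a b c i j = if j = b then c else 0 := by
  simp only [Matrix.single_apply, and_comm (a := a = _), ite_and, eq_comm (a := b)]
  split_ifs <;> simp

theorem basisElt_one (r : ℕ) (γ : Fin n → ℕ) (A : Matrix (Fin n) (Fin n) ℤ)
    (hγ : ∀ i, ∑ j, A i j = γ i) (hAs : ∑ i, ∑ j, A i j = r) :
    basisElt r (diag γ) * basisElt r A = basisElt r A := by
  by_cases hA : ∀ i j, 0 ≤ A i j
  swap
  · push Not at hA
    obtain ⟨i, j, hij⟩ := hA
    rw [basisElt_eq_zero_of_neg r hij, mul_zero]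
  have hγs : ∑ i, γ i = r := by
    zify
    rw [← hAs]
    exact Finset.sum_congr rfl fun i _ => (hγ i).symm
  obtain ⟨m, hm⟩ := exists_comp (fun j => Finset.sum_nonneg fun i _ => hA i j)
    (by rw [Finset.sum_comm]; exact hAs)
  have e1 := basisElt_eq (r := r) (l := ⟨γ, hγs⟩) (m := ⟨γ, hγs⟩) (A := diag γ)
    (sum_diag_row γ) (sum_diag_col γ)
  have e2 := basisElt_eq (l := ⟨γ, hγs⟩) (m := m) hγ hm
  have h := schurMap_mul (k := ⟨γ, hγs⟩) (l := ⟨γ, hγs⟩) (m := m) (B := diag γ) (A := A) (Y := 1)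
    (s := {()}) (a := fun _ => 1) (A' := fun _ => A)
    (by rw [one_mul]; exact (cosetSum_diag (⟨γ, hγs⟩ : Comp n r)).symm) (by simp)
  simp only [Finset.sum_singleton, one_smul] at h
  rw [e1, e2, smul_mul_smul_comm, h, dStat_diag]
  simp

theorem qSum_eq (k : ℕ) : qSum (k + 1) = v ^ (k : ℤ) * qInt ((k : ℤ) + 1) := by
  have h := qqInt_eq ((k : ℤ) + 1)
  rw [add_sub_cancel_right] at h
  rw [← h, qqInt, eq_div_iff v_sq_sub_one_ne_zero, mul_comm, mul_qSum]
  congr 1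
  rw [← pow_mul]
  exact_mod_cast rfl

theorem insertCoef_eq (κ : Fin n → ℤ) {A : Matrix (Fin n) (Fin n) ℤ} (hA : ∀ i j, 0 ≤ A i j)
    (a u : Fin n) : insertCoef κ u (rowMS A a) =
      v ^ (2 * ∑ j with κ u < κ j, A a j + A a u) * qInt (A a u + 1) := by
  have h1 : ∀ j, (((A a j).toNat : ℕ) : ℤ) = A a j := fun j => Int.toNat_of_nonneg (hA a j)
  rw [insertCoef, qSum_eq, count_rowMS, h1, ← mul_assoc, vadd]
  congr 2
  rw [← pow_mul, ← zpow_natCast]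
  congr 1
  push_cast
  rw [numGt]
  push_cast
  simp only [count_rowMS, h1]

/-- The rule for the multiplication by an element with one off-diagonal entry, from the
corresponding property of double coset sums and the change of the exponent `dStat`. -/
theorem isMulBasis_basisElt (r : ℕ) {κ : Fin n → ℤ} (hκ : Function.Injective κ) {a b : Fin n}
    (hab : κ a < κ b)
    (hY : ∀ l l' : Comp n r,
      (∀ i, (l'.1 i : ℤ) = l.1 i + (if i = a then 1 else 0) - (if i = b then 1 else 0)) →
      ∃ Y, MovesLetters κ a b l l' Y)
    (hd : ∀ A u, dStat (move A a b u) =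
      dStat A + ∑ j with κ j < κ u, A a j - ∑ j with κ u < κ j, A b j)
    (hB : ∀ γ : Fin n → ℕ, dStat (diag γ + Matrix.single a b 1) = γ a) :
    IsMulBasis r κ a b (basisElt (n := n) r) where
  neg A i j h := basisElt_eq_zero_of_neg r h
  orth := basisElt_orth r
  one := basisElt_one r
  step := by
    intro γ A hA hrow hAs
    have hne : a ≠ b := by rintro rfl; exact lt_irrefl _ hab
    obtain ⟨l, hl⟩ := exists_comp (fun i => Finset.sum_nonneg fun j _ => hA i j) hAs
    obtain ⟨m, hm⟩ := exists_comp (fun j => Finset.sum_nonneg fun i _ => hA i j)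
      (by rw [Finset.sum_comm]; exact hAs)
    have hγs : ∑ i, (γ i : ℤ) + 1 = r := by
      rw [← hAs]
      simp only [hrow, Finset.sum_add_distrib, Finset.sum_ite_eq', Finset.mem_univ, if_true]
    obtain ⟨k, hk⟩ := exists_comp (c := fun i => (γ i : ℤ) + if i = a then 1 else 0) (r := r)
      (fun i => by positivity)
      (by simp only [Finset.sum_add_distrib, Finset.sum_ite_eq', Finset.mem_univ, if_true, hγs])
    obtain ⟨Y, hY⟩ := hY l k (fun i => by rw [← hk, ← hl, hrow]; ring)
    -- `diag l` with one unit moved is the matrix of the left factor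
    have hdiagl : diag l.1 = diag γ + Matrix.single b b 1 := by
      ext i j
      rw [Matrix.add_apply, diag, diag, Matrix.single_apply]
      by_cases hij : i = j
      · subst hij
        rw [Matrix.diagonal_apply_eq, Matrix.diagonal_apply_eq, ← hl, hrow]
        simp [eq_comm]
      · rw [Matrix.diagonal_apply_ne _ hij, Matrix.diagonal_apply_ne _ hij, if_neg, add_zero]
        rintro ⟨rfl, rfl⟩
        exact hij rfl
    have hBY : Y * xElt l = cosetSum k l (diag γ + Matrix.single a b 1) := by
      rw [← cosetSum_diag l, hY l (diag l.1)
        (fun i j => by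
          rw [diag, Matrix.diagonal_apply]
          split_ifs
          · positivity
          · exact le_rfl)
        (sum_diag_row l.1), Finset.sum_eq_single b]
      · have h1 : move (diag l.1) a b b = diag γ + Matrix.single a b 1 := by
          rw [move, hdiagl]; abel
        have hc : ∀ j, j ≠ a → (rowMS (diag l.1) a).count j = 0 := fun j hj => by
          rw [count_rowMS, diag, Matrix.diagonal_apply_ne _ hj.symm]; rfl
        have h2 : insertCoef κ b (rowMS (diag l.1) a) = 1 := by
          rw [insertCoef, hc b hne.symm, numGt, Finset.sum_eq_zero]
          · simp [qSum]
          · intro j hj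
            refine hc j ?_
            rintro rfl
            simp only [Finset.mem_filter, Finset.mem_univ, true_and] at hj
            exact lt_asymm hab hj
        rw [h1, h2, one_smul]
      · intro u _ hu
        rw [cosetSum_eq_zero (i := b) (j := u), smul_zero]
        rw [move_apply, diag, Matrix.diagonal_apply_ne _ hu.symm]
        simp [hne.symm]
      · simp
    have e1 : basisElt r (diag γ + Matrix.single a b 1) =
        v ^ (-(γ a : ℤ)) • schurMap k l (diag γ + Matrix.single a b 1) := by
      rw [basisElt_eq (l := k) (m := l), hB]
      · intro i
        simp only [Matrix.add_apply, Finset.sum_add_distrib, sum_diag_row, sum_single_row, ← hk]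
      · intro j
        simp only [Matrix.add_apply, Finset.sum_add_distrib, sum_diag_col, sum_single_col]
        rw [← hl, hrow]
    have e2 := basisElt_eq hl hm
    have e3 : ∀ u, basisElt r (move A a b u) =
        v ^ (-dStat (move A a b u)) • schurMap k m (move A a b u) := by
      intro u
      refine basisElt_eq ?_ ?_
      · intro i
        rw [sum_move_row, ← hk, hrow]
        ring
      · intro j
        rw [sum_move_col, hm]
    rw [e1, e2, smul_mul_smul_comm, schurMap_mul hBY (hY m A hA hl), Finset.smul_sum]
    refine Finset.sum_congr rfl fun u _ => ?_
    rw [e3, smul_smul, smul_smul, insertCoef_eq κ hA]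
    congr 1
    rw [← vadd, ← mul_assoc, ← vadd, mul_right_comm, ← vadd]
    congr 2
    have h1 : (γ a : ℤ) = ∑ j, A a j := by rw [hrow, if_neg hne, add_zero]
    have h2 : ∑ j, A a j = ∑ j with κ j < κ u, A a j + A a u + ∑ j with κ u < κ j, A a j := by
      have h3 : A a u = ∑ j, if j = u then A a j else 0 := by simp
      rw [h3, Finset.sum_filter, Finset.sum_filter, ← Finset.sum_add_distrib,
        ← Finset.sum_add_distrib]
      refine Finset.sum_congr rfl fun j _ => ?_
      rcases lt_trichotomy (κ j) (κ u) with h | h | h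
      · have : j ≠ u := by rintro rfl; exact lt_irrefl _ h
        simp [h, this, h.le]
      · simp [hκ h]
      · have : j ≠ u := by rintro rfl; exact lt_irrefl _ h
        simp [h, this, h.le]
    rw [hd, h1, h2, Finset.sum_sub_distrib]
    ring

theorem isMulBasis_up (r : ℕ) {h h' : Fin n} (hh' : (h' : ℕ) = h + 1) :
    IsMulBasis r (fun a : Fin n => ((a : ℕ) : ℤ)) h h' (basisElt (n := n) r) :=
  isMulBasis_basisElt r valKey_injective (by simp [hh'])
    (fun _ _ hl' => exists_movesLetters_up hh' hl')
    (fun A u => by simpa using dStat_move_up hh' A u) (dStat_diag_add_single_up hh')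

theorem isMulBasis_down (r : ℕ) {h h' : Fin n} (hh' : (h' : ℕ) = h + 1) :
    IsMulBasis r (fun a : Fin n => -((a : ℕ) : ℤ)) h' h (basisElt (n := n) r) :=
  isMulBasis_basisElt r (fun _ _ hab => valKey_injective (neg_injective hab)) (by simp [hh'])
    (fun _ _ hl' => exists_movesLetters_down hh' hl')
    (fun A u => by simpa using dStat_move_down hh' A u) (dStat_diag_add_single_down hh')

end Step

/-! ### Multiplication by a basis element with one off-diagonal entry -/

section Powers

variable {n : ℕ}

/-- The matrix obtained from `A` when `t u` letters `u`, for all `u`, move from the row `b` to the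
row `a`. -/
def moveAll (A : Matrix (Fin n) (Fin n) ℤ) (a b : Fin n) (t : Fin n → ℕ) :
    Matrix (Fin n) (Fin n) ℤ :=
  Matrix.of fun i j => A i j + (if i = a then (t j : ℤ) else 0) - (if i = b then (t j : ℤ) else 0)

theorem moveAll_apply (A : Matrix (Fin n) (Fin n) ℤ) (a b : Fin n) (t : Fin n → ℕ) (i j : Fin n) :
    moveAll A a b t i j =
      A i j + (if i = a then (t j : ℤ) else 0) - (if i = b then (t j : ℤ) else 0) := rfl

theorem move_moveAll (A : Matrix (Fin n) (Fin n) ℤ) (a b u : Fin n) (t : Fin n → ℕ) :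
    move (moveAll A a b t) a b u = moveAll A a b (t + Pi.single u 1) := by
  ext i j
  simp only [move_apply, moveAll_apply, Pi.add_apply, Pi.single_apply]
  split_ifs <;> simp_all <;> ring

theorem sum_moveAll_row (A : Matrix (Fin n) (Fin n) ℤ) (a b : Fin n) (t : Fin n → ℕ) (i : Fin n) :
    ∑ j, moveAll A a b t i j = ∑ j, A i j + (if i = a then ∑ j, (t j : ℤ) else 0) -
      (if i = b then ∑ j, (t j : ℤ) else 0) := by
  simp only [moveAll_apply, Finset.sum_sub_distrib, Finset.sum_add_distrib]
  congr 2 <;> split_ifs <;> simp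

theorem sum_moveAll (A : Matrix (Fin n) (Fin n) ℤ) (a b : Fin n) (t : Fin n → ℕ) :
    ∑ i, ∑ j, moveAll A a b t i j = ∑ i, ∑ j, A i j := by
  simp only [sum_moveAll_row, Finset.sum_sub_distrib, Finset.sum_add_distrib, Finset.sum_ite_eq',
    Finset.mem_univ, if_true]
  ring

/-- The exponent of `v` in the coefficient of `moveAll A a b t`. -/
def powExp (κ : Fin n → ℤ) (A : Matrix (Fin n) (Fin n) ℤ) (a b : Fin n) (t : Fin n → ℕ) : ℤ :=
  ∑ u, (t u : ℤ) * ∑ i with κ u < κ i, (A a i - A b i) +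
    ∑ u, ∑ u' with κ u < κ u', (t u : ℤ) * t u'

/-- The coefficient of `moveAll A a b t` in a product with a basis element that has one
off-diagonal entry `∑ t u`. -/
def powCoef (κ : Fin n → ℤ) (A : Matrix (Fin n) (Fin n) ℤ) (a b : Fin n) (t : Fin n → ℕ) : K :=
  v ^ powExp κ A a b t * ∏ u, qBinom (A a u + t u) (t u)

theorem powExp_add_single {κ : Fin n → ℤ} (A : Matrix (Fin n) (Fin n) ℤ) (a b : Fin n)
    (t : Fin n → ℕ) (u : Fin n) : powExp κ A a b (t + Pi.single u 1) = powExp κ A a b t +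
      ∑ i with κ u < κ i, (A a i - A b i) + ∑ i with κ u < κ i, (t i : ℤ) +
        ∑ i with κ i < κ u, (t i : ℤ) := by
  have h1 : ∀ w, (((t + Pi.single u 1 : Fin n → ℕ) w : ℕ) : ℤ) = t w + if w = u then 1 else 0 := by
    intro w
    simp only [Pi.add_apply, Pi.single_apply]
    split_ifs <;> simp
  unfold powExp
  simp only [h1, add_mul, mul_add, Finset.sum_add_distrib]
  have e1 : ∑ w, (if w = u then (1 : ℤ) else 0) * ∑ i with κ w < κ i, (A a i - A b i) =
      ∑ i with κ u < κ i, (A a i - A b i) := by simp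
  have e2 : ∑ w, ∑ w' with κ w < κ w', (if w = u then (1 : ℤ) else 0) * (t w' : ℤ) =
      ∑ i with κ u < κ i, (t i : ℤ) := by
    simp only [← Finset.mul_sum]; simp
  have e3 : ∑ w, ∑ w' with κ w < κ w', (t w : ℤ) * (if w' = u then (1 : ℤ) else 0) =
      ∑ i with κ i < κ u, (t i : ℤ) := by
    rw [Finset.sum_filter]
    refine Finset.sum_congr rfl fun w _ => ?_
    rw [Finset.sum_filter, Finset.sum_eq_single u]
    · simp
    · intro w' _ hw'; simp [hw']
    · simp
  have e4 : ∑ w, ∑ w' with κ w < κ w',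
      (if w = u then (1 : ℤ) else 0) * (if w' = u then (1 : ℤ) else 0) = 0 := by
    refine Finset.sum_eq_zero fun w _ => Finset.sum_eq_zero fun w' hw' => ?_
    simp only [Finset.mem_filter, Finset.mem_univ, true_and] at hw'
    split_ifs with h h'
    · rw [h, h'] at hw'; exact absurd hw' (lt_irrefl _)
    all_goals simp
  simp only [e1, e2, e3, e4]
  ring

/-- One more unit is moved: the coefficients on the two sides differ by the factor that is summed
up in `qInt_sum`. -/
theorem powCoef_mul_step {κ : Fin n → ℤ} (A : Matrix (Fin n) (Fin n) ℤ) {a b : Fin n} (hab : a ≠ b)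
    (t : Fin n → ℕ) (u : Fin n) :
    powCoef κ A a b t * (v ^ (∑ i with κ u < κ i, (moveAll A a b t a i - moveAll A a b t b i)) *
      qInt (moveAll A a b t a u + 1)) =
    powCoef κ A a b (t + Pi.single u 1) *
      (v ^ ((∑ i with κ u < κ i, (((t + Pi.single u 1 : Fin n → ℕ) i : ℕ) : ℤ)) -
        ∑ i with κ i < κ u, (((t + Pi.single u 1 : Fin n → ℕ) i : ℕ) : ℤ)) *
        qInt (((t + Pi.single u 1 : Fin n → ℕ) u : ℕ) : ℤ)) := by
  have h1 : ∀ w, w ≠ u → (t + Pi.single u 1 : Fin n → ℕ) w = t w := by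
    intro w hw; simp [hw]
  have h2 : (t + Pi.single u 1 : Fin n → ℕ) u = t u + 1 := by simp
  have e1 : ∑ i with κ u < κ i, (((t + Pi.single u 1 : Fin n → ℕ) i : ℕ) : ℤ) =
      ∑ i with κ u < κ i, (t i : ℤ) := by
    refine Finset.sum_congr rfl fun i hi => ?_
    rw [h1]; rintro rfl; simp at hi
  have e2 : ∑ i with κ i < κ u, (((t + Pi.single u 1 : Fin n → ℕ) i : ℕ) : ℤ) =
      ∑ i with κ i < κ u, (t i : ℤ) := by
    refine Finset.sum_congr rfl fun i hi => ?_
    rw [h1]; rintro rfl; simp at hi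
  have e3 : ∑ i with κ u < κ i, (moveAll A a b t a i - moveAll A a b t b i) =
      ∑ i with κ u < κ i, (A a i - A b i) + ∑ i with κ u < κ i, (t i : ℤ) +
        ∑ i with κ u < κ i, (t i : ℤ) := by
    rw [← Finset.sum_add_distrib, ← Finset.sum_add_distrib]
    refine Finset.sum_congr rfl fun i _ => ?_
    simp only [moveAll_apply, hab, hab.symm, if_true, if_false]
    ring
  have e4 : moveAll A a b t a u = A a u + t u := by simp [moveAll_apply, hab]
  have e5 : (∏ w, qBinom (A a w + t w) (t w)) * qInt (A a u + t u + 1) =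
      (∏ w, qBinom (A a w + ((t + Pi.single u 1 : Fin n → ℕ) w : ℕ))
        ((t + Pi.single u 1 : Fin n → ℕ) w)) * qInt ((t u : ℤ) + 1) := by
    rw [← Finset.mul_prod_erase _ _ (Finset.mem_univ u), ← Finset.mul_prod_erase _ _
      (Finset.mem_univ u), h2]
    have h3 := qBinom_succ_mul (A a u + t u + 1) (t u)
    rw [add_sub_cancel_right] at h3
    have h4 : ∏ w ∈ Finset.univ.erase u, qBinom (A a w + ((t + Pi.single u 1 : Fin n → ℕ) w : ℕ))
        ((t + Pi.single u 1 : Fin n → ℕ) w) =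
        ∏ w ∈ Finset.univ.erase u, qBinom (A a w + t w) (t w) :=
      Finset.prod_congr rfl fun w hw => by rw [h1 w (Finset.ne_of_mem_erase hw)]
    rw [h4, mul_right_comm, ← h3]
    push_cast
    rw [← add_assoc]
    ring
  have e6 : v ^ powExp κ A a b t * v ^ (∑ i with κ u < κ i, (A a i - A b i) +
      ∑ i with κ u < κ i, (t i : ℤ) + ∑ i with κ u < κ i, (t i : ℤ)) =
      v ^ powExp κ A a b (t + Pi.single u 1) *
        v ^ (∑ i with κ u < κ i, (t i : ℤ) - ∑ i with κ i < κ u, (t i : ℤ)) := by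
    rw [powExp_add_single, ← vadd, ← vadd]
    congr 1
    ring
  rw [e1, e2, e3, e4, powCoef, powCoef, h2]
  push_cast
  linear_combination (∏ w, qBinom (A a w + t w) (t w)) * qInt (A a u + t u + 1) * e6 +
    v ^ powExp κ A a b (t + Pi.single u 1) *
        v ^ (∑ i with κ u < κ i, (t i : ℤ) - ∑ i with κ i < κ u, (t i : ℤ)) * e5

theorem diag_add_single (γ : Fin n → ℕ) (b : Fin n) :
    diag (γ + Pi.single b 1) = diag γ + Matrix.single b b 1 := by
  ext i j
  rw [Matrix.add_apply, diag, diag, Matrix.single_apply]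
  by_cases hij : i = j
  · subst hij
    rw [Matrix.diagonal_apply_eq, Matrix.diagonal_apply_eq, Pi.add_apply, Pi.single_apply]
    by_cases hb : i = b
    · simp [hb]
    · simp [hb, Ne.symm hb]
  · rw [Matrix.diagonal_apply_ne _ hij, Matrix.diagonal_apply_ne _ hij, if_neg, add_zero]
    rintro ⟨rfl, rfl⟩
    exact hij rfl

theorem mem_compositions {m : ℕ} {t : Fin n → ℕ} :
    t ∈ Finset.piAntidiag Finset.univ m ↔ ∑ i, t i = m := by
  simp [Finset.mem_piAntidiag]

theorem sum_add_single {M : Type*} [AddCommMonoid M] (m : ℕ) (u : Fin n) (G : (Fin n → ℕ) → M)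
    (hG : ∀ t, t u = 0 → G t = 0) :
    ∑ t ∈ Finset.piAntidiag Finset.univ m, G (t + Pi.single u 1) =
      ∑ t ∈ Finset.piAntidiag Finset.univ (m + 1), G t := by
  refine Finset.sum_of_injOn (fun t => t + Pi.single u 1) ?_ ?_ ?_ fun _ _ => rfl
  · intro t _ t' _ h
    exact add_right_cancel h
  · intro t ht
    rw [Finset.mem_coe, mem_compositions] at ht ⊢
    simp [Finset.sum_add_distrib, ht]
  · intro t ht hnot
    apply hG
    by_contra h0
    apply hnot
    rw [mem_compositions] at ht
    have hs : (t - Pi.single u 1) + Pi.single u 1 = t := by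
      funext w
      simp only [Pi.add_apply, Pi.sub_apply, Pi.single_apply]
      split_ifs with hw
      · subst hw; omega
      · omega
    refine ⟨t - Pi.single u 1, ?_, hs⟩
    rw [Finset.mem_coe, mem_compositions]
    have := congrArg (fun f : Fin n → ℕ => ∑ i, f i) hs
    simp only [Pi.add_apply, Finset.sum_add_distrib, ht] at this
    simpa using this

variable {S : Type*} [Semiring S] [Algebra K S] {r : ℕ} {κ : Fin n → ℤ} {a b : Fin n}
  {e : Matrix (Fin n) (Fin n) ℤ → S}

/-- The multiplication rule for an arbitrary off-diagonal entry `m`. It follows from the rule for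
the entry `1`, as the product of the elements for `1` and `m` is `[m+1]` times the element for
`m + 1`. -/
theorem IsMulBasis.pow (he : IsMulBasis r κ a b e) (hκ : Function.Injective κ) (hab : κ a < κ b)
    (m : ℕ) (γ : Fin n → ℕ) (A : Matrix (Fin n) (Fin n) ℤ) (hA : ∀ i j, 0 ≤ A i j)
    (hrow : ∀ i, ∑ j, A i j = (γ i : ℤ) + if i = b then (m : ℤ) else 0)
    (hsum : ∑ i, ∑ j, A i j = (r : ℤ)) :
    e (diag γ + Matrix.single a b (m : ℤ)) * e A =
      ∑ t ∈ Finset.piAntidiag Finset.univ m, powCoef κ A a b t • e (moveAll A a b t) := by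
  have hne : a ≠ b := by rintro rfl; exact lt_irrefl _ hab
  induction m generalizing γ with
  | zero =>
    have h0 : moveAll A a b 0 = A := by ext i j; simp [moveAll_apply]
    have h1 : powCoef κ A a b 0 = 1 := by simp [powCoef, powExp]
    rw [Finset.piAntidiag_zero, Finset.sum_singleton, h0, h1, one_smul, Nat.cast_zero,
      Matrix.single_zero, add_zero]
    exact he.one γ A (by simpa using hrow) hsum
  | succ m ih =>
    -- the left factors for the entries `m` and `1`
    set C := diag (γ + Pi.single b 1) + Matrix.single a b (m : ℤ) with hC
    set γ' : Fin n → ℕ := γ + Pi.single a m with hγ'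
    have hγ'c : ∀ i, ((γ' i : ℕ) : ℤ) = γ i + if i = a then (m : ℤ) else 0 := by
      intro i
      simp only [hγ', Pi.add_apply, Pi.single_apply]
      split_ifs <;> simp
    have hγb : ∀ i, (((γ + Pi.single b 1 : Fin n → ℕ) i : ℕ) : ℤ) =
        γ i + if i = b then 1 else 0 := by
      intro i
      simp only [Pi.add_apply, Pi.single_apply]
      split_ifs <;> simp
    have hCrow : ∀ i, ∑ j, C i j = (γ' i : ℤ) + if i = b then 1 else 0 := by
      intro i
      simp only [hC, Matrix.add_apply, Finset.sum_add_distrib, sum_diag_row, sum_single_row, hγ'c,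
        hγb]
      ring
    have hCsum : ∑ i, ∑ j, C i j = (r : ℤ) := by
      rw [← hsum]
      simp only [hCrow, hrow, hγ'c, Finset.sum_add_distrib, Finset.sum_ite_eq', Finset.mem_univ,
        if_true]
      push_cast; ring
    have hCnn : ∀ i j, 0 ≤ C i j := by
      intro i j
      simp only [hC, Matrix.add_apply, diag, Matrix.diagonal_apply, Matrix.single_apply]
      positivity
    have hbase : e (diag γ' + Matrix.single a b 1) * e C =
        qInt ((m : ℤ) + 1) • e (diag γ + Matrix.single a b ((m + 1 : ℕ) : ℤ)) := by
      rw [he.step γ' C hCnn hCrow hCsum, Finset.sum_eq_single b]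
      · have h1 : ∑ i with κ b < κ i, (C a i - C b i) = 0 := by
          refine Finset.sum_eq_zero fun i hi => ?_
          simp only [Finset.mem_filter, Finset.mem_univ, true_and] at hi
          have hib : b ≠ i := by rintro rfl; exact lt_irrefl _ hi
          have hia : a ≠ i := by rintro rfl; exact lt_asymm hab hi
          simp [hC, diag, hia, hib]
        have h2 : C a b = m := by simp [hC, diag, hne]
        have h3 : move C a b b = diag γ + Matrix.single a b ((m + 1 : ℕ) : ℤ) := by
          rw [move, hC, diag_add_single, Nat.cast_succ, Matrix.single_add]
          abel
        rw [h1, h2, h3, zpow_zero, one_mul]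
      · intro u _ hu
        rw [he.neg _ b u, smul_zero]
        have : C b u = 0 := by simp [hC, diag, hu.symm, hne]
        rw [move_apply, this]
        simp [hne.symm]
      · simp
    have hih := ih (γ + Pi.single b 1) (fun i => by
      rw [hrow, hγb]; push_cast; split_ifs <;> ring)
    have hstep : ∀ t ∈ Finset.piAntidiag Finset.univ m,
        e (diag γ' + Matrix.single a b 1) * e (moveAll A a b t) =
        ∑ u, (v ^ (∑ i with κ u < κ i, (moveAll A a b t a i - moveAll A a b t b i)) *
          qInt (moveAll A a b t a u + 1)) • e (moveAll A a b (t + Pi.single u 1)) := by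
      intro t ht
      rw [mem_compositions] at ht
      simp only [← move_moveAll]
      by_cases hnn : ∀ i j, 0 ≤ moveAll A a b t i j
      · refine he.step γ' _ hnn ?_ ((sum_moveAll A a b t).trans hsum)
        intro i
        rw [sum_moveAll_row, hrow, hγ'c, ← Nat.cast_sum, ht]
        push_cast
        split_ifs <;> ring
      · push Not at hnn
        obtain ⟨i, j, hij⟩ := hnn
        rw [he.neg _ i j hij, mul_zero, Finset.sum_eq_zero]
        intro u _
        rw [he.neg _ i j, smul_zero]
        have hib : i = b := by
          by_contra hib
          rw [moveAll_apply, if_neg hib, sub_zero] at hij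
          have := hA i j
          split_ifs at hij <;> omega
        subst hib
        rw [move_apply]
        simp only [hne.symm, false_and, if_false, true_and]
        split_ifs <;> omega
    have hm0 : qInt ((m : ℤ) + 1) ≠ 0 := qInt_ne_zero (by omega)
    have hmain : qInt ((m : ℤ) + 1) • (e (diag γ + Matrix.single a b ((m + 1 : ℕ) : ℤ)) * e A) =
        qInt ((m : ℤ) + 1) • ∑ t ∈ Finset.piAntidiag Finset.univ (m + 1),
          powCoef κ A a b t • e (moveAll A a b t) := by
      rw [← smul_mul_assoc, ← hbase, mul_assoc, hih, Finset.mul_sum]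
      let F : Fin n → (Fin n → ℕ) → S := fun u t => (powCoef κ A a b t *
        (v ^ ((∑ i with κ u < κ i, (t i : ℤ)) - ∑ i with κ i < κ u, (t i : ℤ)) *
          qInt (t u : ℤ))) • e (moveAll A a b t)
      have h1 : ∀ t ∈ Finset.piAntidiag (Finset.univ : Finset (Fin n)) m,
          e (diag γ' + Matrix.single a b 1) * powCoef κ A a b t • e (moveAll A a b t) =
          ∑ u, F u (t + Pi.single u 1) := by
        intro t ht
        rw [mul_smul_comm, hstep t ht, Finset.smul_sum]
        refine Finset.sum_congr rfl fun u _ => ?_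
        rw [smul_smul, powCoef_mul_step A hne]
      have h2 : ∀ u, ∑ t ∈ Finset.piAntidiag Finset.univ m, F u (t + Pi.single u 1) =
          ∑ t ∈ Finset.piAntidiag Finset.univ (m + 1), F u t := fun u =>
        sum_add_single m u (F u) fun t ht => by simp [F, ht]
      rw [Finset.sum_congr rfl h1, Finset.sum_comm, Finset.sum_congr rfl fun u _ => h2 u,
        Finset.sum_comm, Finset.smul_sum]
      refine Finset.sum_congr rfl fun t ht => ?_
      rw [mem_compositions] at ht
      rw [← Finset.sum_smul, ← Finset.mul_sum, qInt_sum hκ (fun i => (t i : ℤ)), smul_smul,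
        ← Nat.cast_sum, ht, mul_comm]
      push_cast
      rfl
    have := congrArg ((qInt ((m : ℤ) + 1))⁻¹ • ·) hmain
    simpa only [smul_smul, inv_mul_cancel₀ hm0, one_smul] using this

end Powers

/-! ### The coefficients -/

section Coefficients

variable {n : ℕ}

/-- The common form of `alphaUp` and `alphaDown`: the indices are compared through `κ`. -/
def alphaKey (κ : Fin n → ℤ) (l : Fin n → ℕ) (a b : Fin n) (t : Fin n → ℕ) (j c k : ℕ) :
    Fin n → ℤ :=
  Pi.single a ((∑ u with κ u < κ a, (t u : ℤ)) + l a - j - c)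
    + Pi.single b ((l b : ℤ) - k - ∑ u with κ u < κ b, (t u : ℤ))

/-- The common form of `gUp` and `gDown`. -/
def gKey (κ : Fin n → ℤ) (A : Matrix (Fin n) (Fin n) ℕ) (δ : Fin n → ℤ) (a b : Fin n)
    (t : Fin n → ℕ) (j k : ℕ) : ℤ :=
  (∑ u, ∑ i with κ u ≤ κ i ∧ i ≠ a, (A a i : ℤ) * t u)
    - (∑ u, ∑ i with κ u < κ i ∧ i ≠ b, (A b i : ℤ) * t u)
    + (∑ u, ∑ u' with u' ≠ a ∧ u' ≠ b ∧ κ u < κ u', (t u : ℤ) * t u')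
    - t a * δ a + t b * δ b + 2 * j * t a - k * t b

/-- The common form of `fUp` and `fDown`. -/
def fKey (κ : Fin n → ℤ) (A : Matrix (Fin n) (Fin n) ℕ) (δ : Fin n → ℤ) (l : Fin n → ℕ)
    (a b : Fin n) (t : Fin n → ℕ) (j c k : ℕ) : K :=
  v ^ gKey κ A δ a b t j k * (∏ u with u ≠ a, bar (qqBinom ((A a u : ℤ) + t u) (t u)))
    * qBinom (-(t a : ℤ)) (l a - j) * qTrinom (t a + j - c) c (t a - c) (j - c)
    * qBinom (t b) (l b - k)

theorem fKey_mem_laurent (κ : Fin n → ℤ) (A : Matrix (Fin n) (Fin n) ℕ) (δ : Fin n → ℤ)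
    (l : Fin n → ℕ) (a b : Fin n) (t : Fin n → ℕ) {j c : ℕ} (k : ℕ) (hc : c ≤ min (t a) j) :
    fKey κ A δ l a b t j c k ∈ laurent := by
  have hp : ∏ u with u ≠ a, bar (qqBinom ((A a u : ℤ) + t u) (t u)) ∈ laurent :=
    Subring.prod_mem _ fun u _ => by
      rw [bar_qqBinom]
      exact Subring.mul_mem _ (v_zpow_mem_laurent _) (qBinom_mem_laurent _ _)
  rw [le_min_iff] at hc
  exact Subring.mul_mem _ (Subring.mul_mem _ (Subring.mul_mem _ (Subring.mul_mem _
    (v_zpow_mem_laurent _) hp) (qBinom_mem_laurent _ _)) (qTrinom_mem_laurent hc.1 hc.2))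
    (qBinom_mem_laurent _ _)

/-- The exponent in terms of the sums that occur in `gKey`. The diagonal entries of `μ` at `a` and
`b`, and the summands `t u * t u'` with `u' = a` or `u' = b`, contribute the last two terms. -/
theorem powExp_eq {κ : Fin n → ℤ} (hκ : Function.Injective κ) {A : Matrix (Fin n) (Fin n) ℕ}
    (hA : ∀ i, A i i = 0) {a b : Fin n} (hab : a ≠ b) (t : Fin n → ℕ) (μ : Fin n → ℤ) :
    powExp κ (A.map (fun x => (x : ℤ)) + Matrix.diagonal μ) a b t =
      (∑ u, ∑ i with κ u ≤ κ i ∧ i ≠ a, (A a i : ℤ) * t u)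
      - (∑ u, ∑ i with κ u < κ i ∧ i ≠ b, (A b i : ℤ) * t u)
      + (∑ u, ∑ u' with u' ≠ a ∧ u' ≠ b ∧ κ u < κ u', (t u : ℤ) * t u')
      - ∑ u with u ≠ a, (t u : ℤ) * A a u
      + (μ a + t a) * (∑ u with κ u < κ a, (t u : ℤ))
      - (μ b - t b) * (∑ u with κ u < κ b, (t u : ℤ)) := by
  have e1 : ∑ u, (t u : ℤ) * ∑ i with κ u < κ i,
      ((A.map (fun x => (x : ℤ)) + Matrix.diagonal μ) a i -
        (A.map (fun x => (x : ℤ)) + Matrix.diagonal μ) b i) =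
      ∑ u, (t u : ℤ) * ∑ i with κ u < κ i, ((A a i : ℤ) - A b i) +
        μ a * (∑ u with κ u < κ a, (t u : ℤ)) - μ b * (∑ u with κ u < κ b, (t u : ℤ)) := by
    rw [Finset.sum_filter (fun u => κ u < κ a), Finset.sum_filter (fun u => κ u < κ b),
      Finset.mul_sum, Finset.mul_sum, ← Finset.sum_add_distrib, ← Finset.sum_sub_distrib]
    refine Finset.sum_congr rfl fun u _ => ?_
    have h1 : ∀ c, ∑ i with κ u < κ i, (Matrix.diagonal μ : Matrix _ _ ℤ) c i =
        if κ u < κ c then μ c else 0 := by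
      intro c
      rw [Finset.sum_filter, Finset.sum_eq_single c]
      · rw [Matrix.diagonal_apply_eq]
      · intro i _ hi
        rw [Matrix.diagonal_apply_ne _ hi.symm, ite_self]
      · simp
    simp only [Matrix.add_apply, Matrix.map_apply, Finset.sum_sub_distrib, Finset.sum_add_distrib,
      h1]
    split_ifs <;> ring
  have e2 : ∑ u, ∑ i with κ u ≤ κ i ∧ i ≠ a, (A a i : ℤ) * t u =
      ∑ u, (t u : ℤ) * ∑ i with κ u < κ i, (A a i : ℤ) + ∑ u with u ≠ a, (t u : ℤ) * A a u := by
    rw [Finset.sum_filter (fun u => u ≠ a), ← Finset.sum_add_distrib]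
    refine Finset.sum_congr rfl fun u _ => ?_
    have h2 : (if u ≠ a then (t u : ℤ) * A a u else 0) =
        ∑ i, if i = u then (A a i : ℤ) * t u else 0 := by
      rw [Finset.sum_ite_eq' , if_pos (Finset.mem_univ u)]
      split_ifs with hu
      · ring
      · rw [not_not.mp hu, hA]; simp
    rw [h2, Finset.mul_sum, Finset.sum_filter, Finset.sum_filter, ← Finset.sum_add_distrib]
    refine Finset.sum_congr rfl fun i _ => ?_
    by_cases hia : i = a
    · subst hia; simp [hA]
    rcases lt_trichotomy (κ u) (κ i) with h | h | h
    · have : i ≠ u := by rintro rfl; exact lt_irrefl _ h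
      simp [h, h.le, hia, this, mul_comm]
    · have := hκ h
      subst this
      simp [hia]
    · have : i ≠ u := by rintro rfl; exact lt_irrefl _ h
      simp [h.not_ge, h.not_gt, this]
  have e3 : ∑ u, ∑ i with κ u < κ i ∧ i ≠ b, (A b i : ℤ) * t u =
      ∑ u, (t u : ℤ) * ∑ i with κ u < κ i, (A b i : ℤ) := by
    refine Finset.sum_congr rfl fun u _ => ?_
    rw [Finset.mul_sum, Finset.sum_filter, Finset.sum_filter]
    refine Finset.sum_congr rfl fun i _ => ?_
    by_cases hib : i = b
    · subst hib; simp [hA]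
    · simp [hib, mul_comm]
  have e4 : ∑ u, ∑ u' with κ u < κ u', (t u : ℤ) * t u' =
      (∑ u, ∑ u' with u' ≠ a ∧ u' ≠ b ∧ κ u < κ u', (t u : ℤ) * t u') +
        t a * (∑ u with κ u < κ a, (t u : ℤ)) + t b * (∑ u with κ u < κ b, (t u : ℤ)) := by
    rw [Finset.sum_filter (fun u => κ u < κ a), Finset.sum_filter (fun u => κ u < κ b),
      Finset.mul_sum, Finset.mul_sum, ← Finset.sum_add_distrib, ← Finset.sum_add_distrib]
    refine Finset.sum_congr rfl fun u _ => ?_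
    have h1 : ∀ c, (t c : ℤ) * (if κ u < κ c then (t u : ℤ) else 0) =
        ∑ u', if u' = c then (if κ u < κ u' then (t u : ℤ) * t u' else 0) else 0 := by
      intro c
      rw [Finset.sum_ite_eq', if_pos (Finset.mem_univ c)]
      split_ifs <;> ring
    rw [h1, h1, Finset.sum_filter, Finset.sum_filter, ← Finset.sum_add_distrib,
      ← Finset.sum_add_distrib]
    refine Finset.sum_congr rfl fun i _ => ?_
    by_cases hia : i = a
    · subst hia; simp [hab]
    · by_cases hib : i = b
      · subst hib; simp [hab.symm]
      · simp [hia, hib]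
  rw [powExp, e1, e2, e3, e4]
  simp only [Finset.sum_sub_distrib, mul_sub]
  ring

/-- The entries of `l + β` are natural numbers, so the truncation in `shift` has no effect. -/
theorem shift_betaUp (l : Fin n → ℕ) {a b : Fin n} (hab : a ≠ b) (t : Fin n → ℕ) {j c : ℕ}
    (k : ℕ) (hc : c ≤ min (t a) j) :
    shift l (betaUp l a b t j c k) = fun i => if i = a then t a + j - c else
      if i = b then k else l i := by
  funext i
  rw [le_min_iff] at hc
  simp only [shift, betaUp, Pi.add_apply, Pi.single_apply]
  by_cases hia : i = a
  · subst hia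
    simp only [hab, if_true, if_false]
    omega
  · by_cases hib : i = b
    · subst hib
      simp only [hia, if_true, if_false]
      omega
    · simp [hia, hib]

theorem prod_eq_mul_mul {a b : Fin n} (hab : a ≠ b) (F : Fin n → K) :
    ∏ i, F i = F a * F b * ∏ i ∈ (Finset.univ.erase a).erase b, F i := by
  rw [← Finset.mul_prod_erase _ _ (Finset.mem_univ a), ← Finset.mul_prod_erase (a := b), mul_assoc]
  simp [hab.symm]

theorem sum_mul_alphaKey (κ : Fin n → ℤ) (δ ν : Fin n → ℤ) (l : Fin n → ℕ) (a b : Fin n)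
    (t : Fin n → ℕ) (j c k : ℕ) :
    ∑ i, ν i * (δ + alphaKey κ l a b t j c k) i = ∑ i, ν i * δ i +
      ν a * ((∑ u with κ u < κ a, (t u : ℤ)) + l a - j - c) +
      ν b * ((l b : ℤ) - k - ∑ u with κ u < κ b, (t u : ℤ)) := by
  simp only [alphaKey, Pi.add_apply, mul_add, Finset.sum_add_distrib]
  simp only [Pi.single_apply, mul_ite, mul_zero, Finset.sum_ite_eq', Finset.mem_univ, if_true]
  ring

/-- The diagonal of the matrix from which `t` moves the units, if the diagonal of the result
is `ν`. -/
def diagBefore (a b : Fin n) (t ν : Fin n → ℕ) : Fin n → ℤ :=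
  fun i => ν i - (if i = a then (t a : ℤ) else 0) + (if i = b then (t b : ℤ) else 0)

theorem diagBefore_left {a b : Fin n} (hab : a ≠ b) (t ν : Fin n → ℕ) :
    diagBefore a b t ν a = ν a - t a := by simp [diagBefore, hab]

theorem diagBefore_right {a b : Fin n} (hab : a ≠ b) (t ν : Fin n → ℕ) :
    diagBefore a b t ν b = ν b + t b := by simp [diagBefore, hab.symm]

theorem powCoef_eq {κ : Fin n → ℤ} {A : Matrix (Fin n) (Fin n) ℕ}
    (hA : ∀ i, A i i = 0) {a b : Fin n} (hab : a ≠ b) (t ν : Fin n → ℕ) :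
    powCoef κ (A.map (fun x => (x : ℤ)) + Matrix.diagonal (diagBefore a b t ν)) a b t =
      v ^ powExp κ (A.map (fun x => (x : ℤ)) + Matrix.diagonal (diagBefore a b t ν)) a b t *
        (qBinom (ν a) (t a) * ∏ u with u ≠ a, qBinom ((A a u : ℤ) + t u) (t u)) := by
  rw [powCoef, ← Finset.mul_prod_erase _ _ (Finset.mem_univ a)]
  congr 2
  · simp [diagBefore_left hab, hA]
  · refine Finset.prod_congr (by ext u; simp) fun u hu => ?_
    have : a ≠ u := fun h => by simp [h] at hu
    simp [Matrix.diagonal_apply_ne _ this]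

/-- The comparison of the coefficients of one basis element. Only the diagonal entries at `a` and
`b` change: the sum over `j` and `c` is expanded by `qBinom_sub_mul`, and the sum over `k` by the
`q`-Vandermonde identity. -/
theorem sum_fKey_mul {κ : Fin n → ℤ} (hκ : Function.Injective κ) {A : Matrix (Fin n) (Fin n) ℕ}
    (hA : ∀ i, A i i = 0) (δ : Fin n → ℤ) (l : Fin n → ℕ) {a b : Fin n} (hab : a ≠ b)
    (t ν : Fin n → ℕ) :
    ∑ j ∈ Finset.range (l a + 1), ∑ k ∈ Finset.range (l b + 1),
      ∑ c ∈ Finset.range (min (t a) j + 1), fKey κ A δ l a b t j c k *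
        (v ^ (∑ i, (ν i : ℤ) * (δ + alphaKey κ l a b t j c k) i) *
          qBinomVec (fun i => (ν i : ℤ)) (shift l (betaUp l a b t j c k))) =
    v ^ (∑ i, diagBefore a b t ν i * δ i) * qBinomVec (diagBefore a b t ν) l *
      powCoef κ (A.map (fun x => (x : ℤ)) + Matrix.diagonal (diagBefore a b t ν)) a b t := by
  have hδ : ∑ i, diagBefore a b t ν i * δ i = ∑ i, (ν i : ℤ) * δ i - t a * δ a + t b * δ b := by
    simp only [diagBefore, add_mul, sub_mul, Finset.sum_add_distrib, Finset.sum_sub_distrib,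
      ite_mul, zero_mul, Finset.sum_ite_eq', Finset.mem_univ, if_true]
  have hvec : qBinomVec (diagBefore a b t ν) l = qBinom ((ν a : ℤ) - t a) (l a) *
      qBinom ((ν b : ℤ) + t b) (l b) *
      ∏ i ∈ (Finset.univ.erase a).erase b, qBinom (ν i) (l i) := by
    rw [qBinomVec, prod_eq_mul_mul hab, diagBefore_left hab, diagBefore_right hab]
    congr 1
    refine Finset.prod_congr rfl fun i hi => ?_
    simp only [Finset.mem_erase, Finset.mem_univ, and_true] at hi
    simp [diagBefore, hi.1, hi.2]
  have hterm : ∀ j k c : ℕ, c ≤ min (t a) j → fKey κ A δ l a b t j c k *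
        (v ^ (∑ i, (ν i : ℤ) * (δ + alphaKey κ l a b t j c k) i) *
          qBinomVec (fun i => (ν i : ℤ)) (shift l (betaUp l a b t j c k))) =
      v ^ (∑ i, diagBefore a b t ν i * δ i) *
        v ^ powExp κ (A.map (fun x => (x : ℤ)) + Matrix.diagonal (diagBefore a b t ν)) a b t *
        (∏ u with u ≠ a, qBinom ((A a u : ℤ) + t u) (t u)) *
        (∏ i ∈ (Finset.univ.erase a).erase b, qBinom (ν i) (l i)) *
        (v ^ (2 * (j : ℤ) * t a + ν a * ((l a : ℤ) - j - c)) * qBinom (-(t a : ℤ)) (l a - j) *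
          qTrinom (t a + j - c) c (t a - c) (j - c) * qBinom (ν a) (t a + j - c)) *
        (v ^ ((ν b : ℤ) * ((l b : ℤ) - k) - t b * k) * qBinom (ν b) k *
          qBinom (t b) (l b - k)) := by
    intro j k c hc
    have h1 : qBinomVec (fun i => (ν i : ℤ)) (shift l (betaUp l a b t j c k)) =
        qBinom (ν a) (t a + j - c) * qBinom (ν b) k *
          ∏ i ∈ (Finset.univ.erase a).erase b, qBinom (ν i) (l i) := by
      rw [shift_betaUp l hab t k hc, qBinomVec, prod_eq_mul_mul hab, if_pos rfl, if_neg hab.symm,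
        if_pos rfl]
      congr 1
      refine Finset.prod_congr rfl fun i hi => ?_
      simp only [Finset.mem_erase, Finset.mem_univ, and_true] at hi
      rw [if_neg hi.2, if_neg hi.1]
    have h2 : ∏ u with u ≠ a, bar (qqBinom ((A a u : ℤ) + t u) (t u)) =
        v ^ (-∑ u with u ≠ a, (t u : ℤ) * A a u) *
          ∏ u with u ≠ a, qBinom ((A a u : ℤ) + t u) (t u) := by
      rw [← Finset.sum_neg_distrib]
      generalize (Finset.univ.filter fun u => u ≠ a) = s
      induction s using Finset.induction_on with
      | empty => simp
      | insert u s hu ih =>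
        rw [Finset.prod_insert hu, Finset.prod_insert hu, Finset.sum_insert hu, vadd, ih,
          bar_qqBinom, add_sub_cancel_right]
        ring
    have h3 : v ^ gKey κ A δ a b t j k * v ^ (-∑ u with u ≠ a, (t u : ℤ) * A a u) *
        v ^ (∑ i, (ν i : ℤ) * (δ + alphaKey κ l a b t j c k) i) =
        v ^ (∑ i, diagBefore a b t ν i * δ i) *
        v ^ powExp κ (A.map (fun x => (x : ℤ)) + Matrix.diagonal (diagBefore a b t ν)) a b t *
        v ^ (2 * (j : ℤ) * t a + ν a * ((l a : ℤ) - j - c)) *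
        v ^ ((ν b : ℤ) * ((l b : ℤ) - k) - t b * k) := by
      simp only [← vadd]
      congr 1
      rw [sum_mul_alphaKey, powExp_eq hκ hA hab, hδ, gKey, diagBefore_left hab,
        diagBefore_right hab]
      ring
    rw [fKey, h1, h2]
    linear_combination (∏ u with u ≠ a, qBinom ((A a u : ℤ) + t u) (t u)) *
      (∏ i ∈ (Finset.univ.erase a).erase b, qBinom (ν i) (l i)) * qBinom (-(t a : ℤ)) (l a - j) *
      qTrinom (t a + j - c) c (t a - c) (j - c) * qBinom (ν a) (t a + j - c) * qBinom (ν b) k *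
      qBinom (t b) (l b - k) * h3
  have h4 := qBinom_sub_mul (ν a) (t a) (l a)
  have h5 := qBinom_add_range (ν b) (t b) (l b)
  rw [hvec, powCoef_eq hA hab]
  have h6 : v ^ (∑ i, diagBefore a b t ν i * δ i) * (qBinom ((ν a : ℤ) - t a) (l a) *
      qBinom ((ν b : ℤ) + t b) (l b) *
      ∏ i ∈ (Finset.univ.erase a).erase b, qBinom (ν i) (l i)) *
      (v ^ powExp κ (A.map (fun x => (x : ℤ)) + Matrix.diagonal (diagBefore a b t ν)) a b t *
        (qBinom (ν a) (t a) * ∏ u with u ≠ a, qBinom ((A a u : ℤ) + t u) (t u))) =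
      v ^ (∑ i, diagBefore a b t ν i * δ i) *
        v ^ powExp κ (A.map (fun x => (x : ℤ)) + Matrix.diagonal (diagBefore a b t ν)) a b t *
        (∏ u with u ≠ a, qBinom ((A a u : ℤ) + t u) (t u)) *
        (∏ i ∈ (Finset.univ.erase a).erase b, qBinom (ν i) (l i)) *
        (qBinom ((ν a : ℤ) - t a) (l a) * qBinom (ν a) (t a)) *
        qBinom ((ν b : ℤ) + t b) (l b) := by ring
  rw [h6, h4, h5, Finset.mul_sum (Finset.range (l a + 1)), Finset.sum_mul]
  refine Finset.sum_congr rfl fun j _ => ?_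
  rw [Finset.mul_sum (Finset.range (l b + 1))]
  refine Finset.sum_congr rfl fun k _ => ?_
  rw [Finset.mul_sum (Finset.range (min (t a) j + 1)), Finset.sum_mul]
  refine Finset.sum_congr rfl fun c hc => ?_
  rw [hterm j k c (by simpa [Nat.lt_succ_iff] using hc)]

end Coefficients

/-! ### The multiplication formulas -/

section Formulas

variable {n : ℕ}

theorem sum_single_entries (a b : Fin n) (c : ℤ) : ∑ i, ∑ j, Matrix.single a b c i j = c := by
  simp [sum_single_row]

theorem matUp_apply (A : Matrix (Fin n) (Fin n) ℕ) (a b : Fin n) (t : Fin n → ℕ) (i j : Fin n) :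
    matUp A a b t i j = A i j + (if i = a ∧ j ≠ a then (t j : ℤ) else 0)
      - (if i = b ∧ j ≠ b then (t j : ℤ) else 0) := by
  have h : ∀ c, (∑ u with u ≠ c, Matrix.single c u (t u : ℤ)) i j =
      if i = c ∧ j ≠ c then (t j : ℤ) else 0 := by
    intro c
    rw [Matrix.sum_apply, Finset.sum_filter, Finset.sum_eq_single j]
    · by_cases h1 : i = c
      · subst h1; simp
      · simp [h1, Ne.symm h1]
    · intro u _ hu
      simp [hu]
    · simp
  rw [matUp, Matrix.sub_apply, Matrix.add_apply, h, h, Matrix.map_apply]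

/-- The matrices in the formula keep their diagonals; on the other side, the units `t a` and `t b`
move in and out of the diagonal. -/
theorem matUp_add_diag (A : Matrix (Fin n) (Fin n) ℕ) (a b : Fin n) (t ν : Fin n → ℕ) :
    matUp A a b t + diag ν =
      moveAll (A.map (fun x => (x : ℤ)) + Matrix.diagonal (diagBefore a b t ν)) a b t := by
  ext i j
  rw [Matrix.add_apply, matUp_apply, moveAll_apply, Matrix.add_apply, Matrix.map_apply, diag]
  by_cases hij : i = j
  · subst hij
    rw [Matrix.diagonal_apply_eq, Matrix.diagonal_apply_eq, diagBefore]
    have h1 : ∀ c : Fin n, ¬ (i = c ∧ i ≠ c) := fun c h => h.2 h.1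
    simp only [h1, if_false]
    have h2 : ∀ c : Fin n, (if i = c then (t c : ℤ) else 0) = if i = c then (t i : ℤ) else 0 := by
      intro c
      split_ifs with h
      · rw [h]
      · rfl
    rw [h2, h2]
    ring
  · rw [Matrix.diagonal_apply_ne _ hij, Matrix.diagonal_apply_ne _ hij]
    have h1 : ∀ c : Fin n, (i = c ∧ j ≠ c) ↔ i = c :=
      fun c => ⟨fun h => h.1, fun h => ⟨h, fun h' => hij (h.trans h'.symm)⟩⟩
    simp only [h1]
    ring

theorem sum_matUp (A : Matrix (Fin n) (Fin n) ℕ) (a b : Fin n) (t : Fin n → ℕ) :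
    ∑ i, ∑ j, matUp A a b t i j =
      ∑ i, ∑ j, A.map (fun x => (x : ℤ)) i j - t a + t b := by
  have h := congrArg (fun B : Matrix (Fin n) (Fin n) ℤ => ∑ i, ∑ j, B i j)
    (matUp_add_diag A a b t 0)
  simp only [sum_moveAll] at h
  simp only [Matrix.add_apply, Finset.sum_add_distrib, sum_diag_row, Matrix.diagonal_apply,
    Finset.sum_ite_eq, Finset.mem_univ, if_true] at h
  simp only [diagBefore, Finset.sum_add_distrib, Finset.sum_sub_distrib, Finset.sum_ite_eq',
    Finset.mem_univ, if_true, Pi.zero_apply, Nat.cast_zero, Finset.sum_const_zero] at h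
  linarith

variable {S : Type*} [Semiring S] [Algebra K S] {r : ℕ} {κ : Fin n → ℤ} {a b : Fin n}
  {e : Matrix (Fin n) (Fin n) ℤ → S}

/-- Only one of the elements of a family with a fixed off-diagonal entry has a nonzero product
with `e A`. -/
theorem IsMulBasis.sum_mul (he : IsMulBasis r κ a b e) (hκ : Function.Injective κ)
    (hab : κ a < κ b) (m : ℕ) (A : Matrix (Fin n) (Fin n) ℤ) (hA : ∀ i j, 0 ≤ A i j)
    (hsum : ∑ i, ∑ j, A i j = (r : ℤ)) :
    (∑ γ ∈ Lam n ((r : ℤ) - m), e (Matrix.single a b (m : ℤ) + diag γ)) * e A =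
      ∑ t ∈ Lam n m, powCoef κ A a b t • e (moveAll A a b t) := by
  have hne : a ≠ b := by rintro rfl; exact lt_irrefl _ hab
  have hLam : Lam n (m : ℤ) = Finset.piAntidiag Finset.univ m := by
    ext t
    rw [mem_Lam, mem_compositions]
    exact_mod_cast Iff.rfl
  have hcol : ∀ (γ : Fin n → ℕ) (i : Fin n), ∑ k, (Matrix.single a b (m : ℤ) + diag γ) k i =
      (γ i : ℤ) + if i = b then (m : ℤ) else 0 := by
    intro γ i
    simp only [Matrix.add_apply, Finset.sum_add_distrib, sum_diag_col, sum_single_col]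
    ring
  rw [Finset.sum_mul]
  -- the only possible diagonal is given by the row sums of `A`; if it does not exist, the row `b`
  -- of `A` has less than `m` units to move, and both sides are zero
  by_cases hγ : ∃ γ : Fin n → ℕ, ∀ i, ∑ j, A i j = (γ i : ℤ) + if i = b then (m : ℤ) else 0
  · obtain ⟨γ, hγ⟩ := hγ
    rw [Finset.sum_eq_single γ, add_comm, he.pow hκ hab m γ A hA hγ hsum, hLam]
    · intro γ' _ hne'
      obtain ⟨i, hi⟩ := Function.ne_iff.mp hne'
      refine he.orth _ _ i ?_
      rw [hcol, hγ]
      intro h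
      exact hi (by exact_mod_cast add_right_cancel h)
    · intro h
      refine absurd (mem_Lam.mpr ?_) h
      rw [← hsum]
      simp only [hγ, Finset.sum_add_distrib, Finset.sum_ite_eq', Finset.mem_univ, if_true]
      ring
  · rw [Finset.sum_eq_zero, Finset.sum_eq_zero]
    · intro t ht
      rw [mem_Lam] at ht
      have hb : ∑ j, A b j < m := by
        by_contra hb
        push Not at hb
        refine hγ ⟨fun i => (∑ j, A i j - if i = b then (m : ℤ) else 0).toNat, fun i => ?_⟩
        have h0 : 0 ≤ ∑ j, A i j - if i = b then (m : ℤ) else 0 := by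
          split_ifs with hi
          · subst hi; omega
          · rw [sub_zero]; exact Finset.sum_nonneg fun j _ => hA i j
        rw [Int.toNat_of_nonneg h0, sub_add_cancel]
      have hneg : ∑ j, moveAll A a b t b j < 0 := by
        rw [sum_moveAll_row, if_neg hne.symm, if_pos rfl, ht]
        omega
      obtain ⟨j, -, hj⟩ := Finset.exists_lt_of_sum_lt
        (s := Finset.univ) (f := fun j => moveAll A a b t b j) (g := fun _ => 0)
        (by simpa using hneg)
      rw [he.neg _ _ _ hj, smul_zero]
    · intro γ _
      have : ∃ i, ∑ k, (Matrix.single a b (m : ℤ) + diag γ) k i ≠ ∑ j, A i j := by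
        by_contra h
        push Not at h
        exact hγ ⟨γ, fun i => by rw [← h, hcol]⟩
      obtain ⟨i, hi⟩ := this
      exact he.orth _ _ i hi

/-- Reindexing of the sum over the diagonals. The diagonals on the left with an entry at `b` that is
too small give matrices with a negative entry, and on the right a too small entry at `a` gives
the coefficient zero. -/
theorem IsMulBasis.sum_diagonals (he : IsMulBasis r κ a b e) (hab : a ≠ b)
    {A : Matrix (Fin n) (Fin n) ℕ} (hA : ∀ i, A i i = 0) (δ : Fin n → ℤ) (l t : Fin n → ℕ)
    (N : ℤ) :
    ∑ μ ∈ Lam n N, (v ^ (∑ i, (μ i : ℤ) * δ i) * qBinomVec (fun i => (μ i : ℤ)) l *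
        powCoef κ (A.map (fun x => (x : ℤ)) + diag μ) a b t) •
          e (moveAll (A.map (fun x => (x : ℤ)) + diag μ) a b t) =
    ∑ ν ∈ Lam n (N + t a - t b), (v ^ (∑ i, diagBefore a b t ν i * δ i) *
      qBinomVec (diagBefore a b t ν) l *
      powCoef κ (A.map (fun x => (x : ℤ)) + Matrix.diagonal (diagBefore a b t ν)) a b t) •
        e (matUp A a b t + diag ν) := by
  -- the diagonal after the move
  let after : (Fin n → ℕ) → Fin n → ℕ :=
    fun μ i => μ i + (if i = a then t a else 0) - (if i = b then t b else 0)
  have hb : ∀ μ : Fin n → ℕ, e (moveAll (A.map (fun x => (x : ℤ)) + diag μ) a b t) ≠ 0 →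
      t b ≤ μ b := by
    intro μ h
    by_contra hlt
    refine h (he.neg _ b b ?_)
    rw [moveAll_apply, Matrix.add_apply, Matrix.map_apply, hA, diag, Matrix.diagonal_apply_eq,
      if_neg hab.symm, if_pos rfl]
    push_cast
    omega
  have hcast : ∀ μ : Fin n → ℕ, t b ≤ μ b → ∀ i, ((after μ i : ℕ) : ℤ) =
      μ i + (if i = a then (t a : ℤ) else 0) - (if i = b then (t b : ℤ) else 0) := by
    intro μ h i
    simp only [after]
    by_cases hib : i = b
    · subst hib
      simp only [hab.symm, if_true, if_false]
      omega
    · simp only [hib, if_false]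
      split_ifs <;> simp
  have hbefore : ∀ μ : Fin n → ℕ, t b ≤ μ b →
      diagBefore a b t (after μ) = fun i => (μ i : ℤ) := by
    intro μ h
    funext i
    rw [diagBefore, hcast μ h]
    ring
  refine Finset.sum_bij_ne_zero (fun μ _ _ => after μ) ?_ ?_ ?_ ?_
  · intro μ hμ h
    have h1 := hb μ (right_ne_zero_of_smul h)
    rw [mem_Lam] at hμ ⊢
    simp only [hcast μ h1, Finset.sum_sub_distrib, Finset.sum_add_distrib, hμ, Finset.sum_ite_eq',
      Finset.mem_univ, if_true]
  · intro μ _ h μ' _ h' heq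
    have h1 := hbefore μ (hb μ (right_ne_zero_of_smul h))
    rw [heq, hbefore μ' (hb μ' (right_ne_zero_of_smul h'))] at h1
    funext i
    exact_mod_cast (congrFun h1 i).symm
  · intro ν hν h
    have ha : t a ≤ ν a := by
      by_contra hlt
      apply left_ne_zero_of_smul h
      rw [powCoef_eq hA hab, qBinom_eq_zero (by omega)]
      ring
    have hnn : ∀ i, 0 ≤ diagBefore a b t ν i := by
      intro i
      rw [diagBefore]
      by_cases hia : i = a
      · subst hia
        simp only [hab, if_true, if_false]
        omega
      · simp only [hia, if_false]
        split_ifs <;> omega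
    have hμ : ∀ i, (((diagBefore a b t ν i).toNat : ℕ) : ℤ) = diagBefore a b t ν i :=
      fun i => Int.toNat_of_nonneg (hnn i)
    have hdiag : diag (fun i => (diagBefore a b t ν i).toNat) =
        Matrix.diagonal (diagBefore a b t ν) := by
      rw [diag]; congr 1; funext i; exact hμ i
    have hμb : t b ≤ (diagBefore a b t ν b).toNat := by
      zify
      rw [hμ, diagBefore_right hab]
      omega
    refine ⟨fun i => (diagBefore a b t ν i).toNat, ?_, ?_, ?_⟩
    · rw [mem_Lam] at hν ⊢
      simp only [hμ]
      simp only [diagBefore, Finset.sum_sub_distrib, Finset.sum_add_distrib, hν,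
        Finset.sum_ite_eq', Finset.mem_univ, if_true]
      ring
    · simp only [hμ, hdiag]
      rw [← matUp_add_diag]
      exact h
    · funext i
      zify
      rw [hcast (fun i => (diagBefore a b t ν i).toNat) hμb, hμ, diagBefore]
      ring
  · intro μ _ h
    have h1 := hbefore μ (hb μ (right_ne_zero_of_smul h))
    rw [matUp_add_diag, h1]
    rfl

/-- Both multiplication formulas in one component, for every basis with the properties of
`IsMulBasis`. -/
theorem IsMulBasis.mul_formula (he : IsMulBasis r κ a b e) (hκ : Function.Injective κ)
    (hab : κ a < κ b) {A : Matrix (Fin n) (Fin n) ℕ} (hA : ∀ i, A i i = 0) (δ : Fin n → ℤ)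
    (l : Fin n → ℕ) (m : ℕ) :
    (∑ γ ∈ Lam n ((r : ℤ) - m), e (Matrix.single a b (m : ℤ) + diag γ)) *
      ∑ μ ∈ Lam n ((r : ℤ) - ∑ i, ∑ j, A.map (fun x => (x : ℤ)) i j),
        (v ^ (∑ i, (μ i : ℤ) * δ i) * qBinomVec (fun i => (μ i : ℤ)) l) •
          e (A.map (fun x => (x : ℤ)) + diag μ) =
    ∑ t ∈ Lam n m, ∑ j ∈ Finset.range (l a + 1), ∑ k ∈ Finset.range (l b + 1),
      ∑ c ∈ Finset.range (min (t a) j + 1), fKey κ A δ l a b t j c k •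
        ∑ ν ∈ Lam n ((r : ℤ) - ∑ i, ∑ j, matUp A a b t i j),
          (v ^ (∑ i, (ν i : ℤ) * (δ + alphaKey κ l a b t j c k) i) *
            qBinomVec (fun i => (ν i : ℤ)) (shift l (betaUp l a b t j c k))) •
              e (matUp A a b t + diag ν) := by
  have hne : a ≠ b := by rintro rfl; exact lt_irrefl _ hab
  rw [Finset.mul_sum]
  have h1 : ∀ μ ∈ Lam n ((r : ℤ) - ∑ i, ∑ j, A.map (fun x => (x : ℤ)) i j),
      (∑ γ ∈ Lam n ((r : ℤ) - m), e (Matrix.single a b (m : ℤ) + diag γ)) *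
        ((v ^ (∑ i, (μ i : ℤ) * δ i) * qBinomVec (fun i => (μ i : ℤ)) l) •
          e (A.map (fun x => (x : ℤ)) + diag μ)) =
      ∑ t ∈ Lam n m, (v ^ (∑ i, (μ i : ℤ) * δ i) * qBinomVec (fun i => (μ i : ℤ)) l *
        powCoef κ (A.map (fun x => (x : ℤ)) + diag μ) a b t) •
          e (moveAll (A.map (fun x => (x : ℤ)) + diag μ) a b t) := by
    intro μ hμ
    rw [mem_Lam] at hμ
    rw [mul_smul_comm, he.sum_mul hκ hab m, Finset.smul_sum]
    · simp only [smul_smul]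
    · intro i j
      rw [Matrix.add_apply, Matrix.map_apply, diag, Matrix.diagonal_apply]
      positivity
    · simp only [Matrix.add_apply, Finset.sum_add_distrib, sum_diag_row, hμ]
      ring
  rw [Finset.sum_congr rfl h1, Finset.sum_comm]
  refine Finset.sum_congr rfl fun t _ => ?_
  rw [he.sum_diagonals hne hA, sum_matUp,
    show ∀ x y z w : ℤ, x - (y - z + w) = x - y + z - w by intros; ring]
  simp only [← sum_fKey_mul hκ hA δ l hne, Finset.sum_smul, Finset.smul_sum, smul_smul]
  rw [Finset.sum_comm]
  refine Finset.sum_congr rfl fun j _ => ?_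
  rw [Finset.sum_comm]
  refine Finset.sum_congr rfl fun k _ => ?_
  rw [Finset.sum_comm]

end Formulas

section Keys

variable {n : ℕ}

/-- The convention for negative off-diagonal entries agrees with the definition by the sum, as then
all basis elements of the sum are zero. -/
theorem eltAt_eq (A : Matrix (Fin n) (Fin n) ℤ) (δ : Fin n → ℤ) (l : Fin n → ℕ) (r : ℕ) :
    eltAt A δ l r = ∑ μ ∈ Lam n ((r : ℤ) - ∑ i, ∑ j, A i j),
      (v ^ (∑ i, (μ i : ℤ) * δ i) * qBinomVec (fun i => (μ i : ℤ)) l) •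
        basisElt r (A + diag μ) := by
  unfold eltAt
  split_ifs with h
  · obtain ⟨i, j, hij, hneg⟩ := h
    refine (Finset.sum_eq_zero fun μ _ => ?_).symm
    rw [basisElt_eq_zero_of_neg r (i := i) (j := j), smul_zero]
    rwa [Matrix.add_apply, diag, Matrix.diagonal_apply_ne _ hij, add_zero]
  · rfl

theorem elt_one_single (a b : Fin n) (m r : ℕ) :
    elt₁ (Matrix.single a b (m : ℤ)) 0 r =
      ∑ γ ∈ Lam n ((r : ℤ) - m), basisElt r (Matrix.single a b (m : ℤ) + diag γ) := by
  simp [elt₁, sum_single_entries]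

/-- The multiplication formula in the product of all `q`-Schur algebras. -/
theorem elt_one_mul_elt {κ : Fin n → ℤ} {a b : Fin n}
    (he : ∀ r, IsMulBasis r κ a b (basisElt (n := n) r)) (hκ : Function.Injective κ)
    (hab : κ a < κ b) {A : Matrix (Fin n) (Fin n) ℕ} (hA : ∀ i, A i i = 0) (δ : Fin n → ℤ)
    (l : Fin n → ℕ) (m : ℕ) :
    elt₁ (Matrix.single a b (m : ℤ)) 0 * elt (A.map (fun x => (x : ℤ))) δ l =
      ∑ t ∈ Lam n m, ∑ j ∈ Finset.range (l a + 1), ∑ k ∈ Finset.range (l b + 1),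
        ∑ c ∈ Finset.range (min (t a) j + 1), fKey κ A δ l a b t j c k •
          elt (matUp A a b t) (δ + alphaKey κ l a b t j c k)
            (shift l (betaUp l a b t j c k)) := by
  funext r
  simp only [Pi.mul_apply, Finset.sum_apply, Pi.smul_apply, elt, eltAt_eq, elt_one_single]
  exact (he r).mul_formula hκ hab hA δ l m

theorem alphaUp_eq (l : Fin n → ℕ) (h h' : Fin n) (t : Fin n → ℕ) (j c k : ℕ) :
    alphaUp l h h' t j c k = alphaKey (fun a : Fin n => ((a : ℕ) : ℤ)) l h h' t j c k := by
  simp only [alphaUp, alphaKey, Nat.cast_lt, Fin.val_fin_lt]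

theorem fUp_eq (A : Matrix (Fin n) (Fin n) ℕ) (δ : Fin n → ℤ) (l : Fin n → ℕ) (h h' : Fin n)
    (t : Fin n → ℕ) (j c k : ℕ) :
    fUp A δ l h h' t j c k = fKey (fun a : Fin n => ((a : ℕ) : ℤ)) A δ l h h' t j c k := by
  simp only [fUp, fKey, gUp, gKey, Nat.cast_lt, Nat.cast_le, Fin.val_fin_lt, Fin.val_fin_le]

theorem alphaDown_eq (l : Fin n → ℕ) (h h' : Fin n) (t : Fin n → ℕ) (j c k : ℕ) :
    alphaDown l h h' t j c k = alphaKey (fun a : Fin n => -((a : ℕ) : ℤ)) l h' h t j c k := by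
  simp only [alphaDown, alphaKey, neg_lt_neg_iff, Nat.cast_lt, Fin.val_fin_lt]

theorem gDown_eq (A : Matrix (Fin n) (Fin n) ℕ) (δ : Fin n → ℤ) (h h' : Fin n)
    (t : Fin n → ℕ) (j k : ℕ) :
    gDown A δ h h' t j k = gKey (fun a : Fin n => -((a : ℕ) : ℤ)) A δ h' h t j k := by
  have hQ : ∑ u with u ≠ h ∧ u ≠ h', ∑ u' with u < u', (t u : ℤ) * t u' =
      ∑ u, ∑ u' with u' ≠ h' ∧ u' ≠ h ∧ u' < u, (t u : ℤ) * t u' := by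
    simp only [Finset.sum_filter]
    have h1 : ∀ u, (if u ≠ h ∧ u ≠ h' then ∑ u', if u < u' then (t u : ℤ) * t u' else 0 else 0) =
        ∑ u', if u ≠ h' ∧ u ≠ h ∧ u < u' then (t u' : ℤ) * t u else 0 := by
      intro u
      by_cases hu : u ≠ h ∧ u ≠ h'
      · simp only [hu.1, hu.2, mul_comm, ne_eq, not_false_eq_true, true_and, and_self, if_true]
      · rw [if_neg hu]
        refine (Finset.sum_eq_zero fun u' _ => if_neg ?_).symm
        exact fun h2 => hu ⟨h2.2.1, h2.1⟩
    rw [Finset.sum_congr rfl fun u _ => h1 u, Finset.sum_comm]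
  simp only [gDown, gKey, neg_lt_neg_iff, neg_le_neg_iff, Nat.cast_lt, Nat.cast_le,
    Fin.val_fin_lt, Fin.val_fin_le, hQ]
  ring

theorem fDown_eq (A : Matrix (Fin n) (Fin n) ℕ) (δ : Fin n → ℤ) (l : Fin n → ℕ) (h h' : Fin n)
    (t : Fin n → ℕ) (j c k : ℕ) :
    fDown A δ l h h' t j c k = fKey (fun a : Fin n => -((a : ℕ) : ℤ)) A δ l h' h t j c k := by
  rw [fDown, fKey, gDown_eq]

theorem matDown_eq (A : Matrix (Fin n) (Fin n) ℕ) (h h' : Fin n) (t : Fin n → ℕ) :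
    matDown A h h' t = matUp A h' h t := by
  rw [matDown, matUp, sub_add_eq_add_sub]

end Keys

end QSchur

end

open QSchur in
theorem lemma3p4 (n : ℕ) (A : Matrix (Fin n) (Fin n) ℕ) (hA : ∀ i, A i i = 0)
    (δ : Fin n → ℤ) (l : Fin n → ℕ) (m : ℕ) (h h' : Fin n) (hh' : (h' : ℕ) = h + 1) :
    ((∀ t ∈ Lam n m, ∀ j ≤ l h, ∀ k ≤ l h', ∀ c ≤ min (t h) j,
        fUp A δ l h h' t j c k ∈ laurent) ∧
      elt₁ (Matrix.single h h' (m : ℤ)) 0 * elt (A.map (fun a => (a : ℤ))) δ l =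
        ∑ t ∈ Lam n m, ∑ j ∈ Finset.range (l h + 1), ∑ k ∈ Finset.range (l h' + 1),
          ∑ c ∈ Finset.range (min (t h) j + 1),
            fUp A δ l h h' t j c k •
              elt (matUp A h h' t) (δ + alphaUp l h h' t j c k)
                (shift l (betaUp l h h' t j c k))) ∧
    ((∀ t ∈ Lam n m, ∀ j ≤ l h', ∀ k ≤ l h, ∀ c ≤ min (t h') j,
        fDown A δ l h h' t j c k ∈ laurent) ∧
      elt₁ (Matrix.single h' h (m : ℤ)) 0 * elt (A.map (fun a => (a : ℤ))) δ l =
        ∑ t ∈ Lam n m, ∑ j ∈ Finset.range (l h' + 1), ∑ k ∈ Finset.range (l h + 1),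
          ∑ c ∈ Finset.range (min (t h') j + 1),
            fDown A δ l h h' t j c k •
              elt (matDown A h h' t) (δ + alphaDown l h h' t j c k)
                (shift l (betaDown l h h' t j c k))) := by
  refine ⟨⟨fun t _ j _ k _ c hc => ?_, ?_⟩, ⟨fun t _ j _ k _ c hc => ?_, ?_⟩⟩
  · rw [fUp_eq]
    exact fKey_mem_laurent _ A δ l h h' t k hc
  · simp only [fUp_eq, alphaUp_eq]
    exact elt_one_mul_elt (fun r => isMulBasis_up r hh') valKey_injective (by simp [hh']) hA δ l m
  · rw [fDown_eq]
    exact fKey_mem_laurent _ A δ l h' h t k hc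
  · simp only [fDown_eq, alphaDown_eq, matDown_eq]
    exact elt_one_mul_elt (fun r => isMulBasis_down r hh')
      (fun _ _ hab => valKey_injective (neg_injective hab)) (by simp [hh']) hA δ l m
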